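/- Let $\Bbbk$ be a field and let $H$ be a bialgebra over $\Bbbk$. **Categories involved.** Let $\mathbf{Vec}$ be the category of $\Bbbk$-vector spaces, $\mathfrak{M}^H$ the monoidal category of right $H$-comodules (coaction $x\otimes y\mapsto x_{(0)}\otimes y_{(0)}\otimes x_{(1)}y_{(1)}$ on $X\otimes Y$), and ${}_H\mathfrak{M}$ the monoidal category of left $H$-modules (diagonal action on tensor products). A left $H$-module coalgebra is a coalgebra $C$ with a left $H$-module structure such that $\Delta(hc)=h_{(1)}c_{(1)}\otimes h_{(2)}c_{(2)}$ and $\varepsilon(hc)=\varepsilon(h)\varepsilon(c)$. For such a $C$: * the category $\mathfrak{M}^C$ of right $C$-comodules is a left $\mathfrak{M}^H$-module category by $(X,M)\mapsto X\otimes M$ with coaction $x\otimes m\mapsto x_{(0)}\otimes m_{(0)}\otimes x_{(1)}m_{(1)}$; * ${}_H\mathfrak{M}^C$ is the category of vector spaces $M$ that are left $H$-modules and right $C$-comodules with $\rho(hm)=h_{(1)}m_{(0)}\otimes h_{(2)}m_{(1)}$ (morphisms: $H$-linear $C$-colinear maps). It is a left ${}_H\mathfrak{M}$-module category by $(V,M)\mapsto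 V\otimes M$ with the diagonal action of $H$ and the coaction $v\otimes m\mapsto v\otimes m_{(0)}\otimes m_{(1)}$. The category $\mathfrak{M}^H$ acts on $\mathbf{Vec}$ from the left through the forgetful functor $\mathfrak{M}^H\to\mathbf{Vec}$. **Module functors.** A lax left $\mathcal{C}$-module functor $\mathcal{M}\to\mathcal{N}$ is a functor $F$ with a natural transformation $\xi_{X,M}:X\otimes F(M)\to F(X\otimes M)$ compatible with the associativity and the unit of the actions. It is strong if $\xi$ is invertible. Morphisms of lax module functors are the natural transformations that commute with the structure morphisms. Two left $\mathcal{C}$-module categories are equivalent if there are lax $\mathcal{C}$-module functors between them (linear ones, if the module categories are linear) whose composites in both orders are isomorphic, as lax module functors, to the identity functors. For $\Bbbk$-linear left $\mathfrak{M}^H$-module categories $\mathcal{M}$ and $\mathcal{N}$, let $\mathscr{L}^{\mathrm{lax}}_{\mathfrak{M}^H}(\mathcal{M},\mathcal{N})$ denote the category of those lax left $\mathfrak{M}^H$-module functors $\mathcal{M}\to\mathcal{N}$ whose underlying functor is $\Bbbk$-linear, left exact and preserves small coproducts. **The two 2-categories.** * $\mathfrak{M}^H\text{-}\mathbf{Mod}$: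 the 0-cells are the $\Bbbk$-linear left $\mathfrak{M}^H$-module categories that are equivalent to $\mathfrak{M}^C$ for some left $H$-module coalgebra $C$; the category of 1-cells from $\mathcal{M}$ to $\mathcal{N}$ is $\mathscr{L}^{\mathrm{lax}}_{\mathfrak{M}^H}(\mathcal{M},\mathcal{N})$. * ${}_H\mathfrak{M}\text{-}\mathbf{Mod}$: the 0-cells are the left ${}_H\mathfrak{M}$-module categories that are equivalent to ${}_H\mathfrak{M}^C$ for some left $H$-module coalgebra $C$; the category of 1-cells from $\mathcal{M}$ to $\mathcal{N}$ is the category of left exact strong left ${}_H\mathfrak{M}$-module functors $\mathcal{M}\to\mathcal{N}$ and morphisms of module functors. **The assignment.** For a 0-cell $\mathcal{M}$ of $\mathfrak{M}^H\text{-}\mathbf{Mod}$ put $\mathcal{M}_*=\mathscr{L}^{\mathrm{lax}}_{\mathfrak{M}^H}(\mathbf{Vec},\mathcal{M})$. An object $V\in{}_H\mathfrak{M}$ acts on $T\in\mathcal{M}_*$ by $V\otimes T=T\circ(-\otimes V)$, where $-\otimes V:\mathbf{Vec}\to\mathbf{Vec}$ is the lax left $\mathfrak{M}^H$-module functor with structure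 morphism $x\otimes(w\otimes v)\mapsto(x_{(0)}\otimes w)\otimes x_{(1)}v$. For a 1-cell $F:\mathcal{M}\to\mathcal{N}$ let $F_*:\mathcal{M}_*\to\mathcal{N}_*$, $T\mapsto F\circ T$, with identities $V\otimes F_*(T)=F_*(V\otimes T)$ as structure morphisms, and for a 2-cell $\theta:F\to G$ let $\theta_*:F_*\to G_*$ be given by $(\theta_*)_T=\theta T$. **Theorem.** For every 0-cell $\mathcal{M}$ of $\mathfrak{M}^H\text{-}\mathbf{Mod}$ the left ${}_H\mathfrak{M}$-module category $\mathcal{M}_*$ is a 0-cell of ${}_H\mathfrak{M}\text{-}\mathbf{Mod}$, and for every 1-cell $F$ of $\mathfrak{M}^H\text{-}\mathbf{Mod}$ the functor $F_*$ is left exact, hence a 1-cell of ${}_H\mathfrak{M}\text{-}\mathbf{Mod}$. The resulting 2-functor $$(-)_*:\mathfrak{M}^H\text{-}\mathbf{Mod}\to{}_H\mathfrak{M}\text{-}\mathbf{Mod},\qquad \mathcal{M}\mapsto\mathcal{M}_*=\mathscr{L}^{\mathrm{lax}}_{\mathfrak{M}^H}(\mathbf{Vec},\mathcal{M})$$ is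 a 2-equivalence: every 0-cell of ${}_H\mathfrak{M}\text{-}\mathbf{Mod}$ is equivalent, in this 2-category, to $\mathcal{M}_*$ for some 0-cell $\mathcal{M}$ of $\mathfrak{M}^H\text{-}\mathbf{Mod}$, and for all 0-cells $\mathcal{M}$ and $\mathcal{N}$ the functor $F\mapsto F_*$ from the category of 1-cells $\mathcal{M}\to\mathcal{N}$ to the category of 1-cells $\mathcal{M}_*\to\mathcal{N}_*$ is an equivalence of categories. -/

import Mathlib

open CategoryTheory MonoidalCategory MonoidalLeftAction Limits

universe v w u

set_option linter.checkUnivs false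

noncomputable section

namespace ModuleDuality

section Comodules

open scoped TensorProduct

section LinearAlgebra

variable {k : Type u} [Field k] {H : Type u} [Ring H] [Bialgebra k H]

/-- The diagonal action `h · (v ⊗ w) = h₍₁₎ v ⊗ h₍₂₎ w` of a bialgebra on a tensor product. -/
def diagAct {V W : Type u} [AddCommGroup V] [Module k V] [AddCommGroup W] [Module k W]
    (a : H →ₐ[k] Module.End k V) (b : H →ₐ[k] Module.End k W) :
    H →ₐ[k] Module.End k (V ⊗[k] W) :=
  (Module.endTensorEndAlgHom (R := k) (S := k) (A := k)).comp
    ((Algebra.TensorProduct.map a b).comp (Bialgebra.comulAlgHom k H))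

/-- The trivial action `h · c = ε(h) c` of a bialgebra on the ground field. -/
def trivAct (k : Type u) [Field k] (H : Type u) [Ring H] [Bialgebra k H] :
    H →ₐ[k] Module.End k k :=
  (Algebra.ofId k (Module.End k k)).comp (Bialgebra.counitAlgHom k H)

/-- An action of `H` on a coalgebra `C` makes it a left `H`-module coalgebra if the
comultiplication and the counit are `H`-linear:
`Δ(h c) = h₍₁₎ c₍₁₎ ⊗ h₍₂₎ c₍₂₎` and `ε(h c) = ε(h) ε(c)`. -/
structure IsModuleCoalgebra {C : Type u} [AddCommGroup C] [Module k C] [Coalgebra k C]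
    (a : H →ₐ[k] Module.End k C) : Prop where
  comul_act : ∀ (h : H) (c : C),
    Coalgebra.comul (R := k) (a h c) = diagAct a a h (Coalgebra.comul (R := k) c)
  counit_act : ∀ (h : H) (c : C),
    Coalgebra.counit (R := k) (a h c) =
      Coalgebra.counit (R := k) h * Coalgebra.counit (R := k) c

/-- The linear map `(x ⊗ h) ⊗ (m ⊗ c) ↦ (x ⊗ m) ⊗ h c`. -/
def mix {C : Type u} [AddCommGroup C] [Module k C] (a : H →ₐ[k] Module.End k C)
    (X M : Type u) [AddCommGroup X] [Module k X] [AddCommGroup M] [Module k M] :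
    (X ⊗[k] H) ⊗[k] (M ⊗[k] C) →ₗ[k] (X ⊗[k] M) ⊗[k] C :=
  LinearMap.lTensor (X ⊗[k] M) (TensorProduct.lift a.toLinearMap) ∘ₗ
    (TensorProduct.tensorTensorTensorComm k X H M C).toLinearMap

section

variable {C : Type u} [AddCommGroup C] [Module k C] (a : H →ₐ[k] Module.End k C)
  {X M : Type u} [AddCommGroup X] [Module k X] [AddCommGroup M] [Module k M]

@[simp]
theorem mix_tmul (x : X) (h : H) (m : M) (c : C) :
    mix a X M ((x ⊗ₜ h) ⊗ₜ (m ⊗ₜ c)) = (x ⊗ₜ m) ⊗ₜ[k] a h c := by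
  simp [mix]

/-- The linear map `(x ⊗ (h ⊗ h')) ⊗ (m ⊗ (c ⊗ c')) ↦ (x ⊗ m) ⊗ (h c ⊗ h' c')`. -/
def mix₂ (X M : Type u) [AddCommGroup X] [Module k X] [AddCommGroup M] [Module k M] :
    (X ⊗[k] (H ⊗[k] H)) ⊗[k] (M ⊗[k] (C ⊗[k] C)) →ₗ[k] (X ⊗[k] M) ⊗[k] (C ⊗[k] C) :=
  LinearMap.lTensor (X ⊗[k] M)
    (TensorProduct.map (TensorProduct.lift a.toLinearMap) (TensorProduct.lift a.toLinearMap) ∘ₗ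
      (TensorProduct.tensorTensorTensorComm k H H C C).toLinearMap) ∘ₗ
    (TensorProduct.tensorTensorTensorComm k X (H ⊗[k] H) M (C ⊗[k] C)).toLinearMap

@[simp]
theorem mix₂_tmul (x : X) (h h' : H) (m : M) (c c' : C) :
    mix₂ a X M ((x ⊗ₜ (h ⊗ₜ h')) ⊗ₜ (m ⊗ₜ (c ⊗ₜ c'))) =
      (x ⊗ₜ m) ⊗ₜ[k] (a h c ⊗ₜ[k] a h' c') := by
  simp [mix₂]

theorem mix₂_diag (x : X) (m : M) (s : H ⊗[k] H) (t : C ⊗[k] C) :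
    mix₂ a X M ((x ⊗ₜ s) ⊗ₜ (m ⊗ₜ t)) =
      (x ⊗ₜ m) ⊗ₜ[k] ((Module.endTensorEndAlgHom (R := k) (S := k) (A := k))
        (Algebra.TensorProduct.map a a s)) t := by
  induction s with
  | zero => simp
  | add s s' hs hs' => simp only [TensorProduct.tmul_add, TensorProduct.add_tmul, map_add, hs, hs',
      LinearMap.add_apply]
  | tmul h h' =>
    induction t with
    | zero => simp
    | add s s' hs hs' => simp only [TensorProduct.tmul_add, map_add, hs, hs']
    | tmul c c' => simp [Module.endTensorEndAlgHom_apply]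

theorem assoc_mix (h : H) (c : C) (s : X ⊗[k] H) (t : M ⊗[k] C) :
    TensorProduct.assoc k (X ⊗[k] M) C C (mix a X M (s ⊗ₜ t) ⊗ₜ a h c) =
      mix₂ a X M ((TensorProduct.assoc k X H H (s ⊗ₜ h)) ⊗ₜ
        (TensorProduct.assoc k M C C (t ⊗ₜ c))) := by
  induction s with
  | zero => simp
  | add s s' hs hs' => simp only [TensorProduct.add_tmul, map_add, hs, hs']
  | tmul x h' =>
    induction t with
    | zero => simp
    | add s s' hs hs' => simp only [TensorProduct.tmul_add, TensorProduct.add_tmul, map_add, hs, hs']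
    | tmul m c' => simp


theorem rTensor_mix {X' M' : Type u} [AddCommGroup X'] [Module k X'] [AddCommGroup M'] [Module k M']
    (f : X →ₗ[k] X') (g : M →ₗ[k] M') :
    (TensorProduct.map f g).rTensor C ∘ₗ mix a X M =
      mix a X' M' ∘ₗ TensorProduct.map (f.rTensor H) (g.rTensor C) := by
  ext x h m c
  simp

/-- The coaction `x ⊗ m ↦ x₍₀₎ ⊗ m₍₀₎ ⊗ x₍₁₎ m₍₁₎` on the tensor product of an `H`-comodule and a
`C`-comodule, where `C` carries the action `a` of `H`. -/
def tensorCoact (ρ : X →ₗ[k] X ⊗[k] H) (σ : M →ₗ[k] M ⊗[k] C) :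
    X ⊗[k] M →ₗ[k] (X ⊗[k] M) ⊗[k] C :=
  mix a X M ∘ₗ TensorProduct.map ρ σ

theorem tensorCoact_map {X' M' : Type u} [AddCommGroup X'] [Module k X'] [AddCommGroup M']
    [Module k M'] {ρ : X →ₗ[k] X ⊗[k] H} {σ : M →ₗ[k] M ⊗[k] C}
    {ρ' : X' →ₗ[k] X' ⊗[k] H} {σ' : M' →ₗ[k] M' ⊗[k] C} {f : X →ₗ[k] X'} {g : M →ₗ[k] M'}
    (hf : ρ' ∘ₗ f = f.rTensor H ∘ₗ ρ) (hg : σ' ∘ₗ g = g.rTensor C ∘ₗ σ) :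
    tensorCoact a ρ' σ' ∘ₗ TensorProduct.map f g =
      (TensorProduct.map f g).rTensor C ∘ₗ tensorCoact a ρ σ := by
  rw [tensorCoact, tensorCoact, ← LinearMap.comp_assoc, rTensor_mix, LinearMap.comp_assoc,
    LinearMap.comp_assoc, ← TensorProduct.map_comp, ← TensorProduct.map_comp, hf, hg]

theorem mix_assoc {Y : Type u} [AddCommGroup Y] [Module k Y] (r : X ⊗[k] H) (s : Y ⊗[k] H)
    (t : M ⊗[k] C) :
    mix a X (Y ⊗[k] M) (r ⊗ₜ mix a Y M (s ⊗ₜ t)) =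
      (TensorProduct.assoc k X Y M).toLinearMap.rTensor C
        (mix a (X ⊗[k] Y) M (mix (Algebra.lmul k H) X Y (r ⊗ₜ s) ⊗ₜ t)) := by
  have h1 : mix a X (Y ⊗[k] M) ∘ₗ (mix a Y M).lTensor (X ⊗[k] H) ∘ₗ
      (TensorProduct.assoc k (X ⊗[k] H) (Y ⊗[k] H) (M ⊗[k] C)).toLinearMap =
      (TensorProduct.assoc k X Y M).toLinearMap.rTensor C ∘ₗ mix a (X ⊗[k] Y) M ∘ₗ
        (mix (Algebra.lmul k H) X Y).rTensor (M ⊗[k] C) := by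
    ext x h y h' m c
    simp
  simpa using LinearMap.congr_fun h1 ((r ⊗ₜ s) ⊗ₜ t)

theorem mix_unit (t : M ⊗[k] C) :
    (TensorProduct.lid k M).toLinearMap.rTensor C (mix a k M ((1 ⊗ₜ 1) ⊗ₜ t)) = t := by
  have h1 : (TensorProduct.lid k M).toLinearMap.rTensor C ∘ₗ mix a k M ∘ₗ
      TensorProduct.mk k (k ⊗[k] H) (M ⊗[k] C) (1 ⊗ₜ 1) = LinearMap.id := by
    ext m c
    simp
  exact LinearMap.congr_fun h1 t

theorem tensorCoact_assoc {Y : Type u} [AddCommGroup Y] [Module k Y] (ρ : X →ₗ[k] X ⊗[k] H)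
    (ρ' : Y →ₗ[k] Y ⊗[k] H) (σ : M →ₗ[k] M ⊗[k] C) :
    tensorCoact a ρ (tensorCoact a ρ' σ) ∘ₗ (TensorProduct.assoc k X Y M).toLinearMap =
      (TensorProduct.assoc k X Y M).toLinearMap.rTensor C ∘ₗ
        tensorCoact a (tensorCoact (Algebra.lmul k H) ρ ρ') σ := by
  ext x y m
  simpa [tensorCoact] using mix_assoc a (ρ x) (ρ' y) (σ m)

theorem tensorCoact_unit (σ : M →ₗ[k] M ⊗[k] C) :
    σ ∘ₗ (TensorProduct.lid k M).toLinearMap =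
      (TensorProduct.lid k M).toLinearMap.rTensor C ∘ₗ
        tensorCoact a ((TensorProduct.mk k k H).flip 1) σ := by
  ext m
  simpa [tensorCoact] using (mix_unit a (σ m)).symm

theorem tensorCoact_lmul_unit (ρ : X →ₗ[k] X ⊗[k] H) :
    ρ ∘ₗ (TensorProduct.rid k X).toLinearMap =
      (TensorProduct.rid k X).toLinearMap.rTensor H ∘ₗ
        tensorCoact (Algebra.lmul k H) ρ ((TensorProduct.mk k k H).flip 1) := by
  have h1 : (TensorProduct.rid k X).toLinearMap.rTensor H ∘ₗ mix (Algebra.lmul k H) X k ∘ₗ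
      (TensorProduct.mk k (X ⊗[k] H) (k ⊗[k] H)).flip (1 ⊗ₜ 1) = LinearMap.id := by
    ext x h
    simp
  ext x
  simpa [tensorCoact] using (LinearMap.congr_fun h1 (ρ x)).symm

variable [Coalgebra k C]

theorem tensorCoact_coassoc (ha : IsModuleCoalgebra a) (ρ : X →ₗ[k] X ⊗[k] H)
    (σ : M →ₗ[k] M ⊗[k] C)
    (hρ : (TensorProduct.assoc k X H H).toLinearMap ∘ₗ ρ.rTensor H ∘ₗ ρ =
      (Coalgebra.comul (R := k) (A := H)).lTensor X ∘ₗ ρ)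
    (hσ : (TensorProduct.assoc k M C C).toLinearMap ∘ₗ σ.rTensor C ∘ₗ σ =
      (Coalgebra.comul (R := k) (A := C)).lTensor M ∘ₗ σ) :
    (TensorProduct.assoc k (X ⊗[k] M) C C).toLinearMap ∘ₗ (tensorCoact a ρ σ).rTensor C ∘ₗ
        tensorCoact a ρ σ =
      (Coalgebra.comul (R := k) (A := C)).lTensor (X ⊗[k] M) ∘ₗ tensorCoact a ρ σ := by
  have h1 : (TensorProduct.assoc k (X ⊗[k] M) C C).toLinearMap ∘ₗ (tensorCoact a ρ σ).rTensor C ∘ₗ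
      mix a X M = mix₂ a X M ∘ₗ TensorProduct.map
        ((TensorProduct.assoc k X H H).toLinearMap ∘ₗ ρ.rTensor H)
        ((TensorProduct.assoc k M C C).toLinearMap ∘ₗ σ.rTensor C) := by
    ext x h m c
    simpa [tensorCoact] using assoc_mix a h c (ρ x) (σ m)
  have h2 : (Coalgebra.comul (R := k) (A := C)).lTensor (X ⊗[k] M) ∘ₗ mix a X M =
      mix₂ a X M ∘ₗ TensorProduct.map ((Coalgebra.comul (R := k) (A := H)).lTensor X)
        ((Coalgebra.comul (R := k) (A := C)).lTensor M) := by
    ext x h m c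
    simpa [ha.comul_act, diagAct] using (mix₂_diag a x m (Coalgebra.comul (R := k) h)
      (Coalgebra.comul (R := k) c)).symm
  calc _ = ((TensorProduct.assoc k (X ⊗[k] M) C C).toLinearMap ∘ₗ
        (tensorCoact a ρ σ).rTensor C ∘ₗ mix a X M) ∘ₗ TensorProduct.map ρ σ := rfl
    _ = mix₂ a X M ∘ₗ TensorProduct.map
        ((TensorProduct.assoc k X H H).toLinearMap ∘ₗ ρ.rTensor H ∘ₗ ρ)
        ((TensorProduct.assoc k M C C).toLinearMap ∘ₗ σ.rTensor C ∘ₗ σ) := by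
      rw [h1, LinearMap.comp_assoc, ← TensorProduct.map_comp]; rfl
    _ = ((Coalgebra.comul (R := k) (A := C)).lTensor (X ⊗[k] M) ∘ₗ mix a X M) ∘ₗ
        TensorProduct.map ρ σ := by
      rw [h2, hρ, hσ, TensorProduct.map_comp]; rfl
    _ = _ := rfl

theorem tensorCoact_counit (ha : IsModuleCoalgebra a) (ρ : X →ₗ[k] X ⊗[k] H)
    (σ : M →ₗ[k] M ⊗[k] C)
    (hρ : (Coalgebra.counit (R := k) (A := H)).lTensor X ∘ₗ ρ = (TensorProduct.mk k X k).flip 1)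
    (hσ : (Coalgebra.counit (R := k) (A := C)).lTensor M ∘ₗ σ = (TensorProduct.mk k M k).flip 1) :
    (Coalgebra.counit (R := k) (A := C)).lTensor (X ⊗[k] M) ∘ₗ tensorCoact a ρ σ =
      (TensorProduct.mk k (X ⊗[k] M) k).flip 1 := by
  have h1 : (Coalgebra.counit (R := k) (A := C)).lTensor (X ⊗[k] M) ∘ₗ mix a X M =
      ((TensorProduct.lid k k).toLinearMap.lTensor (X ⊗[k] M) ∘ₗ
        (TensorProduct.tensorTensorTensorComm k X k M k).toLinearMap) ∘ₗ
      TensorProduct.map ((Coalgebra.counit (R := k) (A := H)).lTensor X)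
        ((Coalgebra.counit (R := k) (A := C)).lTensor M) := by
    ext x h m c
    simp [ha.counit_act]
  rw [tensorCoact, ← LinearMap.comp_assoc, h1, LinearMap.comp_assoc, ← TensorProduct.map_comp,
    hρ, hσ]
  ext x m
  simp

end


section DiagAct

variable {V W U V' W' : Type u} [AddCommGroup V] [Module k V] [AddCommGroup W] [Module k W]
  [AddCommGroup U] [Module k U] [AddCommGroup V'] [Module k V'] [AddCommGroup W'] [Module k W']

theorem diagAct_map {a : H →ₐ[k] Module.End k V} {b : H →ₐ[k] Module.End k W}
    {a' : H →ₐ[k] Module.End k V'} {b' : H →ₐ[k] Module.End k W'} {f : V →ₗ[k] V'}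
    {g : W →ₗ[k] W'} (hf : ∀ h v, f (a h v) = a' h (f v)) (hg : ∀ h w, g (b h w) = b' h (g w))
    (h : H) (t : V ⊗[k] W) :
    TensorProduct.map f g (diagAct a b h t) = diagAct a' b' h (TensorProduct.map f g t) := by
  simp only [diagAct, AlgHom.comp_apply]
  generalize (Bialgebra.comulAlgHom k H) h = s
  induction s with
  | zero => simp
  | add s s' hs hs' => simp only [map_add, hs, hs', LinearMap.add_apply]
  | tmul x y =>
    induction t with
    | zero => simp
    | add s s' hs hs' => simp only [map_add, hs, hs']
    | tmul c d => simp [Module.endTensorEndAlgHom_apply, hf, hg]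

theorem diagAct_assoc (a : H →ₐ[k] Module.End k V) (b : H →ₐ[k] Module.End k W)
    (c : H →ₐ[k] Module.End k U) (h : H) (t : (V ⊗[k] W) ⊗[k] U) :
    TensorProduct.assoc k V W U (diagAct (diagAct a b) c h t) =
      diagAct a (diagAct b c) h (TensorProduct.assoc k V W U t) := by
  let E : H ⊗[k] (H ⊗[k] H) →ₐ[k] Module.End k (V ⊗[k] (W ⊗[k] U)) :=
    (Module.endTensorEndAlgHom (R := k) (S := k) (A := k)).comp
      (Algebra.TensorProduct.map a ((Module.endTensorEndAlgHom (R := k) (S := k) (A := k)).comp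
        (Algebra.TensorProduct.map b c)))
  have h1 : ∀ s : H ⊗[k] H, (Module.endTensorEndAlgHom (R := k) (S := k) (A := k))
      (Algebra.TensorProduct.map a (diagAct b c) s) =
      E ((Coalgebra.comul (R := k) (A := H)).lTensor H s) := by
    intro s
    induction s with
    | zero => simp
    | add s s' hs hs' => simp only [map_add, hs, hs']
    | tmul x y => simp [E, diagAct]
  have h2 : ∀ s : H ⊗[k] H, TensorProduct.assoc k V W U
      ((Module.endTensorEndAlgHom (R := k) (S := k) (A := k))
        (Algebra.TensorProduct.map (diagAct a b) c s) t) =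
      E (TensorProduct.assoc k H H H ((Coalgebra.comul (R := k) (A := H)).rTensor H s))
        (TensorProduct.assoc k V W U t) := by
    intro s
    induction s with
    | zero => simp
    | add s s' hs hs' => simp only [map_add, hs, hs', LinearMap.add_apply]
    | tmul x y =>
      simp only [LinearMap.rTensor_tmul, Algebra.TensorProduct.map_tmul, diagAct,
        AlgHom.comp_apply, Bialgebra.comulAlgHom_apply]
      generalize Coalgebra.comul (R := k) x = r
      induction r with
      | zero => simp
      | add s s' hs hs' =>
        simp only [TensorProduct.add_tmul, map_add, LinearMap.add_apply, hs, hs']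
      | tmul x' x'' =>
        induction t with
        | zero => simp
        | add s s' hs hs' => simp only [map_add, hs, hs']
        | tmul p u =>
          induction p with
          | zero => simp
          | add s s' hs hs' => simp only [TensorProduct.add_tmul, map_add, hs, hs']
          | tmul v w => simp [E, Module.endTensorEndAlgHom_apply]
  have h3 := h1 (Bialgebra.comulAlgHom k H h)
  have h4 := h2 (Bialgebra.comulAlgHom k H h)
  have h5 : TensorProduct.assoc k H H H ((Coalgebra.comul (R := k) (A := H)).rTensor H
      (Bialgebra.comulAlgHom k H h)) =
      (Coalgebra.comul (R := k) (A := H)).lTensor H (Bialgebra.comulAlgHom k H h) := by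
    simp
  rw [h5, ← h3] at h4
  exact h4

theorem diagAct_trivAct_left (b : H →ₐ[k] Module.End k W) (h : H) (t : k ⊗[k] W) :
    TensorProduct.lid k W (diagAct (trivAct k H) b h t) = b h (TensorProduct.lid k W t) := by
  have h1 : ∀ s : H ⊗[k] H, TensorProduct.lid k W
      ((Module.endTensorEndAlgHom (R := k) (S := k) (A := k))
        (Algebra.TensorProduct.map (trivAct k H) b s) t) =
      b (TensorProduct.lid k H ((Coalgebra.counit (R := k) (A := H)).rTensor H s))
        (TensorProduct.lid k W t) := by
    intro s
    induction s with
    | zero => simp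
    | add s s' hs hs' => simp only [map_add, hs, hs', LinearMap.add_apply]
    | tmul x y =>
      induction t with
      | zero => simp
      | add s s' hs hs' => simp only [map_add, hs, hs']
      | tmul c d => 
        simp only [Algebra.TensorProduct.map_tmul, Module.endTensorEndAlgHom_apply, trivAct,
          TensorProduct.AlgebraTensorModule.map_tmul, AlgHom.comp_apply, Algebra.ofId_apply]
        simp [mul_smul]
        exact smul_comm _ _ _
  rw [diagAct, AlgHom.comp_apply, AlgHom.comp_apply, h1]
  simp

theorem diagAct_trivAct_right (b : H →ₐ[k] Module.End k W) (h : H) (t : W ⊗[k] k) :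
    TensorProduct.rid k W (diagAct b (trivAct k H) h t) = b h (TensorProduct.rid k W t) := by
  have h1 : ∀ s : H ⊗[k] H, TensorProduct.rid k W
      ((Module.endTensorEndAlgHom (R := k) (S := k) (A := k))
        (Algebra.TensorProduct.map b (trivAct k H) s) t) =
      b (TensorProduct.rid k H ((Coalgebra.counit (R := k) (A := H)).lTensor H s))
        (TensorProduct.rid k W t) := by
    intro s
    induction s with
    | zero => simp
    | add s s' hs hs' => simp only [map_add, hs, hs', LinearMap.add_apply]
    | tmul x y =>
      induction t with
      | zero => simp
      | add s s' hs hs' => simp only [map_add, hs, hs']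
      | tmul c d => 
        simp only [Algebra.TensorProduct.map_tmul, Module.endTensorEndAlgHom_apply, trivAct,
          TensorProduct.AlgebraTensorModule.map_tmul, AlgHom.comp_apply, Algebra.ofId_apply]
        simp [mul_smul]
        exact smul_comm _ _ _
  rw [diagAct, AlgHom.comp_apply, AlgHom.comp_apply, h1]
  simp

end DiagAct

section Twist

variable {X W V V' : Type u} [AddCommGroup X] [Module k X] [AddCommGroup W] [Module k W]
  [AddCommGroup V] [Module k V] [AddCommGroup V'] [Module k V']

/-- The linear map `x ⊗ (w ⊗ v) ↦ (x₍₀₎ ⊗ w) ⊗ x₍₁₎ v`. -/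
def twist (a : H →ₐ[k] Module.End k V) (ρ : X →ₗ[k] X ⊗[k] H)
    (W : Type u) [AddCommGroup W] [Module k W] :
    X ⊗[k] (W ⊗[k] V) →ₗ[k] (X ⊗[k] W) ⊗[k] V :=
  mix a X W ∘ₗ ρ.rTensor (W ⊗[k] V)

@[simp]
theorem twist_tmul (a : H →ₐ[k] Module.End k V) (ρ : X →ₗ[k] X ⊗[k] H) (x : X)
    (t : W ⊗[k] V) : twist a ρ W (x ⊗ₜ t) = mix a X W (ρ x ⊗ₜ t) := by
  simp [twist]

theorem twist_natural_left {X' : Type u} [AddCommGroup X'] [Module k X']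
    (a : H →ₐ[k] Module.End k V) {ρ : X →ₗ[k] X ⊗[k] H}
    {ρ' : X' →ₗ[k] X' ⊗[k] H} {f : X →ₗ[k] X'} (hf : ρ' ∘ₗ f = f.rTensor H ∘ₗ ρ) :
    twist a ρ' W ∘ₗ f.rTensor (W ⊗[k] V) = (f.rTensor W).rTensor V ∘ₗ twist a ρ W := by
  have h1 := rTensor_mix a f (LinearMap.id (R := k) (M := W))
  ext x w v
  have h2 := LinearMap.congr_fun h1 (ρ x ⊗ₜ (w ⊗ₜ v))
  have h3 := LinearMap.congr_fun hf x
  simp only [LinearMap.comp_apply] at h3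
  simp only [LinearMap.comp_apply, TensorProduct.map_tmul, LinearMap.rTensor_tmul,
    LinearMap.id_apply] at h2
  simp only [TensorProduct.AlgebraTensorModule.curry_apply, LinearMap.comp_apply,
    LinearMap.restrictScalars_self, TensorProduct.curry_apply, LinearMap.rTensor_tmul, twist_tmul,
    h3, ← h2]
  rfl

theorem twist_natural_right {W' : Type u} [AddCommGroup W'] [Module k W']
    (a : H →ₐ[k] Module.End k V) (ρ : X →ₗ[k] X ⊗[k] H) (g : W →ₗ[k] W') :
    twist a ρ W' ∘ₗ (g.rTensor V).lTensor X = (g.lTensor X).rTensor V ∘ₗ twist a ρ W := by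
  have h1 := rTensor_mix a (LinearMap.id (R := k) (M := X)) g
  ext x w v
  have h2 := LinearMap.congr_fun h1 (ρ x ⊗ₜ (w ⊗ₜ v))
  simp only [LinearMap.comp_apply, TensorProduct.map_tmul, LinearMap.rTensor_tmul,
    LinearMap.id_apply, LinearMap.rTensor_id] at h2
  simp [← h2, LinearMap.lTensor]

theorem twist_map {a : H →ₐ[k] Module.End k V} {b : H →ₐ[k] Module.End k V'}
    (ρ : X →ₗ[k] X ⊗[k] H) {f : V →ₗ[k] V'} (hf : ∀ h v, f (a h v) = b h (f v)) :
    twist b ρ W ∘ₗ (f.lTensor W).lTensor X = f.lTensor (X ⊗[k] W) ∘ₗ twist a ρ W := by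
  have h1 : mix b X W ∘ₗ (f.lTensor W).lTensor (X ⊗[k] H) =
      f.lTensor (X ⊗[k] W) ∘ₗ mix a X W := by
    ext x h w v
    simp [hf]
  ext x w v
  simpa using LinearMap.congr_fun h1 (ρ x ⊗ₜ (w ⊗ₜ v))

theorem twist_assoc {Y : Type u} [AddCommGroup Y] [Module k Y] (a : H →ₐ[k] Module.End k V)
    (ρ : X →ₗ[k] X ⊗[k] H) (ρ' : Y →ₗ[k] Y ⊗[k] H) :
    (TensorProduct.assoc k X Y W).toLinearMap.rTensor V ∘ₗ
        twist a (tensorCoact (Algebra.lmul k H) ρ ρ') W =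
      twist a ρ (Y ⊗[k] W) ∘ₗ (twist a ρ' W).lTensor X ∘ₗ
        (TensorProduct.assoc k X Y (W ⊗[k] V)).toLinearMap := by
  ext x y w v
  simpa [tensorCoact] using (mix_assoc a (ρ x) (ρ' y) (w ⊗ₜ v)).symm

theorem twist_unit (a : H →ₐ[k] Module.End k V) :
    (TensorProduct.lid k W).toLinearMap.rTensor V ∘ₗ
        twist a ((TensorProduct.mk k k H).flip 1) W =
      (TensorProduct.lid k (W ⊗[k] V)).toLinearMap := by
  ext w v
  simp

theorem twist_diagAct (a : H →ₐ[k] Module.End k V) (b : H →ₐ[k] Module.End k V')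
    {ρ : X →ₗ[k] X ⊗[k] H} (hρ : (TensorProduct.assoc k X H H).toLinearMap ∘ₗ ρ.rTensor H ∘ₗ ρ =
      (Coalgebra.comul (R := k) (A := H)).lTensor X ∘ₗ ρ) :
    (TensorProduct.assoc k (X ⊗[k] W) V V').symm.toLinearMap ∘ₗ twist (diagAct a b) ρ W =
      (twist a ρ W).rTensor V' ∘ₗ twist b ρ (W ⊗[k] V) ∘ₗ
        (TensorProduct.assoc k W V V').symm.toLinearMap.lTensor X := by
  ext x w v v'
  let Θ : X ⊗[k] (H ⊗[k] H) →ₗ[k] ((X ⊗[k] W) ⊗[k] V) ⊗[k] V' :=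
    (TensorProduct.assoc k (X ⊗[k] W) V V').symm.toLinearMap ∘ₗ
      TensorProduct.map ((TensorProduct.mk k X W).flip w)
        (TensorProduct.map (a.toLinearMap.flip v) (b.toLinearMap.flip v'))
  have h1 : ∀ s : X ⊗[k] H, (TensorProduct.assoc k (X ⊗[k] W) V V').symm
      (mix (diagAct a b) X W (s ⊗ₜ (w ⊗ₜ (v ⊗ₜ v')))) =
      Θ ((Coalgebra.comul (R := k) (A := H)).lTensor X s) := by
    intro s
    induction s with
    | zero => simp
    | add s s' hs hs' => simp only [TensorProduct.add_tmul, map_add, hs, hs']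
    | tmul x h =>
      simp only [mix_tmul, LinearMap.lTensor_tmul, diagAct, AlgHom.comp_apply,
        Bialgebra.comulAlgHom_apply]
      generalize Coalgebra.comul (R := k) h = r
      induction r with
      | zero => simp
      | add s s' hs hs' =>
        simp only [TensorProduct.tmul_add, map_add, LinearMap.add_apply, hs, hs']
      | tmul h h' => simp [Θ, Module.endTensorEndAlgHom_apply]
  have h2 : ∀ s : X ⊗[k] H, (twist a ρ W).rTensor V'
      (mix b X (W ⊗[k] V) (s ⊗ₜ ((w ⊗ₜ v) ⊗ₜ v'))) =
      Θ (TensorProduct.assoc k X H H (ρ.rTensor H s)) := by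
    intro s
    induction s with
    | zero => simp
    | add s s' hs hs' => simp only [TensorProduct.add_tmul, map_add, hs, hs']
    | tmul x h =>
      simp only [mix_tmul, LinearMap.rTensor_tmul, twist_tmul]
      generalize ρ x = r
      induction r with
      | zero => simp
      | add s s' hs hs' =>
        simp only [TensorProduct.add_tmul, map_add, hs, hs']
      | tmul h h' => simp [Θ]
  have h3 := LinearMap.congr_fun hρ x
  simp only [LinearMap.comp_apply, LinearEquiv.coe_coe] at h3
  simp [h1, h2, h3]

theorem twist_trivAct {ρ : X →ₗ[k] X ⊗[k] H}
    (hρ : (Coalgebra.counit (R := k) (A := H)).lTensor X ∘ₗ ρ =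
      (TensorProduct.mk k X k).flip 1) :
    (TensorProduct.rid k (X ⊗[k] W)).toLinearMap ∘ₗ twist (trivAct k H) ρ W =
      (TensorProduct.rid k W).toLinearMap.lTensor X := by
  ext x w
  have h1 : ∀ s : X ⊗[k] H, (TensorProduct.rid k (X ⊗[k] W))
      (mix (trivAct k H) X W (s ⊗ₜ (w ⊗ₜ 1))) =
      (TensorProduct.rid k X ((Coalgebra.counit (R := k) (A := H)).lTensor X s)) ⊗ₜ w := by
    intro s
    induction s with
    | zero => simp
    | add s s' hs hs' => simp only [TensorProduct.add_tmul, map_add, hs, hs']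
    | tmul x h => simp [trivAct, Algebra.ofId_apply, TensorProduct.smul_tmul']
  have h3 := LinearMap.congr_fun hρ x
  simp only [LinearMap.comp_apply] at h3
  simp [h1, h3]

end Twist

section Copower

variable {C : Type u} [AddCommGroup C] [Module k C]
  {V M : Type u} [AddCommGroup V] [Module k V] [AddCommGroup M] [Module k M]

/-- The coaction `v ⊗ m ↦ v ⊗ m₍₀₎ ⊗ m₍₁₎` on the tensor product of a vector space and a
`C`-comodule. -/
def copowerCoact (V : Type u) [AddCommGroup V] [Module k V] (σ : M →ₗ[k] M ⊗[k] C) :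
    V ⊗[k] M →ₗ[k] (V ⊗[k] M) ⊗[k] C :=
  (TensorProduct.assoc k V M C).symm.toLinearMap ∘ₗ σ.lTensor V

theorem copowerCoact_map {V' M' : Type u} [AddCommGroup V'] [Module k V'] [AddCommGroup M']
    [Module k M'] {σ : M →ₗ[k] M ⊗[k] C} {σ' : M' →ₗ[k] M' ⊗[k] C} (f : V →ₗ[k] V')
    {g : M →ₗ[k] M'} (hg : σ' ∘ₗ g = g.rTensor C ∘ₗ σ) :
    copowerCoact V' σ' ∘ₗ TensorProduct.map f g =
      (TensorProduct.map f g).rTensor C ∘ₗ copowerCoact V σ := by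
  have h1 : (TensorProduct.map f g).rTensor C ∘ₗ
      (TensorProduct.assoc k V M C).symm.toLinearMap =
      (TensorProduct.assoc k V' M' C).symm.toLinearMap ∘ₗ
        TensorProduct.map f (g.rTensor C) := by
    ext v m c
    simp
  ext v m
  have h2 := LinearMap.congr_fun hg m
  have h3 := LinearMap.congr_fun h1 (v ⊗ₜ σ m)
  simp only [LinearMap.comp_apply, LinearEquiv.coe_coe, TensorProduct.map_tmul] at h2 h3
  simp [copowerCoact, h2, h3]

theorem copowerCoact_assoc (V W : Type u) [AddCommGroup V] [Module k V] [AddCommGroup W]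
    [Module k W] (σ : M →ₗ[k] M ⊗[k] C) :
    copowerCoact V (copowerCoact W σ) ∘ₗ (TensorProduct.assoc k V W M).toLinearMap =
      (TensorProduct.assoc k V W M).toLinearMap.rTensor C ∘ₗ copowerCoact (V ⊗[k] W) σ := by
  have h1 : (TensorProduct.assoc k V (W ⊗[k] M) C).symm.toLinearMap ∘ₗ
      (TensorProduct.assoc k W M C).symm.toLinearMap.lTensor V ∘ₗ
      (TensorProduct.assoc k V W (M ⊗[k] C)).toLinearMap =
      (TensorProduct.assoc k V W M).toLinearMap.rTensor C ∘ₗ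
      (TensorProduct.assoc k (V ⊗[k] W) M C).symm.toLinearMap := by
    ext v w m c
    simp
  ext v w m
  simpa [copowerCoact] using LinearMap.congr_fun h1 ((v ⊗ₜ w) ⊗ₜ σ m)

theorem copowerCoact_unit (σ : M →ₗ[k] M ⊗[k] C) :
    σ ∘ₗ (TensorProduct.lid k M).toLinearMap =
      (TensorProduct.lid k M).toLinearMap.rTensor C ∘ₗ copowerCoact k σ := by
  have h1 : (TensorProduct.lid k M).toLinearMap.rTensor C ∘ₗ
      (TensorProduct.assoc k k M C).symm.toLinearMap ∘ₗ TensorProduct.mk k k (M ⊗[k] C) 1 =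
      LinearMap.id := by
    ext m c
    simp
  ext m
  simpa [copowerCoact] using (LinearMap.congr_fun h1 (σ m)).symm

theorem copowerCoact_act {a : H →ₐ[k] Module.End k V} {b : H →ₐ[k] Module.End k M}
    {c : H →ₐ[k] Module.End k C} {σ : M →ₗ[k] M ⊗[k] C}
    (hσ : ∀ h m, σ (b h m) = diagAct b c h (σ m)) (h : H) (t : V ⊗[k] M) :
    copowerCoact V σ (diagAct a b h t) = diagAct (diagAct a b) c h (copowerCoact V σ t) := by
  apply (TensorProduct.assoc k V M C).injective
  rw [diagAct_assoc]
  simpa [copowerCoact, LinearMap.lTensor] using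
    diagAct_map (f := LinearMap.id) (fun _ _ => rfl) hσ h t

variable [Coalgebra k C]

theorem copowerCoact_coassoc {σ : M →ₗ[k] M ⊗[k] C}
    (hσ : (TensorProduct.assoc k M C C).toLinearMap ∘ₗ σ.rTensor C ∘ₗ σ =
      (Coalgebra.comul (R := k) (A := C)).lTensor M ∘ₗ σ) :
    (TensorProduct.assoc k (V ⊗[k] M) C C).toLinearMap ∘ₗ (copowerCoact V σ).rTensor C ∘ₗ
        copowerCoact V σ =
      (Coalgebra.comul (R := k) (A := C)).lTensor (V ⊗[k] M) ∘ₗ copowerCoact V σ := by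
  have h1 : (TensorProduct.assoc k (V ⊗[k] M) C C).toLinearMap ∘ₗ (copowerCoact V σ).rTensor C ∘ₗ
      (TensorProduct.assoc k V M C).symm.toLinearMap =
      (TensorProduct.assoc k V M (C ⊗[k] C)).symm.toLinearMap ∘ₗ
        ((TensorProduct.assoc k M C C).toLinearMap ∘ₗ σ.rTensor C).lTensor V := by
    ext v m c
    have : ∀ t : M ⊗[k] C, (TensorProduct.assoc k (V ⊗[k] M) C C)
        ((TensorProduct.assoc k V M C).symm (v ⊗ₜ[k] t) ⊗ₜ[k] c) =
        (TensorProduct.assoc k V M (C ⊗[k] C)).symm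
          (v ⊗ₜ[k] TensorProduct.assoc k M C C (t ⊗ₜ[k] c)) := by
      intro t
      induction t with
      | zero => simp
      | add s s' hs hs' => simp only [TensorProduct.tmul_add, TensorProduct.add_tmul, map_add,
          hs, hs']
      | tmul x y => simp
    simpa [copowerCoact] using this (σ m)
  have h2 : (Coalgebra.comul (R := k) (A := C)).lTensor (V ⊗[k] M) ∘ₗ
      (TensorProduct.assoc k V M C).symm.toLinearMap =
      (TensorProduct.assoc k V M (C ⊗[k] C)).symm.toLinearMap ∘ₗ
        ((Coalgebra.comul (R := k) (A := C)).lTensor M).lTensor V := by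
    ext v m c
    have : ∀ t : C ⊗[k] C, (v ⊗ₜ[k] m) ⊗ₜ[k] t =
        (TensorProduct.assoc k V M (C ⊗[k] C)).symm (v ⊗ₜ[k] (m ⊗ₜ[k] t)) := fun t => by simp
    simp
  ext v m
  have h3 := LinearMap.congr_fun h1 (v ⊗ₜ σ m)
  have h4 := LinearMap.congr_fun h2 (v ⊗ₜ σ m)
  have h5 := LinearMap.congr_fun hσ m
  simp only [LinearMap.comp_apply, LinearEquiv.coe_coe, LinearMap.lTensor_tmul] at h3 h4 h5
  simp [copowerCoact] at h3 h4 ⊢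
  rw [h3, h4, h5]

theorem copowerCoact_counit {σ : M →ₗ[k] M ⊗[k] C}
    (hσ : (Coalgebra.counit (R := k) (A := C)).lTensor M ∘ₗ σ =
      (TensorProduct.mk k M k).flip 1) :
    (Coalgebra.counit (R := k) (A := C)).lTensor (V ⊗[k] M) ∘ₗ copowerCoact V σ =
      (TensorProduct.mk k (V ⊗[k] M) k).flip 1 := by
  have h2 : (Coalgebra.counit (R := k) (A := C)).lTensor (V ⊗[k] M) ∘ₗ
      (TensorProduct.assoc k V M C).symm.toLinearMap =
      (TensorProduct.assoc k V M k).symm.toLinearMap ∘ₗ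
        ((Coalgebra.counit (R := k) (A := C)).lTensor M).lTensor V := by
    ext v m c
    simp
  ext v m
  have h4 := LinearMap.congr_fun h2 (v ⊗ₜ σ m)
  have h5 := LinearMap.congr_fun hσ m
  simp only [LinearMap.comp_apply, LinearEquiv.coe_coe, LinearMap.lTensor_tmul] at h4 h5
  simp [copowerCoact, h4, h5]

end Copower

theorem isModuleCoalgebra_lmul : IsModuleCoalgebra (Algebra.lmul k H) where
  comul_act h c := by
    have key : ∀ s t : H ⊗[k] H, s * t =
        ((Module.endTensorEndAlgHom (R := k) (S := k) (A := k))
        (Algebra.TensorProduct.map (Algebra.lmul k H) (Algebra.lmul k H) s)) t := by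
      intro s t
      induction s with
      | zero => simp
      | add s s' hs hs' => simp only [add_mul, map_add, hs, hs', LinearMap.add_apply]
      | tmul a b =>
        induction t with
        | zero => simp
        | add s s' hs hs' => simp only [mul_add, map_add, hs, hs']
        | tmul c d => simp [Module.endTensorEndAlgHom_apply]
    simp [diagAct, key]
  counit_act h c := by simp

end LinearAlgebra

/-! ### Comodules and modules -/

/-- Right `C`-comodules. -/
structure RComod (k : Type u) [Field k] (C : Type u) [AddCommGroup C] [Module k C]
    [Coalgebra k C] : Type (u + 1) where
  obj : ModuleCat.{u} k
  coact : obj →ₗ[k] obj ⊗[k] C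
  coassoc : (TensorProduct.assoc k obj C C).toLinearMap ∘ₗ coact.rTensor C ∘ₗ coact =
    (Coalgebra.comul (R := k) (A := C)).lTensor obj ∘ₗ coact
  counit : (Coalgebra.counit (R := k) (A := C)).lTensor obj ∘ₗ coact =
    (TensorProduct.mk k obj k).flip 1

namespace RComod

variable {k : Type u} [Field k] {C : Type u} [AddCommGroup C] [Module k C] [Coalgebra k C]

/-- Colinear maps. -/
@[ext]
structure Hom (M N : RComod k C) : Type u where
  hom : M.obj ⟶ N.obj
  comm : N.coact ∘ₗ hom.hom = hom.hom.rTensor C ∘ₗ M.coact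

@[simps id_hom comp_hom]
instance : Category.{u} (RComod k C) where
  Hom := Hom
  id M := ⟨𝟙 M.obj, by simp⟩
  comp f g := ⟨f.hom ≫ g.hom, by
    rw [ModuleCat.hom_comp, LinearMap.rTensor_comp, ← LinearMap.comp_assoc, g.comm,
      LinearMap.comp_assoc, f.comm, LinearMap.comp_assoc]⟩

@[ext]
theorem hom_ext {M N : RComod k C} {f g : M ⟶ N} (h : f.hom = g.hom) : f = g := Hom.ext h

variable (k C) in
/-- The forgetful functor to vector spaces. -/
@[simps]
def forget : RComod k C ⥤ ModuleCat.{u} k where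
  obj M := M.obj
  map f := f.hom

instance : (forget k C).Faithful where
  map_injective h := hom_ext h

/-- An isomorphism of comodules from a colinear isomorphism of vector spaces. -/
@[simps]
def isoMk {M N : RComod k C} (e : M.obj ≅ N.obj)
    (h : N.coact ∘ₗ e.hom.hom = e.hom.hom.rTensor C ∘ₗ M.coact) : M ≅ N where
  hom := ⟨e.hom, h⟩
  inv := ⟨e.inv, by
    have h1 : e.hom.hom ∘ₗ e.inv.hom = LinearMap.id := by
      rw [← ModuleCat.hom_comp, e.inv_hom_id, ModuleCat.hom_id]
    have h2 : e.inv.hom ∘ₗ e.hom.hom = LinearMap.id := by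
      rw [← ModuleCat.hom_comp, e.hom_inv_id, ModuleCat.hom_id]
    calc M.coact ∘ₗ e.inv.hom
        = (e.inv.hom ∘ₗ e.hom.hom).rTensor C ∘ₗ M.coact ∘ₗ e.inv.hom := by
          rw [h2]; simp
      _ = e.inv.hom.rTensor C ∘ₗ (e.hom.hom.rTensor C ∘ₗ M.coact) ∘ₗ e.inv.hom := by
          rw [LinearMap.rTensor_comp]; simp only [LinearMap.comp_assoc]
      _ = e.inv.hom.rTensor C ∘ₗ N.coact ∘ₗ (e.hom.hom ∘ₗ e.inv.hom) := by
          rw [← h]; simp only [LinearMap.comp_assoc]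
      _ = _ := by rw [h1]; simp⟩
  hom_inv_id := by ext1; simp
  inv_hom_id := by ext1; simp


section Linear

variable (M N : RComod k C)

instance : Zero (M ⟶ N) := ⟨⟨0, by simp⟩⟩
instance : Add (M ⟶ N) := ⟨fun f g => ⟨f.hom + g.hom, by
  simp [LinearMap.comp_add, LinearMap.add_comp, LinearMap.rTensor_add, f.comm, g.comm]⟩⟩
instance : Neg (M ⟶ N) := ⟨fun f => ⟨-f.hom, by
  simp [LinearMap.comp_neg, LinearMap.neg_comp, LinearMap.rTensor_neg, f.comm]⟩⟩
instance : SMul k (M ⟶ N) := ⟨fun c f => ⟨c • f.hom, by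
  simp [LinearMap.comp_smul, LinearMap.smul_comp, LinearMap.rTensor_smul, f.comm]⟩⟩

variable {M N}

@[simp] theorem zero_hom : (0 : M ⟶ N).hom = 0 := rfl
@[simp] theorem add_hom (f g : M ⟶ N) : (f + g).hom = f.hom + g.hom := rfl
@[simp] theorem neg_hom (f : M ⟶ N) : (-f).hom = -f.hom := rfl
@[simp] theorem smul_hom (c : k) (f : M ⟶ N) : (c • f).hom = c • f.hom := rfl

instance : Preadditive (RComod k C) where
  homGroup M N :=
    { add_assoc := fun f g h => by ext1; simp [add_assoc]
      zero_add := fun f => by ext1; simp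
      add_zero := fun f => by ext1; simp
      nsmul := nsmulRec
      zsmul := zsmulRec
      neg_add_cancel := fun f => by ext1; simp
      add_comm := fun f g => by ext1; simp [add_comm] }
  add_comp _ _ _ f f' g := by ext1; exact Preadditive.add_comp _ _ _ f.hom f'.hom g.hom
  comp_add _ _ _ f g g' := by ext1; exact Preadditive.comp_add _ _ _ f.hom g.hom g'.hom

instance : Linear k (RComod k C) where
  homModule M N :=
    { one_smul := fun f => by ext1; simp
      mul_smul := fun a b f => by ext1; simp [mul_smul]
      smul_zero := fun a => by ext1; simp
      smul_add := fun a f g => by ext1; simp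
      add_smul := fun a b f => by ext1; simp [add_smul]
      zero_smul := fun f => by ext1; simp }
  smul_comp _ _ _ c f g := by ext1; exact Linear.smul_comp _ _ _ c f.hom g.hom
  comp_smul _ _ _ f c g := by ext1; exact Linear.comp_smul _ _ _ f.hom c g.hom

end Linear

section Monoidal

variable {H : Type u} [Ring H] [Bialgebra k H]

/-- The `C`-comodule `X ⊗ M` for an `H`-comodule `X` and a `C`-comodule `M`, where `C` is an
`H`-module coalgebra by the action `a`. -/
@[simps obj coact]
def tensor {a : H →ₐ[k] Module.End k C} (ha : IsModuleCoalgebra a) (X : RComod k H)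
    (M : RComod k C) : RComod k C where
  obj := X.obj ⊗ M.obj
  coact := tensorCoact a X.coact M.coact
  coassoc := tensorCoact_coassoc a ha _ _ X.coassoc M.coassoc
  counit := tensorCoact_counit a ha _ _ X.counit M.counit

/-- The tensor product of colinear maps. -/
@[simps hom]
def tensorMap {a : H →ₐ[k] Module.End k C} (ha : IsModuleCoalgebra a) {X X' : RComod k H}
    (f : X ⟶ X') {M M' : RComod k C} (g : M ⟶ M') : tensor ha X M ⟶ tensor ha X' M' where
  hom := f.hom ⊗ₘ g.hom
  comm := tensorCoact_map a f.comm g.comm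

/-- The map `X ⊗ g`. -/
@[simps hom]
def tensorWhiskerLeft {a : H →ₐ[k] Module.End k C} (ha : IsModuleCoalgebra a) (X : RComod k H)
    {M M' : RComod k C} (g : M ⟶ M') : tensor ha X M ⟶ tensor ha X M' where
  hom := X.obj ◁ g.hom
  comm := tensorCoact_map a (f := LinearMap.id) (by simp) g.comm

/-- The map `f ⊗ M`. -/
@[simps hom]
def tensorWhiskerRight {a : H →ₐ[k] Module.End k C} (ha : IsModuleCoalgebra a)
    {X X' : RComod k H} (f : X ⟶ X') (M : RComod k C) : tensor ha X M ⟶ tensor ha X' M where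
  hom := f.hom ▷ M.obj
  comm := tensorCoact_map a f.comm (g := LinearMap.id) (by simp)

variable (k H) in
/-- The trivial `H`-comodule `k`. -/
@[simps obj coact]
def unit : RComod k H where
  obj := 𝟙_ (ModuleCat.{u} k)
  coact := (TensorProduct.mk k k H).flip 1
  coassoc := by
    ext
    simp
    rfl
  counit := by
    ext
    simp
    rfl

/-- The isomorphism `(X ⊗ Y) ⊗ M ≅ X ⊗ (Y ⊗ M)`. -/
@[simps! hom_hom inv_hom]
def tensorAssoc {a : H →ₐ[k] Module.End k C} (ha : IsModuleCoalgebra a) (X Y : RComod k H)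
    (M : RComod k C) :
    tensor ha (tensor isModuleCoalgebra_lmul X Y) M ≅ tensor ha X (tensor ha Y M) :=
  isoMk (α_ X.obj Y.obj M.obj) (tensorCoact_assoc a X.coact Y.coact M.coact)

/-- The isomorphism `k ⊗ M ≅ M`. -/
@[simps! hom_hom inv_hom]
def tensorUnit {a : H →ₐ[k] Module.End k C} (ha : IsModuleCoalgebra a) (M : RComod k C) :
    tensor ha (unit k H) M ≅ M :=
  isoMk (λ_ M.obj) (tensorCoact_unit a M.coact)

/-- The monoidal category `𝔐^H` of right comodules over a bialgebra `H`. -/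
@[simps]
instance : MonoidalCategoryStruct (RComod k H) where
  tensorObj X Y := tensor isModuleCoalgebra_lmul X Y
  whiskerLeft X _ _ f := tensorWhiskerLeft isModuleCoalgebra_lmul X f
  whiskerRight f Y := tensorWhiskerRight isModuleCoalgebra_lmul f Y
  tensorHom f g := tensorMap isModuleCoalgebra_lmul f g
  tensorUnit := unit k H
  associator X Y Z := tensorAssoc isModuleCoalgebra_lmul X Y Z
  leftUnitor X := tensorUnit isModuleCoalgebra_lmul X
  rightUnitor X := isoMk (ρ_ X.obj) (tensorCoact_lmul_unit X.coact)

instance : MonoidalCategory (RComod k H) where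
  tensorHom_def f g := hom_ext (MonoidalCategory.tensorHom_def f.hom g.hom)
  id_tensorHom_id X Y := hom_ext (MonoidalCategory.id_tensorHom_id X.obj Y.obj)
  tensorHom_comp_tensorHom f g f' g' :=
    hom_ext (MonoidalCategory.tensorHom_comp_tensorHom f.hom g.hom f'.hom g'.hom)
  whiskerLeft_id X Y := hom_ext (MonoidalCategory.whiskerLeft_id X.obj Y.obj)
  id_whiskerRight X Y := hom_ext (MonoidalCategory.id_whiskerRight X.obj Y.obj)
  associator_naturality f g h :=
    hom_ext (MonoidalCategory.associator_naturality f.hom g.hom h.hom)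
  leftUnitor_naturality f := hom_ext (MonoidalCategory.leftUnitor_naturality f.hom)
  rightUnitor_naturality f := hom_ext (MonoidalCategory.rightUnitor_naturality f.hom)
  pentagon W X Y Z := hom_ext (MonoidalCategory.pentagon W.obj X.obj Y.obj Z.obj)
  triangle X Y := hom_ext (MonoidalCategory.triangle X.obj Y.obj)

/-- The action of `𝔐^H` on `𝔐^C` for an `H`-module coalgebra `C`. -/
@[reducible]
def action {a : H →ₐ[k] Module.End k C} (ha : IsModuleCoalgebra a) :
    MonoidalLeftAction (RComod k H) (RComod k C) where
  actionObj X M := tensor ha X M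
  actionHomLeft f M := tensorWhiskerRight ha f M
  actionHomRight X _ _ g := tensorWhiskerLeft ha X g
  actionHom f g := tensorMap ha f g
  actionAssocIso X Y M := tensorAssoc ha X Y M
  actionUnitIso M := tensorUnit ha M
  actionHom_def f g := hom_ext (actionHom_def f.hom g.hom)
  actionHomRight_id X M := hom_ext (actionHomRight_id X.obj M.obj)
  id_actionHomLeft X M := hom_ext (id_actionHomLeft X.obj M.obj)
  actionHom_comp f f' g g' := hom_ext (actionHom_comp f.hom f'.hom g.hom g'.hom)
  actionAssocIso_hom_naturality f g h :=
    hom_ext (actionAssocIso_hom_naturality f.hom g.hom h.hom)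
  actionUnitIso_hom_naturality f :=
    hom_ext (actionUnitIso_hom_naturality (C := ModuleCat.{u} k) f.hom)
  whiskerLeft_actionHomLeft X _ _ f M :=
    hom_ext (whiskerLeft_actionHomLeft X.obj f.hom M.obj)
  whiskerRight_actionHomLeft X f M :=
    hom_ext (whiskerRight_actionHomLeft X.obj f.hom M.obj)
  associator_actionHom X Y Z M :=
    hom_ext (associator_actionHom X.obj Y.obj Z.obj M.obj)
  leftUnitor_actionHom X M := hom_ext (leftUnitor_actionHom X.obj M.obj)
  rightUnitor_actionHom X M := hom_ext (rightUnitor_actionHom X.obj M.obj)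

/-- The action of `𝔐^H` on the category of vector spaces through the forgetful functor. -/
instance vecAction : MonoidalLeftAction (RComod k H) (ModuleCat.{u} k) where
  actionObj X W := X.obj ⊗ W
  actionHomLeft f W := f.hom ▷ W
  actionHomRight X _ _ g := X.obj ◁ g
  actionHom f g := f.hom ⊗ₘ g
  actionAssocIso X Y W := α_ X.obj Y.obj W
  actionUnitIso W := λ_ W
  actionHom_def f g := actionHom_def f.hom g
  actionHomRight_id X M := actionHomRight_id X.obj M
  id_actionHomLeft X M := id_actionHomLeft X.obj M
  actionHom_comp f f' g g' := actionHom_comp f.hom f'.hom g g'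
  actionAssocIso_hom_naturality f g h := actionAssocIso_hom_naturality f.hom g.hom h
  actionUnitIso_hom_naturality f := actionUnitIso_hom_naturality (C := ModuleCat.{u} k) f
  whiskerLeft_actionHomLeft X _ _ f M := whiskerLeft_actionHomLeft X.obj f.hom M
  whiskerRight_actionHomLeft X f M := whiskerRight_actionHomLeft X.obj f.hom M
  associator_actionHom X Y Z M := associator_actionHom X.obj Y.obj Z.obj M
  leftUnitor_actionHom X M := leftUnitor_actionHom X.obj M
  rightUnitor_actionHom X M := rightUnitor_actionHom X.obj M

end Monoidal

end RComod

/-- Left `H`-modules. -/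
structure HMod (k : Type u) [Field k] (H : Type u) [Ring H] [Bialgebra k H] : Type (u + 1) where
  obj : ModuleCat.{u} k
  act : H →ₐ[k] Module.End k obj

namespace HMod

variable {k : Type u} [Field k] {H : Type u} [Ring H] [Bialgebra k H]

/-- `H`-linear maps. -/
@[ext]
structure Hom (V W : HMod k H) : Type u where
  hom : V.obj ⟶ W.obj
  comm : ∀ (h : H) (v : V.obj), hom.hom (V.act h v) = W.act h (hom.hom v)

@[simps id_hom comp_hom]
instance : Category.{u} (HMod k H) where
  Hom := Hom
  id V := ⟨𝟙 V.obj, by simp⟩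
  comp f g := ⟨f.hom ≫ g.hom, by simp [f.comm, g.comm]⟩

@[ext]
theorem hom_ext {V W : HMod k H} {f g : V ⟶ W} (h : f.hom = g.hom) : f = g := Hom.ext h

/-- An isomorphism of modules from an `H`-linear isomorphism of vector spaces. -/
@[simps]
def isoMk {V W : HMod k H} (e : V.obj ≅ W.obj)
    (h : ∀ (h : H) (v : V.obj), e.hom.hom (V.act h v) = W.act h (e.hom.hom v)) : V ≅ W where
  hom := ⟨e.hom, h⟩
  inv := ⟨e.inv, fun x w => by
    have h1 : ∀ v, e.inv.hom (e.hom.hom v) = v := fun v => by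
      rw [← LinearMap.comp_apply, ← ModuleCat.hom_comp, e.hom_inv_id, ModuleCat.hom_id,
        LinearMap.id_apply]
    have h2 : ∀ v, e.hom.hom (e.inv.hom v) = v := fun v => by
      rw [← LinearMap.comp_apply, ← ModuleCat.hom_comp, e.inv_hom_id, ModuleCat.hom_id,
        LinearMap.id_apply]
    rw [← h1 (V.act x _), h, h2]⟩
  hom_inv_id := by ext1; simp
  inv_hom_id := by ext1; simp

/-- The monoidal category `_H𝔐` of left modules over a bialgebra `H`. -/
@[simps]
instance : MonoidalCategoryStruct (HMod k H) where
  tensorObj V W := ⟨V.obj ⊗ W.obj, diagAct V.act W.act⟩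
  whiskerLeft V _ _ f := ⟨V.obj ◁ f.hom, diagAct_map (fun _ _ => rfl) f.comm⟩
  whiskerRight f W := ⟨f.hom ▷ W.obj, diagAct_map f.comm (fun _ _ => rfl)⟩
  tensorHom f g := ⟨f.hom ⊗ₘ g.hom, diagAct_map f.comm g.comm⟩
  tensorUnit := ⟨𝟙_ (ModuleCat.{u} k), trivAct k H⟩
  associator V W U := isoMk (α_ V.obj W.obj U.obj) (diagAct_assoc V.act W.act U.act)
  leftUnitor V := isoMk (λ_ V.obj) (diagAct_trivAct_left V.act)
  rightUnitor V := isoMk (ρ_ V.obj) (diagAct_trivAct_right V.act)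

instance : MonoidalCategory (HMod k H) where
  tensorHom_def f g := hom_ext (MonoidalCategory.tensorHom_def f.hom g.hom)
  id_tensorHom_id X Y := hom_ext (MonoidalCategory.id_tensorHom_id X.obj Y.obj)
  tensorHom_comp_tensorHom f g f' g' :=
    hom_ext (MonoidalCategory.tensorHom_comp_tensorHom f.hom g.hom f'.hom g'.hom)
  whiskerLeft_id X Y := hom_ext (MonoidalCategory.whiskerLeft_id X.obj Y.obj)
  id_whiskerRight X Y := hom_ext (MonoidalCategory.id_whiskerRight X.obj Y.obj)
  associator_naturality f g h :=
    hom_ext (MonoidalCategory.associator_naturality f.hom g.hom h.hom)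
  leftUnitor_naturality f := hom_ext (MonoidalCategory.leftUnitor_naturality f.hom)
  rightUnitor_naturality f := hom_ext (MonoidalCategory.rightUnitor_naturality f.hom)
  pentagon W X Y Z := hom_ext (MonoidalCategory.pentagon W.obj X.obj Y.obj Z.obj)
  triangle X Y := hom_ext (MonoidalCategory.triangle X.obj Y.obj)

end HMod

/-- Left `H`-module coalgebras. -/
structure ModuleCoalgebra (k : Type u) [Field k] (H : Type u) [Ring H] [Bialgebra k H] :
    Type (u + 1) where
  carrier : Type u
  [addCommGroup : AddCommGroup carrier]
  [module : Module k carrier]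
  [coalgebra : Coalgebra k carrier]
  act : H →ₐ[k] Module.End k carrier
  isModuleCoalgebra : IsModuleCoalgebra act

namespace ModuleCoalgebra

attribute [instance] addCommGroup module coalgebra

variable {k : Type u} [Field k] {H : Type u} [Ring H] [Bialgebra k H]

/-- The category `𝔐^C` of right `C`-comodules. -/
def Comod (C : ModuleCoalgebra k H) : Type (u + 1) := RComod k C.carrier

variable (C : ModuleCoalgebra k H)

instance : Category.{u} C.Comod := inferInstanceAs (Category.{u} (RComod k C.carrier))
instance : Preadditive C.Comod := inferInstanceAs (Preadditive (RComod k C.carrier))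
instance : Linear k C.Comod := inferInstanceAs (Linear k (RComod k C.carrier))

/-- The left `𝔐^H`-module category `𝔐^C`. -/
instance : MonoidalLeftAction (RComod k H) C.Comod := RComod.action C.isModuleCoalgebra

/-- The category `_H𝔐^C` of right `C`-comodules in `_H𝔐`: a right `C`-comodule with an action of
`H` such that `ρ(h m) = h₍₁₎ m₍₀₎ ⊗ h₍₂₎ m₍₁₎`. -/
structure HComod (C : ModuleCoalgebra k H) : Type (u + 1) extends RComod k C.carrier where
  act : H →ₐ[k] Module.End k obj
  coact_act : ∀ (h : H) (m : obj), coact (act h m) = diagAct act C.act h (coact m)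

namespace HComod

variable {C}

/-- `H`-linear and `C`-colinear maps. -/
@[ext]
structure Hom (M N : C.HComod) : Type u extends RComod.Hom M.toRComod N.toRComod where
  act_comm : ∀ (h : H) (m : M.obj), hom.hom (M.act h m) = N.act h (hom.hom m)

instance : Category.{u} C.HComod where
  Hom := Hom
  id M := { toHom := 𝟙 M.toRComod, act_comm := by simp }
  comp {M N K} f g :=
    { toHom := CategoryStruct.comp (obj := RComod k C.carrier) f.toHom g.toHom
      act_comm := by simp [f.act_comm, g.act_comm] }

@[simp] theorem id_hom (M : C.HComod) : (𝟙 M : M ⟶ M).hom = 𝟙 M.obj := rfl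

@[simp] theorem comp_hom {M N K : C.HComod} (f : M ⟶ N) (g : N ⟶ K) :
    (f ≫ g).hom = f.hom ≫ g.hom := rfl

@[ext]
theorem hom_ext {M N : C.HComod} {f g : M ⟶ N} (h : f.hom = g.hom) : f = g :=
  Hom.ext h

/-- An isomorphism in `_H𝔐^C` from an `H`-linear colinear isomorphism of vector spaces. -/
def isoMk {M N : C.HComod} (e : M.obj ≅ N.obj)
    (h : N.coact ∘ₗ e.hom.hom = e.hom.hom.rTensor C.carrier ∘ₗ M.coact)
    (h' : ∀ (h : H) (v : M.obj), e.hom.hom (M.act h v) = N.act h (e.hom.hom v)) : M ≅ N where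
  hom := { hom := e.hom, comm := h, act_comm := h' }
  inv :=
    { toHom := (RComod.isoMk (M := M.toRComod) (N := N.toRComod) e h).inv
      act_comm := (HMod.isoMk (V := ⟨M.obj, M.act⟩) (W := ⟨N.obj, N.act⟩) e h').inv.comm }
  hom_inv_id := hom_ext e.hom_inv_id
  inv_hom_id := hom_ext e.inv_hom_id

/-- The object `V ⊗ M` of `_H𝔐^C` for `V` in `_H𝔐` and `M` in `_H𝔐^C`. -/
@[simps obj]
def tensor (V : HMod k H) (M : C.HComod) : C.HComod where
  obj := V.obj ⊗ M.obj
  coact := copowerCoact V.obj M.coact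
  coassoc := copowerCoact_coassoc M.coassoc
  counit := copowerCoact_counit M.counit
  act := diagAct V.act M.act
  coact_act := copowerCoact_act M.coact_act

/-- The left `_H𝔐`-module category `_H𝔐^C`. -/
instance : MonoidalLeftAction (HMod k H) C.HComod where
  actionObj V M := tensor V M
  actionHomLeft {V W} f M :=
    { hom := f.hom ▷ M.obj
      comm := copowerCoact_map f.hom.hom (g := LinearMap.id) (by simp)
      act_comm := diagAct_map f.comm (fun _ _ => rfl) }
  actionHomRight V M N g :=
    { hom := V.obj ◁ g.hom
      comm := copowerCoact_map LinearMap.id g.comm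
      act_comm := diagAct_map (fun _ _ => rfl) g.act_comm }
  actionHom {V W M N} f g :=
    { hom := f.hom ⊗ₘ g.hom
      comm := copowerCoact_map f.hom.hom g.comm
      act_comm := diagAct_map f.comm g.act_comm }
  actionAssocIso V W M := isoMk (α_ V.obj W.obj M.obj)
    (copowerCoact_assoc V.obj W.obj M.coact) (diagAct_assoc V.act W.act M.act)
  actionUnitIso M := isoMk (λ_ M.obj) (copowerCoact_unit M.coact) (diagAct_trivAct_left M.act)
  actionHom_def f g := hom_ext (actionHom_def f.hom g.hom)
  actionHomRight_id X M := hom_ext (actionHomRight_id X.obj M.obj)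
  id_actionHomLeft X M := hom_ext (id_actionHomLeft X.obj M.obj)
  actionHom_comp f f' g g' := hom_ext (actionHom_comp f.hom f'.hom g.hom g'.hom)
  actionAssocIso_hom_naturality f g h :=
    hom_ext (actionAssocIso_hom_naturality f.hom g.hom h.hom)
  actionUnitIso_hom_naturality f :=
    hom_ext (actionUnitIso_hom_naturality (C := ModuleCat.{u} k) f.hom)
  whiskerLeft_actionHomLeft X _ _ f M :=
    hom_ext (whiskerLeft_actionHomLeft X.obj f.hom M.obj)
  whiskerRight_actionHomLeft X f M :=
    hom_ext (whiskerRight_actionHomLeft X.obj f.hom M.obj)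
  associator_actionHom X Y Z M :=
    hom_ext (associator_actionHom X.obj Y.obj Z.obj M.obj)
  leftUnitor_actionHom X M := hom_ext (leftUnitor_actionHom X.obj M.obj)
  rightUnitor_actionHom X M := hom_ext (rightUnitor_actionHom X.obj M.obj)

end HComod

end ModuleCoalgebra

end Comodules

/-! ### Module categories and lax module functors -/

section ModuleFunctors

/-- The composition of lax linear functors is lax linear. -/
@[reducible]
def compLaxLeftLinear {C M N K : Type*} [Category* C] [MonoidalCategory C] [Category* M]
    [Category* N] [Category* K] [MonoidalLeftAction C M] [MonoidalLeftAction C N]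
    [MonoidalLeftAction C K] (F : M ⥤ N) (G : N ⥤ K) [F.LaxLeftLinear C]
    [G.LaxLeftLinear C] : (F ⋙ G).LaxLeftLinear C where
  μₗ c m := Functor.LaxLeftLinear.μₗ G c (F.obj m) ≫ G.map (Functor.LaxLeftLinear.μₗ F c m)
  μₗ_naturality_left f m := by simp [← Functor.map_comp]
  μₗ_naturality_right c _ _ f := by simp [← Functor.map_comp]
  μₗ_associativity c c' m := by
    simp only [Functor.comp_map, Category.assoc, ← G.map_comp,
      Functor.LaxLeftLinear.μₗ_associativity]
    simp
  μₗ_unitality m := by simp [← Functor.map_comp]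

variable (C : Type*) [Category* C] [MonoidalCategory C]

/-- Lax left `C`-module functors `F : M ⥤ N`, with structure morphisms `c ⊗ F(m) ⟶ F(c ⊗ m)`. -/
structure LaxModuleFunctor (M N : Type*) [Category* M] [Category* N] [MonoidalLeftAction C M]
    [MonoidalLeftAction C N] where
  functor : M ⥤ N
  [lax : functor.LaxLeftLinear C]

namespace LaxModuleFunctor

attribute [instance] lax

variable {C}
variable {M N K L : Type*} [Category* M] [Category* N] [Category* K] [Category* L]
  [MonoidalLeftAction C M] [MonoidalLeftAction C N] [MonoidalLeftAction C K]
  [MonoidalLeftAction C L]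

/-- The structure morphism `c ⊗ F(m) ⟶ F(c ⊗ m)`. -/
abbrev str (F : LaxModuleFunctor C M N) (c : C) (m : M) :
    c ⊙ₗ F.functor.obj m ⟶ F.functor.obj (c ⊙ₗ m) :=
  Functor.LaxLeftLinear.μₗ F.functor c m

/-- Morphisms of lax module functors. -/
@[ext]
structure Hom (F G : LaxModuleFunctor C M N) where
  nat : F.functor ⟶ G.functor
  comm : ∀ (c : C) (m : M), F.str c m ≫ nat.app (c ⊙ₗ m) = c ⊴ₗ nat.app m ≫ G.str c m

attribute [simp] Hom.comm

@[simp]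
theorem Hom.comm_assoc {F G : LaxModuleFunctor C M N} (η : Hom F G) (c : C) (m : M) {X : N}
    (f : G.functor.obj (c ⊙ₗ m) ⟶ X) :
    F.str c m ≫ η.nat.app (c ⊙ₗ m) ≫ f = c ⊴ₗ η.nat.app m ≫ G.str c m ≫ f := by
  rw [← Category.assoc, Hom.comm, Category.assoc]

@[simps id_nat comp_nat]
instance : Category (LaxModuleFunctor C M N) where
  Hom := Hom
  id F := ⟨𝟙 F.functor, by simp⟩
  comp η θ := ⟨η.nat ≫ θ.nat, by simp⟩

@[ext]
theorem hom_ext {F G : LaxModuleFunctor C M N} {η θ : F ⟶ G}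
    (h : ∀ m, η.nat.app m = θ.nat.app m) : η = θ :=
  Hom.ext (NatTrans.ext (funext h))

/-- An isomorphism of lax module functors from a natural isomorphism. -/
@[simps]
def isoMk {F G : LaxModuleFunctor C M N} (e : F.functor ≅ G.functor)
    (h : ∀ (c : C) (m : M), F.str c m ≫ e.hom.app (c ⊙ₗ m) = c ⊴ₗ e.hom.app m ≫ G.str c m) :
    F ≅ G where
  hom := ⟨e.hom, h⟩
  inv := ⟨e.inv, fun c m => by
    rw [← cancel_mono (e.hom.app (c ⊙ₗ m)), Category.assoc, Category.assoc, h,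
      ← actionHomRight_comp_assoc]
    simp⟩

/-- The identity module functor. -/
@[simps]
def id (M : Type*) [Category* M] [MonoidalLeftAction C M] : LaxModuleFunctor C M M where
  functor := 𝟭 M
  lax := { μₗ := fun c m => 𝟙 (c ⊙ₗ m) }

@[simp]
theorem id_str (c : C) (m : M) : (id M).str c m = 𝟙 (c ⊙ₗ m) := rfl

/-- The composition of lax module functors. -/
@[simps functor]
def comp (F : LaxModuleFunctor C M N) (G : LaxModuleFunctor C N K) :
    LaxModuleFunctor C M K where
  functor := F.functor ⋙ G.functor
  lax := compLaxLeftLinear F.functor G.functor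

@[simp]
theorem comp_str (F : LaxModuleFunctor C M N) (G : LaxModuleFunctor C N K) (c : C) (m : M) :
    (comp F G).str c m = G.str c (F.functor.obj m) ≫ G.functor.map (F.str c m) := rfl

/-- Whiskering of a morphism of module functors with `F` on the source side. -/
@[simps nat]
def whiskerLeft (F : LaxModuleFunctor C M N) {G G' : LaxModuleFunctor C N K} (η : G ⟶ G') :
    comp F G ⟶ comp F G' where
  nat := Functor.whiskerLeft F.functor η.nat
  comm c m := by
    change (G.str c (F.functor.obj m) ≫ G.functor.map (F.str c m)) ≫
      η.nat.app (F.functor.obj (c ⊙ₗ m)) = c ⊴ₗ η.nat.app (F.functor.obj m) ≫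
        G'.str c (F.functor.obj m) ≫ G'.functor.map (F.str c m)
    rw [Category.assoc, η.nat.naturality, Hom.comm_assoc]

/-- Whiskering of a morphism of module functors with `G` on the target side. -/
@[simps nat]
def whiskerRight {F F' : LaxModuleFunctor C M N} (η : F ⟶ F') (G : LaxModuleFunctor C N K) :
    comp F G ⟶ comp F' G where
  nat := Functor.whiskerRight η.nat G.functor
  comm c m := by
    change (G.str c (F.functor.obj m) ≫ G.functor.map (F.str c m)) ≫
      G.functor.map (η.nat.app (c ⊙ₗ m)) = c ⊴ₗ G.functor.map (η.nat.app m) ≫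
        G.str c (F'.functor.obj m) ≫ G.functor.map (F'.str c m)
    rw [Category.assoc, ← Functor.map_comp, Hom.comm, Functor.map_comp,
      Functor.LaxLeftLinear.μₗ_naturality_right_assoc]

/-- Whiskering of an isomorphism of module functors with `G` on the target side. -/
@[simps]
def whiskerRightIso {F F' : LaxModuleFunctor C M N} (e : F ≅ F')
    (G : LaxModuleFunctor C N K) : comp F G ≅ comp F' G where
  hom := whiskerRight e.hom G
  inv := whiskerRight e.inv G
  hom_inv_id := hom_ext fun m => by
    change G.functor.map (e.hom.nat.app m) ≫ G.functor.map (e.inv.nat.app m) = 𝟙 _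
    rw [← Functor.map_comp, ← NatTrans.comp_app, ← comp_nat, e.hom_inv_id]
    simp
  inv_hom_id := hom_ext fun m => by
    change G.functor.map (e.inv.nat.app m) ≫ G.functor.map (e.hom.nat.app m) = 𝟙 _
    rw [← Functor.map_comp, ← NatTrans.comp_app, ← comp_nat, e.inv_hom_id]
    simp

/-- The associativity constraint (with identity components). -/
@[simps!]
def assoc (F : LaxModuleFunctor C M N) (G : LaxModuleFunctor C N K)
    (E : LaxModuleFunctor C K L) : comp (comp F G) E ≅ comp F (comp G E) :=
  isoMk (Functor.associator F.functor G.functor E.functor) fun c m => by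
    change (E.str c (G.functor.obj (F.functor.obj m)) ≫ E.functor.map
      (G.str c (F.functor.obj m) ≫ G.functor.map (F.str c m))) ≫ 𝟙 _ =
      c ⊴ₗ 𝟙 (E.functor.obj (G.functor.obj (F.functor.obj m))) ≫
        (E.str c (G.functor.obj (F.functor.obj m)) ≫ E.functor.map (G.str c (F.functor.obj m))) ≫
          E.functor.map (G.functor.map (F.str c m))
    simp

/-- The left unit constraint (with identity components). -/
@[simps!]
def idComp (F : LaxModuleFunctor C M N) : comp (id M) F ≅ F :=
  isoMk F.functor.leftUnitor fun c m => by
    change (F.str c m ≫ F.functor.map (𝟙 (c ⊙ₗ m))) ≫ 𝟙 _ =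
      c ⊴ₗ 𝟙 (F.functor.obj m) ≫ F.str c m
    simp

/-- The right unit constraint (with identity components). -/
@[simps!]
def compId (F : LaxModuleFunctor C M N) : comp F (id N) ≅ F :=
  isoMk F.functor.rightUnitor fun c m => by
    change (𝟙 (c ⊙ₗ F.functor.obj m) ≫ F.str c m) ≫ 𝟙 _ =
      c ⊴ₗ 𝟙 (F.functor.obj m) ≫ F.str c m
    simp

/-- A lax module functor is strong if its structure morphisms are invertible. -/
def IsStrong (F : LaxModuleFunctor C M N) : Prop :=
  ∀ (c : C) (m : M), IsIso (F.str c m)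

end LaxModuleFunctor

open LaxModuleFunctor in
/-- Two left `C`-module categories are equivalent if there are mutually quasi-inverse lax module
functors between them. -/
def ModuleEquivalent (M N : Type*) [Category* M] [Category* N] [MonoidalLeftAction C M]
    [MonoidalLeftAction C N] : Prop :=
  ∃ (F : LaxModuleFunctor C M N) (G : LaxModuleFunctor C N M),
    Nonempty (comp F G ≅ id M) ∧ Nonempty (comp G F ≅ id N)

open LaxModuleFunctor in
/-- Two `k`-linear left `C`-module categories are equivalent if there are mutually quasi-inverse
`k`-linear lax module functors between them. -/
def LinearModuleEquivalent (k : Type*) [Field k] (M N : Type*) [Category* M] [Category* N]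
    [Preadditive M] [Preadditive N] [Linear k M] [Linear k N]
    [MonoidalLeftAction C M] [MonoidalLeftAction C N] : Prop :=
  ∃ (F : LaxModuleFunctor C M N) (G : LaxModuleFunctor C N M),
    F.functor.Additive ∧ F.functor.Linear k ∧ G.functor.Additive ∧ G.functor.Linear k ∧
    Nonempty (comp F G ≅ id M) ∧ Nonempty (comp G F ≅ id N)

end ModuleFunctors

/-- Lax `C`-module functors of type `ℒ`: the underlying functor is `k`-linear, left exact and
preserves small coproducts. -/
structure LFunctor (k : Type u) [Field k] (C : Type*) [Category* C] [MonoidalCategory C]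
    (M N : Type*) [Category* M] [Category* N] [Preadditive M] [Preadditive N] [Linear k M]
    [Linear k N] [MonoidalLeftAction C M] [MonoidalLeftAction C N]
    extends LaxModuleFunctor C M N where
  additive : functor.Additive
  linear : functor.Linear k
  leftExact : PreservesFiniteLimits functor
  coproducts : ∀ J : Type u, PreservesColimitsOfShape (Discrete J) functor

namespace LFunctor

variable {k : Type u} [Field k] {C : Type*} [Category* C] [MonoidalCategory C]
  {M N K : Type*} [Category* M] [Category* N] [Category* K]
  [Preadditive M] [Preadditive N] [Preadditive K] [Linear k M] [Linear k N] [Linear k K]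
  [MonoidalLeftAction C M] [MonoidalLeftAction C N] [MonoidalLeftAction C K]

/-- The morphisms are the morphisms of lax module functors. -/
instance : Category (LFunctor k C M N) where
  Hom F G := F.toLaxModuleFunctor ⟶ G.toLaxModuleFunctor
  id F := 𝟙 F.toLaxModuleFunctor
  comp η θ := CategoryStruct.comp (obj := LaxModuleFunctor C M N) η θ
  id_comp η := Category.id_comp (obj := LaxModuleFunctor C M N) η
  comp_id η := Category.comp_id (obj := LaxModuleFunctor C M N) η
  assoc η θ ι := Category.assoc (obj := LaxModuleFunctor C M N) η θ ι

@[simp]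
theorem id_nat (F : LFunctor k C M N) :
    LaxModuleFunctor.Hom.nat (𝟙 F) = 𝟙 F.functor := rfl

@[simp]
theorem comp_nat {F G E : LFunctor k C M N} (η : F ⟶ G) (θ : G ⟶ E) :
    LaxModuleFunctor.Hom.nat (η ≫ θ) =
      LaxModuleFunctor.Hom.nat η ≫ LaxModuleFunctor.Hom.nat θ := rfl

theorem hom_ext {F G : LFunctor k C M N} {η θ : F ⟶ G}
    (h : ∀ m, (LaxModuleFunctor.Hom.nat η).app m = (LaxModuleFunctor.Hom.nat θ).app m) : η = θ :=
  LaxModuleFunctor.hom_ext h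

/-- Isomorphisms of functors of type `ℒ` are isomorphisms of lax module functors. -/
@[simps]
def isoMk {F G : LFunctor k C M N} (e : F.toLaxModuleFunctor ≅ G.toLaxModuleFunctor) :
    F ≅ G where
  hom := e.hom
  inv := e.inv
  hom_inv_id := e.hom_inv_id
  inv_hom_id := e.inv_hom_id

variable (k C M) in
/-- The identity functor. -/
@[simps toLaxModuleFunctor]
def id : LFunctor k C M M where
  toLaxModuleFunctor := LaxModuleFunctor.id M
  additive := inferInstanceAs (𝟭 M).Additive
  linear := inferInstanceAs ((𝟭 M).Linear k)
  leftExact := inferInstanceAs (PreservesFiniteLimits (𝟭 M))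
  coproducts _ := inferInstanceAs (PreservesColimitsOfShape _ (𝟭 M))

/-- The composition of functors of type `ℒ`. -/
@[simps toLaxModuleFunctor]
def comp (F : LFunctor k C M N) (G : LFunctor k C N K) : LFunctor k C M K where
  toLaxModuleFunctor := F.toLaxModuleFunctor.comp G.toLaxModuleFunctor
  additive := by
    have := F.additive
    have := G.additive
    exact inferInstanceAs (F.functor ⋙ G.functor).Additive
  linear := by
    have := F.linear
    have := G.linear
    exact inferInstanceAs ((F.functor ⋙ G.functor).Linear k)
  leftExact := by
    have := F.leftExact
    have := G.leftExact
    exact comp_preservesFiniteLimits F.functor G.functor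
  coproducts J := by
    have := F.coproducts J
    have := G.coproducts J
    exact inferInstanceAs (PreservesColimitsOfShape (Discrete J) (F.functor ⋙ G.functor))

end LFunctor

/-- Left exact strong `C`-module functors. -/
structure LeftExactStrongFunctor (C : Type*) [Category* C] [MonoidalCategory C]
    (M N : Type*) [Category* M] [Category* N] [MonoidalLeftAction C M] [MonoidalLeftAction C N]
    extends LaxModuleFunctor C M N where
  strong : toLaxModuleFunctor.IsStrong
  leftExact : PreservesFiniteLimits functor

namespace LeftExactStrongFunctor

variable {C : Type*} [Category* C] [MonoidalCategory C]
  {M N K : Type*} [Category* M] [Category* N] [Category* K]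
  [MonoidalLeftAction C M] [MonoidalLeftAction C N] [MonoidalLeftAction C K]

/-- The morphisms are the morphisms of module functors. -/
instance : Category (LeftExactStrongFunctor C M N) where
  Hom F G := F.toLaxModuleFunctor ⟶ G.toLaxModuleFunctor
  id F := 𝟙 F.toLaxModuleFunctor
  comp η θ := CategoryStruct.comp (obj := LaxModuleFunctor C M N) η θ
  id_comp η := Category.id_comp (obj := LaxModuleFunctor C M N) η
  comp_id η := Category.comp_id (obj := LaxModuleFunctor C M N) η
  assoc η θ ι := Category.assoc (obj := LaxModuleFunctor C M N) η θ ι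

@[simp]
theorem id_nat (F : LeftExactStrongFunctor C M N) :
    LaxModuleFunctor.Hom.nat (𝟙 F) = 𝟙 F.functor := rfl

@[simp]
theorem comp_nat {F G E : LeftExactStrongFunctor C M N} (η : F ⟶ G) (θ : G ⟶ E) :
    LaxModuleFunctor.Hom.nat (η ≫ θ) =
      LaxModuleFunctor.Hom.nat η ≫ LaxModuleFunctor.Hom.nat θ := rfl

theorem hom_ext {F G : LeftExactStrongFunctor C M N} {η θ : F ⟶ G}
    (h : ∀ m, (LaxModuleFunctor.Hom.nat η).app m = (LaxModuleFunctor.Hom.nat θ).app m) : η = θ :=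
  LaxModuleFunctor.hom_ext h

/-- Isomorphisms of left exact strong module functors are isomorphisms of module functors. -/
@[simps]
def isoMk {F G : LeftExactStrongFunctor C M N}
    (e : F.toLaxModuleFunctor ≅ G.toLaxModuleFunctor) : F ≅ G where
  hom := e.hom
  inv := e.inv
  hom_inv_id := e.hom_inv_id
  inv_hom_id := e.inv_hom_id

variable (C M) in
/-- The identity functor. -/
@[simps toLaxModuleFunctor]
def id : LeftExactStrongFunctor C M M where
  toLaxModuleFunctor := LaxModuleFunctor.id M
  strong c m := inferInstanceAs (IsIso (𝟙 (c ⊙ₗ m)))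
  leftExact := inferInstanceAs (PreservesFiniteLimits (𝟭 M))

/-- The composition of left exact strong module functors. -/
@[simps toLaxModuleFunctor]
def comp (F : LeftExactStrongFunctor C M N) (G : LeftExactStrongFunctor C N K) :
    LeftExactStrongFunctor C M K where
  toLaxModuleFunctor := F.toLaxModuleFunctor.comp G.toLaxModuleFunctor
  strong c m := by
    have := F.strong c m
    have := G.strong c (F.functor.obj m)
    exact inferInstanceAs (IsIso (G.str c (F.functor.obj m) ≫ G.functor.map (F.str c m)))
  leftExact := by
    have := F.leftExact
    have := G.leftExact
    exact comp_preservesFiniteLimits F.functor G.functor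

end LeftExactStrongFunctor

/-! ### The two 2-categories -/

/-- The 0-cells of `𝔐^H-Mod`: `k`-linear left `𝔐^H`-module categories equivalent to `𝔐^C` for some
left `H`-module coalgebra `C`. -/
structure ComodModCat (k : Type u) [Field k] (H : Type u) [Ring H] [Bialgebra k H] :
    Type (max (u + 1) (v + 1) (w + 1)) where
  carrier : Type w
  [category : Category.{v} carrier]
  [preadditive : Preadditive carrier]
  [linear : Linear k carrier]
  [action : MonoidalLeftAction (RComod k H) carrier]
  exists_equiv : ∃ C : ModuleCoalgebra k H,
    LinearModuleEquivalent (RComod k H) k carrier C.Comod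

/-- The 0-cells of `_H𝔐-Mod`: left `_H𝔐`-module categories equivalent to `_H𝔐^C` for some left
`H`-module coalgebra `C`. -/
structure ModModCat (k : Type u) [Field k] (H : Type u) [Ring H] [Bialgebra k H] :
    Type (max (u + 1) (v + 1) (w + 1)) where
  carrier : Type w
  [category : Category.{v} carrier]
  [action : MonoidalLeftAction (HMod k H) carrier]
  exists_equiv : ∃ C : ModuleCoalgebra k H, ModuleEquivalent (HMod k H) carrier C.HComod

attribute [instance] ComodModCat.category ComodModCat.preadditive ComodModCat.linear
  ComodModCat.action ModModCat.category ModModCat.action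

section Bicategories

theorem id_comp_comp_id {C : Type*} [Category* C] {X Y : C} (f : X ⟶ Y) :
    f = 𝟙 X ≫ f ≫ 𝟙 Y := by simp

theorem map_id_comp_id_comp_id {C D : Type*} [Category* C] [Category* D] (F : C ⥤ D) (X : C) :
    F.map (𝟙 X) ≫ 𝟙 (F.obj X) ≫ 𝟙 (F.obj X) = 𝟙 (F.obj X) ≫ 𝟙 (F.obj X) := by simp

theorem id_comp_map_id {C D : Type*} [Category* C] [Category* D] (F : C ⥤ D) (X : C) :
    𝟙 (F.obj X) ≫ 𝟙 (F.obj X) = F.map (𝟙 X) := by simp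

variable {k : Type u} [Field k] {H : Type u} [Ring H] [Bialgebra k H]

/-- The 2-category `𝔐^H-Mod`: the 1-cells are the lax module functors of type `ℒ`, and the 2-cells
are the morphisms of lax module functors. -/
instance : Bicategory (ComodModCat.{v, w} k H) where
  Hom M N := LFunctor k (RComod k H) M.carrier N.carrier
  id M := LFunctor.id k (RComod k H) M.carrier
  comp F G := LFunctor.comp F G
  whiskerLeft F _ _ η := LaxModuleFunctor.whiskerLeft F.toLaxModuleFunctor η
  whiskerRight η G := LaxModuleFunctor.whiskerRight η G.toLaxModuleFunctor
  associator F G K := LFunctor.isoMk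
    (LaxModuleFunctor.assoc F.toLaxModuleFunctor G.toLaxModuleFunctor K.toLaxModuleFunctor)
  leftUnitor F := LFunctor.isoMk F.toLaxModuleFunctor.idComp
  rightUnitor F := LFunctor.isoMk F.toLaxModuleFunctor.compId
  whiskerLeft_id _ _ := rfl
  whiskerLeft_comp _ _ _ _ _ _ := rfl
  id_whiskerLeft η := LaxModuleFunctor.hom_ext fun _ => id_comp_comp_id _
  comp_whiskerLeft _ _ _ _ η := LaxModuleFunctor.hom_ext fun _ => id_comp_comp_id _
  id_whiskerRight _ G := LaxModuleFunctor.hom_ext fun _ => G.functor.map_id _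
  comp_whiskerRight _ _ G := LaxModuleFunctor.hom_ext fun _ => G.functor.map_comp _ _
  whiskerRight_id _ := LaxModuleFunctor.hom_ext fun _ => id_comp_comp_id _
  whiskerRight_comp _ _ _ := LaxModuleFunctor.hom_ext fun _ => id_comp_comp_id _
  whisker_assoc _ _ _ _ _ := LaxModuleFunctor.hom_ext fun _ => id_comp_comp_id _
  whisker_exchange _ η := LaxModuleFunctor.hom_ext fun _ =>
    ((LaxModuleFunctor.Hom.nat η).naturality _).symm
  pentagon _ _ _ K := LaxModuleFunctor.hom_ext fun _ =>
    map_id_comp_id_comp_id K.functor _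
  triangle _ G := LaxModuleFunctor.hom_ext fun _ => id_comp_map_id G.functor _

/-- The 2-category `_H𝔐-Mod`: the 1-cells are the left exact strong module functors, and the
2-cells are the morphisms of module functors. -/
instance : Bicategory (ModModCat.{v, w} k H) where
  Hom M N := LeftExactStrongFunctor (HMod k H) M.carrier N.carrier
  id M := LeftExactStrongFunctor.id (HMod k H) M.carrier
  comp F G := LeftExactStrongFunctor.comp F G
  whiskerLeft F _ _ η := LaxModuleFunctor.whiskerLeft F.toLaxModuleFunctor η
  whiskerRight η G := LaxModuleFunctor.whiskerRight η G.toLaxModuleFunctor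
  associator F G K := LeftExactStrongFunctor.isoMk
    (LaxModuleFunctor.assoc F.toLaxModuleFunctor G.toLaxModuleFunctor K.toLaxModuleFunctor)
  leftUnitor F := LeftExactStrongFunctor.isoMk F.toLaxModuleFunctor.idComp
  rightUnitor F := LeftExactStrongFunctor.isoMk F.toLaxModuleFunctor.compId
  whiskerLeft_id _ _ := rfl
  whiskerLeft_comp _ _ _ _ _ _ := rfl
  id_whiskerLeft η := LaxModuleFunctor.hom_ext fun _ => id_comp_comp_id _
  comp_whiskerLeft _ _ _ _ η := LaxModuleFunctor.hom_ext fun _ => id_comp_comp_id _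
  id_whiskerRight _ G := LaxModuleFunctor.hom_ext fun _ => G.functor.map_id _
  comp_whiskerRight _ _ G := LaxModuleFunctor.hom_ext fun _ => G.functor.map_comp _ _
  whiskerRight_id _ := LaxModuleFunctor.hom_ext fun _ => id_comp_comp_id _
  whiskerRight_comp _ _ _ := LaxModuleFunctor.hom_ext fun _ => id_comp_comp_id _
  whisker_assoc _ _ _ _ _ := LaxModuleFunctor.hom_ext fun _ => id_comp_comp_id _
  whisker_exchange _ η := LaxModuleFunctor.hom_ext fun _ =>
    ((LaxModuleFunctor.Hom.nat η).naturality _).symm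
  pentagon _ _ _ K := LaxModuleFunctor.hom_ext fun _ =>
    map_id_comp_id_comp_id K.functor _
  triangle _ G := LaxModuleFunctor.hom_ext fun _ => id_comp_map_id G.functor _

end Bicategories

/-! ### The 2-functor `M ↦ M_* = ℒ^lax(Vec, M)` -/

section Star

variable {k : Type u} [Field k] {H : Type u} [Ring H] [Bialgebra k H]

/-- The lax `𝔐^H`-module functor `W ↦ W ⊗ V` on vector spaces given by a left `H`-module `V`; its
structure morphism is `x ⊗ (w ⊗ v) ↦ (x₍₀₎ ⊗ w) ⊗ x₍₁₎ v`. -/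
@[simps functor]
def HMod.tensorRightLax (V : HMod k H) :
    LaxModuleFunctor (RComod k H) (ModuleCat.{u} k) (ModuleCat.{u} k) where
  functor := tensorRight V.obj
  lax :=
    { μₗ := fun X W => ModuleCat.ofHom (twist V.act X.coact W)
      μₗ_naturality_left := fun f _ =>
        ModuleCat.hom_ext (twist_natural_left V.act f.comm)
      μₗ_naturality_right := fun X _ _ g =>
        ModuleCat.hom_ext (twist_natural_right V.act X.coact g.hom)
      μₗ_associativity := fun X Y _ =>
        ModuleCat.hom_ext (twist_assoc V.act X.coact Y.coact)
      μₗ_unitality := fun _ => ModuleCat.hom_ext (twist_unit V.act).symm }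

/-- The functor `W ↦ W ⊗ V` is of type `ℒ`. -/
@[simps toLaxModuleFunctor]
def HMod.tensorRight (V : HMod k H) :
    LFunctor k (RComod k H) (ModuleCat.{u} k) (ModuleCat.{u} k) where
  toLaxModuleFunctor := V.tensorRightLax
  additive := inferInstanceAs (MonoidalCategory.tensorRight V.obj).Additive
  linear := inferInstanceAs ((MonoidalCategory.tensorRight V.obj).Linear k)
  leftExact := inferInstanceAs (PreservesFiniteLimits (MonoidalCategory.tensorRight V.obj))
  coproducts _ :=
    preservesColimitsOfShape_of_natIso (BraidedCategory.tensorLeftIsoTensorRight V.obj)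

namespace HMod

/-- The morphism `W ⊗ f : W ⊗ V ⟶ W ⊗ V'` of lax module functors. -/
@[simps nat]
def tensorRightMap {V V' : HMod k H} (f : V ⟶ V') : V.tensorRightLax ⟶ V'.tensorRightLax where
  nat := (tensoringRight (ModuleCat.{u} k)).map f.hom
  comm X _ := ModuleCat.hom_ext (twist_map X.coact f.comm).symm

/-- The isomorphism `W ⊗ (V ⊗ V') ≅ (W ⊗ V) ⊗ V'` of lax module functors. -/
def tensorRightTensor (V V' : HMod k H) :
    (V ⊗ V').tensorRightLax ≅ V.tensorRightLax.comp V'.tensorRightLax :=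
  LaxModuleFunctor.isoMk
    (NatIso.ofComponents (fun W => (α_ W V.obj V'.obj).symm)
      (fun f => MonoidalCategory.associator_inv_naturality_left f V.obj V'.obj))
    fun X _ => ModuleCat.hom_ext (twist_diagAct V.act V'.act X.coassoc)

variable (k H) in
/-- The isomorphism `W ⊗ k ≅ W` of lax module functors. -/
def tensorRightUnit :
    (𝟙_ (HMod k H)).tensorRightLax ≅ LaxModuleFunctor.id (ModuleCat.{u} k) :=
  LaxModuleFunctor.isoMk
    (NatIso.ofComponents (fun W => ρ_ W)
      (fun f => MonoidalCategory.rightUnitor_naturality f))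
    fun X _ => ModuleCat.hom_ext (twist_trivAct X.counit)

end HMod

section Action

variable {M N : Type*} [Category* M] [Category* N] [Preadditive M] [Preadditive N]
  [Linear k M] [Linear k N] [MonoidalLeftAction (RComod k H) M] [MonoidalLeftAction (RComod k H) N]

variable (k H M) in
/-- The category `M_* = ℒ^lax(Vec, M)`. -/
abbrev Star : Type _ := LFunctor k (RComod k H) (ModuleCat.{u} k) M

/-- The left `_H𝔐`-module structure of `M_*`: an `H`-module `V` sends `F` to the composition
`W ↦ F(W ⊗ V)`. -/
instance : MonoidalLeftAction (HMod k H) (Star k H M) where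
  actionObj V F := V.tensorRight.comp F
  actionHomLeft f F := LaxModuleFunctor.whiskerRight (HMod.tensorRightMap f) F.toLaxModuleFunctor
  actionHomRight V _ _ η := LaxModuleFunctor.whiskerLeft V.tensorRightLax η
  actionHom {V V' F F'} f η :=
    CategoryStruct.comp (obj := LaxModuleFunctor (RComod k H) (ModuleCat.{u} k) M)
      (LaxModuleFunctor.whiskerRight (HMod.tensorRightMap f) F.toLaxModuleFunctor)
      (LaxModuleFunctor.whiskerLeft V'.tensorRightLax η)
  actionAssocIso V V' F := LFunctor.isoMk
    (LaxModuleFunctor.whiskerRightIso (HMod.tensorRightTensor V V') F.toLaxModuleFunctor ≪≫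
      LaxModuleFunctor.assoc V.tensorRightLax V'.tensorRightLax F.toLaxModuleFunctor)
  actionUnitIso F := LFunctor.isoMk
    (LaxModuleFunctor.whiskerRightIso (HMod.tensorRightUnit k H) F.toLaxModuleFunctor ≪≫
      LaxModuleFunctor.idComp F.toLaxModuleFunctor)
  actionHom_def f η := rfl
  actionHomRight_id V F := rfl
  id_actionHomLeft V F := LaxModuleFunctor.hom_ext fun W => by
    change F.functor.map (W ◁ 𝟙 V.obj) = 𝟙 _
    simp
  actionHom_comp {V V' V'' F F' F''} f f' η η' := LaxModuleFunctor.hom_ext fun W => by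
    change F.functor.map (W ◁ (f.hom ≫ f'.hom)) ≫ (η.nat.app (W ⊗ V''.obj) ≫ η'.nat.app (W ⊗ V''.obj)) =
      (F.functor.map (W ◁ f.hom) ≫ η.nat.app (W ⊗ V'.obj)) ≫
        (F'.functor.map (W ◁ f'.hom) ≫ η'.nat.app (W ⊗ V''.obj))
    simp
  actionAssocIso_hom_naturality {V₁ V₂ V₃ V₄ F F'} f g η := LaxModuleFunctor.hom_ext fun W => by
    change (F.functor.map (W ◁ (f.hom ⊗ₘ g.hom)) ≫ η.nat.app (W ⊗ (V₂.obj ⊗ V₄.obj))) ≫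
        F'.functor.map (α_ W V₂.obj V₄.obj).inv ≫ 𝟙 _ =
      (F.functor.map (α_ W V₁.obj V₃.obj).inv ≫ 𝟙 _) ≫
        F.functor.map ((W ◁ f.hom) ▷ V₃.obj) ≫ F.functor.map ((W ⊗ V₂.obj) ◁ g.hom) ≫ η.nat.app _
    have key : W ◁ (f.hom ⊗ₘ g.hom) ≫ (α_ W V₂.obj V₄.obj).inv =
        (α_ W V₁.obj V₃.obj).inv ≫ (W ◁ f.hom) ▷ V₃.obj ≫ (W ⊗ V₂.obj) ◁ g.hom := by
      simp [MonoidalCategory.tensorHom_def]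
    rw [Category.comp_id, Category.comp_id, Category.assoc, ← η.nat.naturality,
      ← Functor.map_comp_assoc, ← Functor.map_comp_assoc, ← Functor.map_comp_assoc, key,
      Category.assoc]
  actionUnitIso_hom_naturality {F F'} η := LaxModuleFunctor.hom_ext fun W => by
    change (F.functor.map (ρ_ W).hom ≫ 𝟙 _) ≫ η.nat.app W =
      η.nat.app (W ⊗ 𝟙_ _) ≫ F'.functor.map (ρ_ W).hom ≫ 𝟙 _
    simp
  whiskerLeft_actionHomLeft V {V₁ V₂} f F := LaxModuleFunctor.hom_ext fun W => by
    change F.functor.map (W ◁ V.obj ◁ f.hom) = (F.functor.map (α_ W V.obj V₁.obj).inv ≫ 𝟙 _) ≫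
        F.functor.map ((W ⊗ V.obj) ◁ f.hom) ≫ 𝟙 _ ≫ F.functor.map (α_ W V.obj V₂.obj).hom
    simp [← Functor.map_comp]
  whiskerRight_actionHomLeft {V₁ V₂} V f F := LaxModuleFunctor.hom_ext fun W => by
    change F.functor.map (W ◁ (f.hom ▷ V.obj)) = (F.functor.map (α_ W V₁.obj V.obj).inv ≫ 𝟙 _) ≫
        F.functor.map ((W ◁ f.hom) ▷ V.obj) ≫ 𝟙 _ ≫ F.functor.map (α_ W V₂.obj V.obj).hom
    simp [← Functor.map_comp]
  associator_actionHom V₁ V₂ V₃ F := LaxModuleFunctor.hom_ext fun W => by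
    change F.functor.map (W ◁ (α_ V₁.obj V₂.obj V₃.obj).hom) ≫
        (F.functor.map (α_ W V₁.obj (V₂.obj ⊗ V₃.obj)).inv ≫ 𝟙 _) ≫
        F.functor.map (α_ (W ⊗ V₁.obj) V₂.obj V₃.obj).inv ≫ 𝟙 _ =
      (F.functor.map (α_ W (V₁.obj ⊗ V₂.obj) V₃.obj).inv ≫ 𝟙 _) ≫
        F.functor.map ((α_ W V₁.obj V₂.obj).inv ▷ V₃.obj) ≫ 𝟙 _
    simp [← Functor.map_comp]
  leftUnitor_actionHom V F := LaxModuleFunctor.hom_ext fun W => by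
    change F.functor.map (W ◁ (λ_ V.obj).hom) =
      (F.functor.map (α_ W (𝟙_ _) V.obj).inv ≫ 𝟙 _) ≫
        F.functor.map ((ρ_ W).hom ▷ V.obj) ≫ 𝟙 _
    simp [← Functor.map_comp]
  rightUnitor_actionHom V F := LaxModuleFunctor.hom_ext fun W => by
    change F.functor.map (W ◁ (ρ_ V.obj).hom) =
      (F.functor.map (α_ W V.obj (𝟙_ _)).inv ≫ 𝟙 _) ≫
        F.functor.map (ρ_ (W ⊗ V.obj)).hom ≫ 𝟙 _
    simp [← Functor.map_comp]

/-- The functor `F_* : M_* ⥤ N_*`, `T ↦ F ∘ T`, as a lax `_H𝔐`-module functor (the structure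
morphisms have identity components). -/
def starLax (F : LFunctor k (RComod k H) M N) :
    LaxModuleFunctor (HMod k H) (Star k H M) (Star k H N) where
  functor :=
    { obj := fun T => T.comp F
      map := fun η => LaxModuleFunctor.whiskerRight η F.toLaxModuleFunctor
      map_id := fun T => LaxModuleFunctor.hom_ext fun _ => F.functor.map_id _
      map_comp := fun η θ => LaxModuleFunctor.hom_ext fun _ => F.functor.map_comp _ _ }
  lax :=
    { μₗ := fun V T => (LFunctor.isoMk (F := V.tensorRight.comp (T.comp F))
        (G := (V.tensorRight.comp T).comp F) (LaxModuleFunctor.assoc V.tensorRightLax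
          T.toLaxModuleFunctor F.toLaxModuleFunctor).symm).hom
      μₗ_naturality_left := fun {V V'} f T => LaxModuleFunctor.hom_ext fun W => by
        change F.functor.map (T.functor.map (W ◁ f.hom)) ≫ 𝟙 _ =
          𝟙 _ ≫ F.functor.map (T.functor.map (W ◁ f.hom))
        simp
      μₗ_naturality_right := fun V T T' η => LaxModuleFunctor.hom_ext fun W => by
        change F.functor.map ((LaxModuleFunctor.Hom.nat η).app (W ⊗ V.obj)) ≫ 𝟙 _ =
          𝟙 _ ≫ F.functor.map ((LaxModuleFunctor.Hom.nat η).app (W ⊗ V.obj))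
        simp
      μₗ_associativity := fun V V' T => LaxModuleFunctor.hom_ext fun W => by
        change 𝟙 _ ≫ F.functor.map (T.functor.map (α_ W V.obj V'.obj).inv ≫ 𝟙 _) =
          (F.functor.map (T.functor.map (α_ W V.obj V'.obj).inv) ≫ 𝟙 _) ≫ 𝟙 _ ≫ 𝟙 _
        simp
      μₗ_unitality := fun T => LaxModuleFunctor.hom_ext fun W => by
        change F.functor.map (T.functor.map (ρ_ W).hom) ≫ 𝟙 _ =
          𝟙 _ ≫ F.functor.map (T.functor.map (ρ_ W).hom ≫ 𝟙 _)
        simp }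

theorem starLax_isStrong (F : LFunctor k (RComod k H) M N) : (starLax F).IsStrong :=
  fun V T => inferInstanceAs (IsIso (LFunctor.isoMk (F := V.tensorRight.comp (T.comp F))
        (G := (V.tensorRight.comp T).comp F) (LaxModuleFunctor.assoc V.tensorRightLax
          T.toLaxModuleFunctor F.toLaxModuleFunctor).symm).hom)

/-- The natural transformation `F_* ⟶ G_*` induced by `F ⟶ G`, with components `θ ∘ T`. -/
def starMap₂ {F G : LFunctor k (RComod k H) M N} (θ : F ⟶ G) : starLax F ⟶ starLax G where
  nat :=
    { app := fun T => LaxModuleFunctor.whiskerLeft T.toLaxModuleFunctor θ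
      naturality := fun _ _ η => LaxModuleFunctor.hom_ext fun W =>
        (LaxModuleFunctor.Hom.nat θ).naturality ((LaxModuleFunctor.Hom.nat η).app W) }
  comm V T := LaxModuleFunctor.hom_ext fun W => by
    change 𝟙 _ ≫ (LaxModuleFunctor.Hom.nat θ).app (T.functor.obj (W ⊗ V.obj)) =
      (LaxModuleFunctor.Hom.nat θ).app (T.functor.obj (W ⊗ V.obj)) ≫ 𝟙 _
    simp

end Action

end Star

/-- The condition that the left `_H𝔐`-module category `M_*` is equivalent to `_H𝔐^C` for some left
`H`-module coalgebra `C`, for all 0-cells `M` of `𝔐^H-Mod`. -/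
def StarIsModModCat (k : Type u) [Field k] (H : Type u) [Ring H] [Bialgebra k H] : Prop :=
  ∀ M : ComodModCat.{v, w} k H, ∃ C : ModuleCoalgebra k H,
    ModuleEquivalent (HMod k H) (Star k H M.carrier) C.HComod

/-- The condition that `F_*` is left exact for all 1-cells `F` of `𝔐^H-Mod`. -/
def StarIsLeftExact (k : Type u) [Field k] (H : Type u) [Ring H] [Bialgebra k H] : Prop :=
  ∀ (M N : ComodModCat.{v, w} k H) (F : M ⟶ N), PreservesFiniteLimits (starLax F).functor

variable {k : Type u} [Field k] {H : Type u} [Ring H] [Bialgebra k H]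

/-- The 2-functor `(-)_* : 𝔐^H-Mod → _H𝔐-Mod`, with `M_* = ℒ^lax(Vec, M)` on 0-cells, `F_* = F ∘ -`
on 1-cells and `θ_* = θ ∘ -` on 2-cells. It is strict, in the sense that its comparison
2-isomorphisms have identity components. -/
def starFunctor (h₀ : StarIsModModCat.{v, w} k H) (h₁ : StarIsLeftExact.{v, w} k H) :
    Pseudofunctor (ComodModCat.{v, w} k H)
      (ModModCat.{max (u + 1) v, max (u + 1) v w} k H) where
  obj M := { carrier := Star k H M.carrier, exists_equiv := h₀ M }
  map {M N} F :=
    { toLaxModuleFunctor := starLax F, strong := starLax_isStrong F, leftExact := h₁ M N F }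
  map₂ θ := starMap₂ θ
  map₂_id F := LaxModuleFunctor.hom_ext fun T => rfl
  map₂_comp θ θ' := LaxModuleFunctor.hom_ext fun T => rfl
  mapId M := LeftExactStrongFunctor.isoMk <| LaxModuleFunctor.isoMk
    (NatIso.ofComponents
      (fun (T : Star k H M.carrier) =>
        (LFunctor.isoMk T.toLaxModuleFunctor.compId : T.comp (LFunctor.id k _ _) ≅ T))
      fun η => LaxModuleFunctor.hom_ext fun W => by
        change (LaxModuleFunctor.Hom.nat η).app W ≫ 𝟙 _ = 𝟙 _ ≫ (LaxModuleFunctor.Hom.nat η).app W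
        simp)
    fun V T => LaxModuleFunctor.hom_ext fun W => by
      change 𝟙 (T.functor.obj (W ⊗ V.obj)) ≫ 𝟙 _ = 𝟙 _ ≫ 𝟙 _
      rfl
  mapComp {M N K} F G := LeftExactStrongFunctor.isoMk <| LaxModuleFunctor.isoMk
    (NatIso.ofComponents
      (fun (T : Star k H M.carrier) =>
        (LFunctor.isoMk (LaxModuleFunctor.assoc T.toLaxModuleFunctor F.toLaxModuleFunctor
          G.toLaxModuleFunctor).symm : T.comp (F.comp G) ≅ (T.comp F).comp G))
      fun η => LaxModuleFunctor.hom_ext fun W => by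
        change G.functor.map (F.functor.map ((LaxModuleFunctor.Hom.nat η).app W)) ≫ 𝟙 _ =
          𝟙 _ ≫ G.functor.map (F.functor.map ((LaxModuleFunctor.Hom.nat η).app W))
        simp)
    fun V T => LaxModuleFunctor.hom_ext fun W => by
      change 𝟙 (G.functor.obj (F.functor.obj (T.functor.obj (W ⊗ V.obj)))) ≫ 𝟙 _ =
        𝟙 _ ≫ 𝟙 _ ≫ G.functor.map (𝟙 _)
      simp
  map₂_whisker_left {M N K} F {G G'} θ := LaxModuleFunctor.hom_ext fun T =>
    LaxModuleFunctor.hom_ext fun W => id_comp_comp_id _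
  map₂_whisker_right {M N K F F'} θ G := LaxModuleFunctor.hom_ext fun T =>
    LaxModuleFunctor.hom_ext fun W => id_comp_comp_id _
  map₂_associator {M N K L} F G E := LaxModuleFunctor.hom_ext fun T =>
    LaxModuleFunctor.hom_ext fun W => by
      change 𝟙 (E.functor.obj (G.functor.obj (F.functor.obj (T.functor.obj W)))) =
        𝟙 _ ≫ E.functor.map (𝟙 _) ≫ 𝟙 _ ≫ 𝟙 _ ≫ 𝟙 _
      simp
  map₂_left_unitor {M N} F := LaxModuleFunctor.hom_ext fun T =>
    LaxModuleFunctor.hom_ext fun W => by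
      change 𝟙 (F.functor.obj (T.functor.obj W)) = 𝟙 _ ≫ F.functor.map (𝟙 _) ≫ 𝟙 _
      simp
  map₂_right_unitor {M N} F := LaxModuleFunctor.hom_ext fun T =>
    LaxModuleFunctor.hom_ext fun W => by
      change 𝟙 (F.functor.obj (T.functor.obj W)) = 𝟙 _ ≫ 𝟙 _ ≫ 𝟙 _
      simp

/-- A 2-functor is a 2-equivalence if it is essentially surjective on 0-cells (up to equivalence)
and induces an equivalence on each category of 1-cells. -/
def IsTwoEquivalence {B B' : Type*} [Bicategory B] [Bicategory B'] (F : Pseudofunctor B B') :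
    Prop :=
  (∀ b' : B', ∃ b : B, Nonempty (Bicategory.Equivalence (F.obj b) b')) ∧
    ∀ a b : B, (F.mapFunctor a b).IsEquivalence

end ModuleDuality

end

/-! The proof computes `(𝔐^C)_*` and then reconstructs a functor on `𝔐^C` from its values on cofree
comodules.

Objects of `(𝔐^C)_*`. Every vector space is a coproduct of copies of `k`, so a linear
coproduct-preserving functor `T` on `Vec` is `W ↦ W ⊗ P` with `P = T(k)`. By naturality in `W`, its
structure morphisms reduce to endomorphisms of the spaces `X ⊗ P`, natural in the `H`-comodule `X`
(a `NaturalTwist`). Naturality along the coaction `X ⟶ X ⊗ H` leaves only the endomorphism at `X =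
H`, and applying `ε` to it gives a map `H ⊗ P ⟶ P`. The unit and the multiplication of `H` are
colinear, so the unit and associativity axioms of a module functor say that this map is an action;
colinearity of the structure morphism at `H` says that `P` lies in `_H𝔐^C`. Thus `P ↦ (- ⊗ P)` is an
equivalence from `_H𝔐^C` to `(𝔐^C)_*` (`toStarFiberIso`, `fiberHom_act`). It is a strong module
functor, and a quasi-inverse of a strong module equivalence is again a module functor
(`moduleEquivalent_of_isStrong`). Since `M ↦ M_*` respects equivalences, every `M_*` is a 0-cell,
and every 0-cell arises up to equivalence.

Left exactness of `F_*`. In `𝔐^C` coproducts are exact, because finite limits and coproducts are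
computed in `Vec`. Hence a pointwise finite limit of functors of type `ℒ` is of type `ℒ`, finite
limits in `M_*` are pointwise, and a left exact `F` preserves them.

Full faithfulness on 1-cells. Every comodule `M` is the equalizer of `M ⊗ C ⇉ M ⊗ C ⊗ C`
(`isEqualizer_coactHom`). A left exact functor on `𝔐^C` is therefore controlled by its values on the
comodules `W ⊗ C`, that is, by its composite with the object `- ⊗ C` of `(𝔐^C)_*`. A morphism `φ :
F_* ⟶ G_*` has a component at `- ⊗ C`, and passing to equalizers turns it into a morphism `F ⟶ G`.
It induces `φ` because the coaction of `P` is a morphism `- ⊗ P ⟶ P ⊗ (- ⊗ C)` in `(𝔐^C)_*`, and `φ`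
respects both this morphism and the action of the module `P`.

Essential surjectivity on 1-cells. Given a strong left exact `Φ : (𝔐^C)_* ⟶ N_*`, put `L = Φ(- ⊗
C)`, with the morphism `d : L ⟶ C ⊗ L` induced by the comultiplication. Let `F(M)` be the equalizer
of `L(M) ⇉ L(M ⊗ C)` formed from the coaction of `M` and from `d`. Both `F ∘ (- ⊗ P)` and `Φ(- ⊗ P)`
are equalizers of the same pair `P ⊗ L ⇉ P ⊗ C ⊗ L`, which gives `F_* ≅ Φ` (`exists_starLax_iso`).

An arbitrary source 0-cell is equivalent to some `𝔐^C`, and precomposition with an equivalence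
transfers the result to it. -/

noncomputable section

namespace ModuleDuality

/-! ### Limits of module functors -/

section LimitsOfModuleFunctors

/-- If colimits of shape `S` commute with limits of shape `J`, then `lim` preserves colimits of
shape `S`. -/
theorem preservesColimitsOfShape_lim {J S N : Type*} [Category* J] [Category* S] [Category* N]
    [HasLimitsOfShape J N] [HasColimitsOfShape S N]
    [PreservesLimitsOfShape J (colim : (S ⥤ N) ⥤ N)] :
    PreservesColimitsOfShape S (lim : (J ⥤ N) ⥤ N) where
  preservesColimit {K} := ⟨fun {c} hc => by
    -- The limits of the `K.obj s`, taken together, form a limit of `K.flip` in `S ⥤ N`. Applying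
    -- `colim`, which preserves it, exhibits the colimit over `s` of these limits as a limit over
    -- `j`.
    let cone : Cone K.flip :=
      { pt := K ⋙ lim
        π := { app := fun j =>
                { app := fun s => limit.π (K.obj s) j
                  naturality := fun s s' f => limMap_π (K.map f) j }
               naturality := fun j j' f => by
                ext s
                exact (Category.id_comp _).trans (limit.w (K.obj s) f).symm } }
    have hcone : IsLimit cone := evaluationJointlyReflectsLimits _ fun s =>
      IsLimit.ofIsoLimit (limit.isLimit (K.obj s)) (Cone.ext (Iso.refl _) fun j => by
        simp [cone])
    have h1 : IsLimit (colim.mapCone cone) := isLimitOfPreserves colim hcone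
    let e : K.flip ⋙ colim ≅ c.pt := NatIso.ofComponents
      (fun j => (colimit.isColimit (K.flip.obj j)).coconePointUniqueUpToIso
        (isColimitOfPreserves ((evaluation J N).obj j) hc))
        fun {j j'} f => colimit.hom_ext fun s => by
          have h2 := (colimit.isColimit (K.flip.obj j)).comp_coconePointUniqueUpToIso_hom
            (isColimitOfPreserves ((evaluation J N).obj j) hc) s
          have h3 := (colimit.isColimit (K.flip.obj j')).comp_coconePointUniqueUpToIso_hom
            (isColimitOfPreserves ((evaluation J N).obj j') hc) s
          dsimp at h2 h3 ⊢
          rw [ι_colimMap_assoc, h3, reassoc_of% h2]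
          exact (c.ι.app s).naturality f
    let i := IsLimit.conePointsIsoOfNatIso h1 (limit.isLimit c.pt) e
    -- An abstract isomorphism is not enough: the canonical comparison morphism itself has to be
    -- invertible, so it is identified with `i` on all injections and projections.
    have h4 : (colimit.isColimit (K ⋙ lim)).desc (lim.mapCocone c) = i.hom := by
      refine colimit.hom_ext fun s => limit.hom_ext fun j => ?_
      have h2 := (colimit.isColimit (K.flip.obj j)).comp_coconePointUniqueUpToIso_hom
            (isColimitOfPreserves ((evaluation J N).obj j) hc) s
      have h5 := IsLimit.conePointsIsoOfNatIso_hom_comp h1 (limit.isLimit c.pt) e j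
      dsimp [i] at h2 h5 ⊢
      refine (Category.assoc _ _ _).trans (Eq.trans ?_ (Category.assoc _ _ _).symm)
      refine Eq.trans ?_ (congrArg (colimit.ι (K ⋙ lim) s ≫ ·) h5.symm)
      rw [colimit.ι_desc_assoc]
      dsimp [e]
      rw [limMap_π, ι_colimMap_assoc, h2]
    have : IsIso ((colimit.isColimit (K ⋙ lim)).desc (lim.mapCocone c)) := by
      rw [h4]; infer_instance
    exact ⟨IsColimit.ofPointIso (colimit.isColimit (K ⋙ lim))⟩⟩

/-- Limits in `J ⥤ N` are computed at each `j`, where the flipped functor is `G.obj j`. A pointwise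
limit of functors is the flip followed by `lim`, so this is the first half of its exactness; the
next lemma is the same for colimits. -/
theorem preservesLimitsOfShape_flip {J S M N : Type*} [Category* J] [Category* S] [Category* M]
    [Category* N] (G : J ⥤ M ⥤ N) (h : ∀ j, PreservesLimitsOfShape S (G.obj j)) :
    PreservesLimitsOfShape S G.flip :=
  ⟨fun {_} => ⟨fun {_} hc => ⟨evaluationJointlyReflectsLimits _
    fun j => have := h j; isLimitOfPreserves (G.obj j) hc⟩⟩⟩

theorem preservesColimitsOfShape_flip {J S M N : Type*} [Category* J] [Category* S] [Category* M]
    [Category* N] (G : J ⥤ M ⥤ N) (h : ∀ j, PreservesColimitsOfShape S (G.obj j)) :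
    PreservesColimitsOfShape S G.flip :=
  ⟨fun {_} => ⟨fun {_} hc => ⟨evaluationJointlyReflectsColimits _
    fun j => have := h j; isColimitOfPreserves (G.obj j) hc⟩⟩⟩

variable {k : Type u} [Field k] {C : Type*} [Category* C] [MonoidalCategory C]
  {M N K : Type*} [Category* M] [Category* N] [Category* K]
  [Preadditive M] [Preadditive N] [Preadditive K] [Linear k M] [Linear k N] [Linear k K]
  [MonoidalLeftAction C M] [MonoidalLeftAction C N] [MonoidalLeftAction C K]

variable (k C M N) in
/-- The underlying functor of a functor of type `ℒ`. -/
@[simps]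
def LFunctor.underlying : LFunctor k C M N ⥤ M ⥤ N where
  obj F := F.functor
  map η := LaxModuleFunctor.Hom.nat η

variable (k C N) in
/-- The evaluation of functors of type `ℒ` at an object. -/
abbrev LFunctor.ev (m : M) : LFunctor k C M N ⥤ N :=
  LFunctor.underlying k C M N ⋙ (evaluation M N).obj m

/-! ### Limit cones of functors of type `ℒ` are detected by the evaluations. -/

section JointReflection

variable {J : Type*} [Category* J] {D : J ⥤ LFunctor k C M N} {c : Cone D}

/-- The leg of a cone of functors of type `ℒ`, evaluated at an object. -/
def LFunctor.leg (c : Cone D) (j : J) (m : M) : c.pt.functor.obj m ⟶ (D.obj j).functor.obj m :=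
  (LaxModuleFunctor.Hom.nat (c.π.app j)).app m

theorem LFunctor.leg_naturality (c : Cone D) (j : J) {m m' : M} (f : m ⟶ m') :
    c.pt.functor.map f ≫ LFunctor.leg c j m' = LFunctor.leg c j m ≫ (D.obj j).functor.map f :=
  (LaxModuleFunctor.Hom.nat (c.π.app j)).naturality f

theorem LFunctor.str_leg (c : Cone D) (j : J) (x : C) (m : M) :
    c.pt.str x m ≫ LFunctor.leg c j (x ⊙ₗ m) = x ⊴ₗ LFunctor.leg c j m ≫ (D.obj j).str x m :=
  LaxModuleFunctor.Hom.comm (c.π.app j) x m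

theorem LFunctor.ev_hom_ext (hc : ∀ m, IsLimit ((LFunctor.ev k C N m).mapCone c))
    {X : N} {m : M} {f g : X ⟶ c.pt.functor.obj m}
    (h : ∀ j, f ≫ LFunctor.leg c j m = g ≫ LFunctor.leg c j m) : f = g :=
  (hc m).hom_ext h

variable (hc : ∀ m, IsLimit ((LFunctor.ev k C N m).mapCone c))

/-- The lift of a cone at an object. -/
def LFunctor.evLift (s : Cone D) (m : M) : s.pt.functor.obj m ⟶ c.pt.functor.obj m :=
  (hc m).lift ((LFunctor.ev k C N m).mapCone s)

theorem LFunctor.evLift_leg (s : Cone D) (m : M) (j : J) :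
    LFunctor.evLift hc s m ≫ LFunctor.leg c j m = LFunctor.leg s j m :=
  (hc m).fac ((LFunctor.ev k C N m).mapCone s) j

theorem LFunctor.evLift_leg_assoc (s : Cone D) (m : M) (j : J) {Z : N}
    (h : (D.obj j).functor.obj m ⟶ Z) :
    LFunctor.evLift hc s m ≫ LFunctor.leg c j m ≫ h = LFunctor.leg s j m ≫ h := by
  rw [← Category.assoc, LFunctor.evLift_leg]

/-- A cone of functors of type `ℒ` all of whose evaluations are limit cones is a limit cone. -/
def LFunctor.isLimitOfEv : IsLimit c where
  lift s :=
    { nat :=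
        { app := LFunctor.evLift hc s
          naturality := fun m m' f => LFunctor.ev_hom_ext hc fun j => by
            rw [Category.assoc, Category.assoc, LFunctor.leg_naturality, LFunctor.evLift_leg,
              LFunctor.evLift_leg_assoc, LFunctor.leg_naturality] }
      comm := fun x m => LFunctor.ev_hom_ext hc fun j => by
        rw [Category.assoc, Category.assoc, LFunctor.str_leg, LFunctor.evLift_leg,
          ← actionHomRight_comp_assoc, LFunctor.evLift_leg, LFunctor.str_leg] }
  fac s j := LFunctor.hom_ext fun m => LFunctor.evLift_leg hc s m j
  uniq s t ht := LFunctor.hom_ext fun m => LFunctor.ev_hom_ext hc fun j => by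
    rw [LFunctor.evLift_leg]
    exact congrArg (fun η => (LaxModuleFunctor.Hom.nat η).app m) (ht j)

end JointReflection

/-! ### The pointwise limit as a linear lax module functor. -/

section Pointwise

variable {J : Type*} [Category* J] (D : J ⥤ LFunctor k C M N)

/-- The evaluation of a diagram of functors of type `ℒ` at an object. -/
abbrev LFunctor.evDiagram (m : M) : J ⥤ N := D ⋙ LFunctor.ev k C N m

variable [HasLimitsOfShape J N]

/-- The limit of a diagram of functors of type `ℒ` at an object. -/
def LFunctor.evLimit (m : M) : N := limit (LFunctor.evDiagram D m)

/-- The projections of the limit of a diagram of functors of type `ℒ` at an object. -/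
def LFunctor.evπ (j : J) (m : M) : LFunctor.evLimit D m ⟶ (D.obj j).functor.obj m :=
  limit.π (LFunctor.evDiagram D m) j

theorem LFunctor.evπ_w {i j : J} (f : i ⟶ j) (m : M) :
    LFunctor.evπ D i m ≫ (LaxModuleFunctor.Hom.nat (D.map f)).app m = LFunctor.evπ D j m :=
  limit.w (LFunctor.evDiagram D m) f

variable {D} in
theorem LFunctor.evLimit_hom_ext {X : N} {m : M} {f g : X ⟶ LFunctor.evLimit D m}
    (h : ∀ j, f ≫ LFunctor.evπ D j m = g ≫ LFunctor.evπ D j m) : f = g :=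
  limit.hom_ext h

-- Stated as an existence so that the lift chosen from it is known only through its composites with
-- the projections.
variable {D} in
theorem LFunctor.exists_evLimit_lift {X : N} {m : M} (f : ∀ j, X ⟶ (D.obj j).functor.obj m)
    (hf : ∀ i j (g : i ⟶ j), f i ≫ (LaxModuleFunctor.Hom.nat (D.map g)).app m = f j) :
    ∃ t : X ⟶ LFunctor.evLimit D m, ∀ j, t ≫ LFunctor.evπ D j m = f j :=
  ⟨limit.lift (LFunctor.evDiagram D m) ⟨X, ⟨f, fun i j g =>
    (Category.id_comp _).trans (hf i j g).symm⟩⟩, fun j => limit.lift_π _ j⟩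

/-- A morphism to the limit at an object from a compatible family. -/
def LFunctor.evLimitLift {X : N} {m : M} (f : ∀ j, X ⟶ (D.obj j).functor.obj m)
    (hf : ∀ i j (g : i ⟶ j), f i ≫ (LaxModuleFunctor.Hom.nat (D.map g)).app m = f j) :
    X ⟶ LFunctor.evLimit D m :=
  (LFunctor.exists_evLimit_lift f hf).choose

@[simp]
theorem LFunctor.evLimitLift_evπ {X : N} {m : M} (f : ∀ j, X ⟶ (D.obj j).functor.obj m)
    (hf : ∀ i j (g : i ⟶ j), f i ≫ (LaxModuleFunctor.Hom.nat (D.map g)).app m = f j) (j : J) :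
    LFunctor.evLimitLift D f hf ≫ LFunctor.evπ D j m = f j :=
  (LFunctor.exists_evLimit_lift f hf).choose_spec j

@[simp]
theorem LFunctor.evLimitLift_evπ_assoc {X : N} {m : M} (f : ∀ j, X ⟶ (D.obj j).functor.obj m)
    (hf : ∀ i j (g : i ⟶ j), f i ≫ (LaxModuleFunctor.Hom.nat (D.map g)).app m = f j) (j : J)
    {Z : N} (h : (D.obj j).functor.obj m ⟶ Z) :
    LFunctor.evLimitLift D f hf ≫ LFunctor.evπ D j m ≫ h = f j ≫ h := by
  rw [← Category.assoc, LFunctor.evLimitLift_evπ]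

theorem LFunctor.evMap_compat {m m' : M} (f : m ⟶ m') (i j : J) (g : i ⟶ j) :
    (LFunctor.evπ D i m ≫ (D.obj i).functor.map f) ≫
        (LaxModuleFunctor.Hom.nat (D.map g)).app m' =
      LFunctor.evπ D j m ≫ (D.obj j).functor.map f := by
  rw [Category.assoc, NatTrans.naturality, ← Category.assoc, LFunctor.evπ_w]

/-- The pointwise limit of a diagram of functors of type `ℒ`, as a functor. -/
def LFunctor.pointwiseLimitFunctor : M ⥤ N where
  obj m := LFunctor.evLimit D m
  map {m m'} f := LFunctor.evLimitLift D (fun j => LFunctor.evπ D j m ≫ (D.obj j).functor.map f)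
    (LFunctor.evMap_compat D f)
  map_id m := LFunctor.evLimit_hom_ext fun j => by simp
  map_comp f g := LFunctor.evLimit_hom_ext fun j => by simp

/-- The projections of the pointwise limit. -/
def LFunctor.pointwiseπ (j : J) (m : M) :
    (LFunctor.pointwiseLimitFunctor D).obj m ⟶ (D.obj j).functor.obj m :=
  LFunctor.evπ D j m

theorem LFunctor.pointwiseπ_w {i j : J} (f : i ⟶ j) (m : M) :
    LFunctor.pointwiseπ D i m ≫ (LaxModuleFunctor.Hom.nat (D.map f)).app m =
      LFunctor.pointwiseπ D j m :=
  LFunctor.evπ_w D f m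

variable {D} in
theorem LFunctor.pointwise_hom_ext {X : N} {m : M}
    {f g : X ⟶ (LFunctor.pointwiseLimitFunctor D).obj m}
    (h : ∀ j, f ≫ LFunctor.pointwiseπ D j m = g ≫ LFunctor.pointwiseπ D j m) : f = g :=
  limit.hom_ext h

@[simp]
theorem LFunctor.pointwiseLimitFunctor_map_π {m m' : M} (f : m ⟶ m') (j : J) :
    (LFunctor.pointwiseLimitFunctor D).map f ≫ LFunctor.pointwiseπ D j m' =
      LFunctor.pointwiseπ D j m ≫ (D.obj j).functor.map f :=
  LFunctor.evLimitLift_evπ D (fun j => LFunctor.evπ D j m ≫ (D.obj j).functor.map f)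
    (LFunctor.evMap_compat D f) j

theorem LFunctor.pointwiseStr_compat (x : C) (m : M) (i j : J) (g : i ⟶ j) :
    (x ⊴ₗ LFunctor.pointwiseπ D i m ≫ (D.obj i).str x m) ≫
        (LaxModuleFunctor.Hom.nat (D.map g)).app (x ⊙ₗ m) =
      x ⊴ₗ LFunctor.pointwiseπ D j m ≫ (D.obj j).str x m := by
  rw [Category.assoc, LaxModuleFunctor.Hom.comm, ← actionHomRight_comp_assoc,
    LFunctor.pointwiseπ_w]

/-- The structure morphism of the pointwise limit. -/
def LFunctor.pointwiseLimitStr (x : C) (m : M) :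
    x ⊙ₗ (LFunctor.pointwiseLimitFunctor D).obj m ⟶
      (LFunctor.pointwiseLimitFunctor D).obj (x ⊙ₗ m) :=
  LFunctor.evLimitLift D (fun j => x ⊴ₗ LFunctor.pointwiseπ D j m ≫ (D.obj j).str x m)
    (LFunctor.pointwiseStr_compat D x m)

@[simp]
theorem LFunctor.pointwiseLimitStr_π (x : C) (m : M) (j : J) :
    LFunctor.pointwiseLimitStr D x m ≫ LFunctor.pointwiseπ D j (x ⊙ₗ m) =
      x ⊴ₗ LFunctor.pointwiseπ D j m ≫ (D.obj j).str x m :=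
  LFunctor.evLimitLift_evπ D _ (LFunctor.pointwiseStr_compat D x m) j

@[simp]
theorem LFunctor.pointwiseLimitStr_π_assoc (x : C) (m : M) (j : J) {Z : N}
    (h : (D.obj j).functor.obj (x ⊙ₗ m) ⟶ Z) :
    LFunctor.pointwiseLimitStr D x m ≫ LFunctor.pointwiseπ D j (x ⊙ₗ m) ≫ h =
      x ⊴ₗ LFunctor.pointwiseπ D j m ≫ (D.obj j).str x m ≫ h := by
  rw [← Category.assoc, LFunctor.pointwiseLimitStr_π, Category.assoc]

/-- The pointwise limit of a diagram of functors of type `ℒ`, as a lax module functor. -/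
@[simps functor]
def LFunctor.pointwiseLimitLax : LaxModuleFunctor C M N where
  functor := LFunctor.pointwiseLimitFunctor D
  lax :=
    { μₗ := LFunctor.pointwiseLimitStr D
      μₗ_naturality_left := fun {c c'} f m => LFunctor.pointwise_hom_ext fun j => by
        rw [Category.assoc, Category.assoc, LFunctor.pointwiseLimitStr_π,
          LFunctor.pointwiseLimitFunctor_map_π, LFunctor.pointwiseLimitStr_π_assoc,
          ← Functor.LaxLeftLinear.μₗ_naturality_left, action_exchange_assoc]
      μₗ_naturality_right := fun c m m' f => LFunctor.pointwise_hom_ext fun j => by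
        rw [Category.assoc, Category.assoc, LFunctor.pointwiseLimitStr_π,
          LFunctor.pointwiseLimitFunctor_map_π, LFunctor.pointwiseLimitStr_π_assoc,
          ← Functor.LaxLeftLinear.μₗ_naturality_right, ← actionHomRight_comp_assoc,
          ← actionHomRight_comp_assoc, LFunctor.pointwiseLimitFunctor_map_π]
      μₗ_associativity := fun c c' m => LFunctor.pointwise_hom_ext fun j => by
        simp only [Category.assoc, LFunctor.pointwiseLimitStr_π,
          LFunctor.pointwiseLimitFunctor_map_π, LFunctor.pointwiseLimitStr_π_assoc,
          Functor.LaxLeftLinear.μₗ_associativity]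
        rw [← actionHomRight_comp_assoc, LFunctor.pointwiseLimitStr_π]
        simp
      μₗ_unitality := fun m => LFunctor.pointwise_hom_ext fun j => by
        simp only [Category.assoc,
          LFunctor.pointwiseLimitFunctor_map_π, LFunctor.pointwiseLimitStr_π_assoc,
          ← Functor.LaxLeftLinear.μₗ_unitality, actionUnitIso_hom_naturality] }

theorem LFunctor.pointwiseLimitFunctor_additive : (LFunctor.pointwiseLimitFunctor D).Additive :=
  ⟨fun {m m' f g} => LFunctor.pointwise_hom_ext fun j => by
    have := (D.obj j).additive
    rw [LFunctor.pointwiseLimitFunctor_map_π, Functor.map_add, Preadditive.comp_add,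
      Preadditive.add_comp, LFunctor.pointwiseLimitFunctor_map_π,
      LFunctor.pointwiseLimitFunctor_map_π]⟩

theorem LFunctor.pointwiseLimitFunctor_linear : (LFunctor.pointwiseLimitFunctor D).Linear k :=
  ⟨fun {m m'} f r => LFunctor.pointwise_hom_ext fun j => by
    have := (D.obj j).linear
    rw [LFunctor.pointwiseLimitFunctor_map_π, Functor.map_smul, Linear.comp_smul,
      Linear.smul_comp, LFunctor.pointwiseLimitFunctor_map_π]⟩

/-- The pointwise limit is the composition of `lim` with a diagram-valued functor. -/
def LFunctor.pointwiseLimitFunctorIso : LFunctor.pointwiseLimitFunctor D ≅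
    (D ⋙ LFunctor.underlying k C M N).flip ⋙ lim :=
  NatIso.ofComponents (fun m => Iso.refl (limit (LFunctor.evDiagram D m))) fun {m m'} f =>
    limit.hom_ext fun j => by
      have h1 := LFunctor.pointwiseLimitFunctor_map_π D f j
      have h2 := limMap_π ((D ⋙ LFunctor.underlying k C M N).flip.map f) j
      refine Eq.trans ?_ (h1.trans (h2.symm.trans ?_))
      · exact congrArg (· ≫ _) (Category.comp_id _)
      · exact congrArg (· ≫ _) (Category.id_comp _).symm

end Pointwise

/-! ### Pointwise limits stay of type `ℒ` when coproducts in the target commute with them. -/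

section FiniteLimits

variable {J : Type*} [Category* J] [HasLimitsOfShape J N] [HasCoproducts.{u} N]
  [∀ S : Type u, PreservesLimitsOfShape J (colim : (Discrete S ⥤ N) ⥤ N)]
  (D : J ⥤ LFunctor k C M N)

/-- The pointwise limit of a diagram of functors of type `ℒ`. -/
@[simps toLaxModuleFunctor]
def LFunctor.pointwiseLimit : LFunctor k C M N where
  toLaxModuleFunctor := LFunctor.pointwiseLimitLax D
  additive := LFunctor.pointwiseLimitFunctor_additive D
  linear := LFunctor.pointwiseLimitFunctor_linear D
  -- Limits commute with limits, so exactness of coproducts in `N` plays no part here.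
  leftExact := ⟨fun S _ _ => by
    have := preservesLimitsOfShape_flip (S := S) (D ⋙ LFunctor.underlying k C M N)
      fun j => (D.obj j).leftExact.preservesFiniteLimits S
    exact preservesLimitsOfShape_of_natIso (LFunctor.pointwiseLimitFunctorIso D).symm⟩
  -- The only use of the hypothesis that coproducts in `N` commute with limits of shape `J`.
  coproducts S := by
    have := preservesColimitsOfShape_flip (S := Discrete S) (D ⋙ LFunctor.underlying k C M N)
      fun j => (D.obj j).coproducts S
    have := preservesColimitsOfShape_lim (J := J) (S := Discrete S) (N := N)
    exact preservesColimitsOfShape_of_natIso (LFunctor.pointwiseLimitFunctorIso D).symm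

/-- The limit cone of a diagram of functors of type `ℒ`. -/
def LFunctor.pointwiseLimitCone : Cone D where
  pt := LFunctor.pointwiseLimit D
  π :=
    { app := fun j =>
        { nat :=
            { app := LFunctor.pointwiseπ D j
              naturality := fun _ _ f => LFunctor.pointwiseLimitFunctor_map_π D f j }
          comm := fun x m => LFunctor.pointwiseLimitStr_π D x m j }
      naturality := fun _ _ f => LFunctor.hom_ext fun m =>
        (Category.id_comp _).trans (LFunctor.evπ_w D f m).symm }

/-- The evaluations of `LFunctor.pointwiseLimitCone` are limit cones. -/
def LFunctor.isLimitEvPointwiseLimitCone (m : M) :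
    IsLimit ((LFunctor.ev k C N m).mapCone (LFunctor.pointwiseLimitCone D)) :=
  IsLimit.ofIsoLimit (limit.isLimit (LFunctor.evDiagram D m))
    (Cone.ext (Iso.refl _) fun _ => (Category.id_comp _).symm)

/-- The pointwise limit is a limit. -/
def LFunctor.isLimitPointwiseLimitCone : IsLimit (LFunctor.pointwiseLimitCone D) :=
  LFunctor.isLimitOfEv (LFunctor.isLimitEvPointwiseLimitCone D)

theorem LFunctor.hasLimitsOfShape : HasLimitsOfShape J (LFunctor k C M N) :=
  ⟨fun D => ⟨⟨⟨_, LFunctor.isLimitPointwiseLimitCone D⟩⟩⟩⟩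

theorem LFunctor.preservesLimitsOfShape_ev (m : M) :
    PreservesLimitsOfShape J (LFunctor.ev k C N m) :=
  ⟨fun {D} => preservesLimit_of_preserves_limit_cone (LFunctor.isLimitPointwiseLimitCone D)
    (LFunctor.isLimitEvPointwiseLimitCone D m)⟩

end FiniteLimits

end LimitsOfModuleFunctors

/-! ### Limits and colimits of comodules -/

namespace RComod

open scoped TensorProduct

section

variable (k : Type u) [Field k] (C : Type u) [AddCommGroup C] [Module k C] [Coalgebra k C]

/-- The comonad `- ⊗ C` on vector spaces. -/
def tensorComonad : Comonad (ModuleCat.{u} k) where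
  toFunctor := MonoidalCategory.tensorRight (ModuleCat.of k C)
  ε :=
    { app := fun W => ModuleCat.ofHom ((TensorProduct.rid k W).toLinearMap ∘ₗ
        (Coalgebra.counit (R := k) (A := C)).lTensor W)
      naturality := fun W W' f => by
        ext : 1
        refine TensorProduct.ext' fun w c => ?_
        change (Coalgebra.counit (R := k) c) • f.hom w = f.hom ((Coalgebra.counit (R := k) c) • w)
        simp }
  δ :=
    { app := fun W => ModuleCat.ofHom ((TensorProduct.assoc k W C C).symm.toLinearMap ∘ₗ
        (Coalgebra.comul (R := k) (A := C)).lTensor W)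
      naturality := fun W W' f => by
        ext : 1
        refine TensorProduct.ext' fun w c => ?_
        change (TensorProduct.assoc k W' C C).symm (f.hom w ⊗ₜ Coalgebra.comul (R := k) c) =
          (f.hom.rTensor C).rTensor C
            ((TensorProduct.assoc k W C C).symm (w ⊗ₜ Coalgebra.comul (R := k) c))
        generalize Coalgebra.comul (R := k) c = t
        induction t with
        | zero => simp
        | add s s' hs hs' => simp only [TensorProduct.tmul_add, map_add, hs, hs']
        | tmul c d => rfl }
  coassoc W := by
    ext t
    have h := LinearMap.congr_fun (copowerCoact_coassoc (V := W)
      (Coalgebra.coassoc (R := k) (A := C))) t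
    change (copowerCoact W (Coalgebra.comul (R := k) (A := C))).rTensor C
        (copowerCoact W (Coalgebra.comul (R := k) (A := C)) t) =
      (TensorProduct.assoc k (W ⊗[k] C) C C).symm
        ((Coalgebra.comul (R := k) (A := C)).lTensor (W ⊗[k] C)
          (copowerCoact W (Coalgebra.comul (R := k) (A := C)) t))
    exact ((LinearEquiv.symm_apply_eq _).2 h.symm).symm
  left_counit W := by
    ext t
    have h := LinearMap.congr_fun (copowerCoact_counit (V := W)
      (Coalgebra.lTensor_counit_comp_comul (R := k) (A := C))) t
    change TensorProduct.rid k (W ⊗[k] C) ((Coalgebra.counit (R := k) (A := C)).lTensor (W ⊗[k] C)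
        (copowerCoact W (Coalgebra.comul (R := k) (A := C)) t)) = t
    refine (congrArg (TensorProduct.rid k (W ⊗[k] C)) h).trans ?_
    exact (TensorProduct.rid_tmul t 1).trans (one_smul k t)
  right_counit W := by
    ext : 1
    refine TensorProduct.ext' fun w c => ?_
    have h : ∀ t : C ⊗[k] C, ((TensorProduct.rid k W).toLinearMap ∘ₗ
        (Coalgebra.counit (R := k) (A := C)).lTensor W).rTensor C
          ((TensorProduct.assoc k W C C).symm (w ⊗ₜ t)) =
        w ⊗ₜ TensorProduct.lid k C ((Coalgebra.counit (R := k) (A := C)).rTensor C t) := by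
      intro t
      induction t with
      | zero => simp
      | add s s' hs hs' => simp only [TensorProduct.tmul_add, map_add, hs, hs']
      | tmul c d => simp [TensorProduct.smul_tmul]
    refine (h (Coalgebra.comul (R := k) c)).trans ?_
    rw [Coalgebra.rTensor_counit_comul]
    simp

/-- Comodules as coalgebras over the comonad `- ⊗ C`. -/
def toCoalgebra : RComod k C ⥤ (tensorComonad k C).Coalgebra where
  obj M :=
    { A := M.obj
      a := ModuleCat.ofHom M.coact
      counit := by
        ext m
        change TensorProduct.rid k M.obj
          ((Coalgebra.counit (R := k) (A := C)).lTensor M.obj (M.coact m)) = m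
        rw [← LinearMap.comp_apply, M.counit]
        simp
      coassoc := by
        ext m
        have h := LinearMap.congr_fun M.coassoc m
        change (TensorProduct.assoc k M.obj C C).symm
          ((Coalgebra.comul (R := k) (A := C)).lTensor M.obj (M.coact m)) =
            M.coact.rTensor C (M.coact m)
        rw [LinearEquiv.symm_apply_eq]
        exact h.symm }
  map f :=
    { f := f.hom
      h := by
        ext : 1
        exact f.comm.symm }

instance : (toCoalgebra k C).Faithful where
  map_injective h := hom_ext (congrArg Comonad.Coalgebra.Hom.f h)

instance : (toCoalgebra k C).Full where
  map_surjective f := ⟨⟨f.f, (congrArg ModuleCat.Hom.hom f.h).symm⟩, rfl⟩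

instance : (toCoalgebra k C).EssSurj where
  mem_essImage A := by
    refine ⟨⟨A.A, A.a.hom, ?_, ?_⟩, ⟨Iso.refl _⟩⟩
    · ext m
      have h : (TensorProduct.assoc k A.A C C).symm
          ((Coalgebra.comul (R := k) (A := C)).lTensor A.A (A.a.hom m)) =
            A.a.hom.rTensor C (A.a.hom m) :=
        LinearMap.congr_fun (congrArg ModuleCat.Hom.hom A.coassoc) m
      exact ((LinearEquiv.symm_apply_eq _).1 h).symm
    · ext m
      have h : TensorProduct.rid k A.A
          ((Coalgebra.counit (R := k) (A := C)).lTensor A.A (A.a.hom m)) = m :=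
        LinearMap.congr_fun (congrArg ModuleCat.Hom.hom A.counit) m
      apply (TensorProduct.rid k A.A).injective
      refine h.trans ?_
      simp

instance : (toCoalgebra k C).IsEquivalence where

instance : PreservesFiniteLimits (tensorComonad k C).toFunctor :=
  inferInstanceAs (PreservesFiniteLimits (MonoidalCategory.tensorRight (ModuleCat.of k C)))

/-- Over a field `- ⊗ C` is exact, so the forgetful functor from coalgebras over this comonad
creates finite limits. Colimits are created for any comonad, which gives the next instance. -/
instance : HasFiniteLimits (RComod k C) := ⟨fun J _ _ => by
  have : HasLimitsOfShape J (tensorComonad k C).Coalgebra :=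
    hasLimitsOfShape_of_hasLimitsOfShape_createsLimitsOfShape (Comonad.forget _)
  exact Adjunction.hasLimitsOfShape_of_equivalence (toCoalgebra k C)⟩

instance : HasCoproducts.{u} (RComod k C) := fun J => by
  have : HasColimitsOfShape (Discrete J) (tensorComonad k C).Coalgebra :=
    hasColimitsOfShape_of_hasColimitsOfShape_createsColimitsOfShape (Comonad.forget _)
  exact Adjunction.hasColimitsOfShape_of_equivalence (toCoalgebra k C)

instance : PreservesFiniteLimits (forget k C) := ⟨fun J _ _ =>
  inferInstanceAs (PreservesLimitsOfShape J (toCoalgebra k C ⋙ Comonad.forget _))⟩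

instance : PreservesColimitsOfSize.{u, u} (forget k C) :=
  inferInstanceAs (PreservesColimitsOfSize.{u, u} (toCoalgebra k C ⋙ Comonad.forget _))

instance : (forget k C).ReflectsIsomorphisms where
  reflects {M N} f h := by
    have : IsIso f.hom := h
    exact (isoMk (asIso f.hom) f.comm).isIso_hom

instance : ReflectsFiniteLimits (forget k C) := ⟨fun _ _ _ =>
  reflectsLimitsOfShape_of_reflectsIsomorphisms⟩

/-- Finite limits and coproducts of comodules are those of the underlying vector spaces, where
coproducts are exact. All later commutations of finite limits with coproducts come from here. -/
instance (J : Type u) : HasExactColimitsOfShape (Discrete J) (RComod k C) :=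
  HasExactColimitsOfShape.domain_of_functor _ (forget k C)

end

end RComod

/-! ### The functors `W ↦ W ⊗ P` -/

section Copower

open scoped TensorProduct

variable {k : Type u} [Field k] {H : Type u} [Ring H] [Bialgebra k H]

/-- Coacting on `M` first separates the two coactions: what remains is the structure morphism of the
functor `- ⊗ C` at `M`. -/
theorem tensorCoact_eq_twist {C : Type u} [AddCommGroup C] [Module k C]
    (a : H →ₐ[k] Module.End k C) {X M : Type u} [AddCommGroup X] [Module k X] [AddCommGroup M]
    [Module k M] (ρ : X →ₗ[k] X ⊗[k] H) (σ : M →ₗ[k] M ⊗[k] C) :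
    tensorCoact a ρ σ = twist a ρ M ∘ₗ σ.lTensor X := by
  ext x m
  simp [tensorCoact]

/-- Colinearity of the structure morphism of `- ⊗ P`. By `hσ` the coaction of `P` is an `H`-linear
map to `P ⊗ C`, so it commutes with the twists; by coassociativity of `ρ` the twist for `P ⊗ C` is
the twist for `C` followed by the one for `P`. -/
theorem copowerCoact_twist {C : Type u} [AddCommGroup C] [Module k C]
    (c : H →ₐ[k] Module.End k C) {X W P : Type u} [AddCommGroup X] [Module k X] [AddCommGroup P]
    [Module k P] [AddCommGroup W] [Module k W] (a : H →ₐ[k] Module.End k P)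
    {ρ : X →ₗ[k] X ⊗[k] H}
    (hρ : (TensorProduct.assoc k X H H).toLinearMap ∘ₗ ρ.rTensor H ∘ₗ ρ =
      (Coalgebra.comul (R := k) (A := H)).lTensor X ∘ₗ ρ)
    {σ : P →ₗ[k] P ⊗[k] C} (hσ : ∀ h p, σ (a h p) = diagAct a c h (σ p)) :
    copowerCoact (X ⊗[k] W) σ ∘ₗ twist a ρ W =
      (twist a ρ W).rTensor C ∘ₗ tensorCoact c ρ (copowerCoact W σ) := by
  have h1 := twist_map (W := W) (a := a) (b := diagAct a c) ρ hσ
  have h2 := twist_diagAct (W := W) a c hρ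
  calc copowerCoact (X ⊗[k] W) σ ∘ₗ twist a ρ W
      = (TensorProduct.assoc k (X ⊗[k] W) P C).symm.toLinearMap ∘ₗ
          (σ.lTensor (X ⊗[k] W) ∘ₗ twist a ρ W) := rfl
    _ = ((TensorProduct.assoc k (X ⊗[k] W) P C).symm.toLinearMap ∘ₗ
          twist (diagAct a c) ρ W) ∘ₗ (σ.lTensor W).lTensor X := by rw [← h1]; rfl
    _ = (twist a ρ W).rTensor C ∘ₗ twist c ρ (W ⊗[k] P) ∘ₗ
          ((TensorProduct.assoc k W P C).symm.toLinearMap ∘ₗ σ.lTensor W).lTensor X := by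
      rw [h2, LinearMap.lTensor_comp]; rfl
    _ = _ := by rw [tensorCoact_eq_twist]; rfl

namespace RComod

variable {C : Type u} [AddCommGroup C] [Module k C] [Coalgebra k C]

/-- The comodule `W ⊗ P` for a vector space `W` and a comodule `P`. -/
@[simps]
def copower (W : ModuleCat.{u} k) (P : RComod k C) : RComod k C where
  obj := W ⊗ P.obj
  coact := copowerCoact W P.coact
  coassoc := copowerCoact_coassoc P.coassoc
  counit := copowerCoact_counit P.counit

/-- The morphism `f ⊗ P`. -/
def copowerMap {W W' : ModuleCat.{u} k} (f : W ⟶ W') (P : RComod k C) :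
    copower W P ⟶ copower W' P :=
  ⟨f ▷ P.obj, copowerCoact_map f.hom (g := LinearMap.id) (by simp)⟩

/-- The functor `W ↦ W ⊗ P`. -/
@[simps obj]
def copowerFunctor (P : RComod k C) : ModuleCat.{u} k ⥤ RComod k C where
  obj W := copower W P
  map f := copowerMap f P
  map_id W := hom_ext (MonoidalCategory.id_whiskerRight W P.obj)
  map_comp f g := hom_ext (MonoidalCategory.comp_whiskerRight f g P.obj)

instance (P : RComod k C) : (copowerFunctor P).Additive where
  map_add := hom_ext (MonoidalPreadditive.add_whiskerRight _ _)

instance (P : RComod k C) : (copowerFunctor P).Linear k where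
  map_smul f r := hom_ext (MonoidalLinear.smul_whiskerRight r f _)

/-- `W ↦ W ⊗ P` on the level of vector spaces. -/
def copowerFunctorForget (P : RComod k C) :
    copowerFunctor P ⋙ forget k C ≅ MonoidalCategory.tensorRight P.obj :=
  NatIso.ofComponents (fun W => Iso.refl (W ⊗ P.obj)) fun f =>
    (Category.comp_id (f ▷ P.obj)).trans (Category.id_comp (f ▷ P.obj)).symm

instance (P : RComod k C) : PreservesFiniteLimits (copowerFunctor P) := by
  have : PreservesFiniteLimits (copowerFunctor P ⋙ forget k C) :=
    preservesFiniteLimits_of_natIso (copowerFunctorForget P).symm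
  exact preservesFiniteLimits_of_reflects_of_preserves _ (forget k C)

instance (P : RComod k C) (J : Type u) :
    PreservesColimitsOfShape (Discrete J) (copowerFunctor P) := by
  have h : PreservesColimitsOfShape (Discrete J) (MonoidalCategory.tensorRight P.obj) :=
    preservesColimitsOfShape_of_natIso (BraidedCategory.tensorLeftIsoTensorRight P.obj)
  have : PreservesColimitsOfShape (Discrete J) (copowerFunctor P ⋙ forget k C) :=
    preservesColimitsOfShape_of_natIso (copowerFunctorForget P).symm
  have : ReflectsColimitsOfShape (Discrete J) (forget k C) :=
    reflectsColimitsOfShape_of_reflectsIsomorphisms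
  exact preservesColimitsOfShape_of_reflects_of_preserves _ (forget k C)

end RComod

namespace ModuleCoalgebra

variable {C : ModuleCoalgebra k H}

namespace HComod

/-- The underlying `H`-module. -/
@[simps]
def toHMod (P : C.HComod) : HMod k H := ⟨P.obj, P.act⟩

/-- The underlying `H`-linear map. -/
@[simps]
def homToHMod {P Q : C.HComod} (f : P ⟶ Q) : P.toHMod ⟶ Q.toHMod := ⟨f.hom, f.act_comm⟩

/-- The structure morphism `x ⊗ (w ⊗ p) ↦ (x₍₀₎ ⊗ w) ⊗ x₍₁₎ p`. -/
@[simps]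
def copowerStr (P : C.HComod) (X : RComod k H) (W : ModuleCat.{u} k) :
    RComod.tensor C.isModuleCoalgebra X (RComod.copower W P.toRComod) ⟶
      RComod.copower (X.obj ⊗ W) P.toRComod where
  hom := ModuleCat.ofHom (twist P.act X.coact W)
  comm := copowerCoact_twist C.act P.act X.coassoc P.coact_act

/-- The lax module functor `W ↦ W ⊗ P`. -/
def copowerLax (P : C.HComod) : LaxModuleFunctor (RComod k H) (ModuleCat.{u} k) C.Comod where
  functor := RComod.copowerFunctor P.toRComod
  lax :=
    { μₗ := fun X W => P.copowerStr X W
      -- On underlying vector spaces the structure morphisms are those of the functor `- ⊗ P` on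
      -- `Vec`, and comodule maps are determined there, so all four axioms are inherited.
      μₗ_naturality_left := fun f W => RComod.hom_ext
        (P.toHMod.tensorRightLax.lax.μₗ_naturality_left f W)
      μₗ_naturality_right := fun X _ _ f => RComod.hom_ext
        (P.toHMod.tensorRightLax.lax.μₗ_naturality_right X f)
      μₗ_associativity := fun X Y W => RComod.hom_ext
        (P.toHMod.tensorRightLax.lax.μₗ_associativity X Y W)
      μₗ_unitality := fun W => RComod.hom_ext
        (P.toHMod.tensorRightLax.lax.μₗ_unitality W) }

/-- The functor `W ↦ W ⊗ P`, as an object of `ℒ^lax(Vec, 𝔐^C)`. -/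
@[simps toLaxModuleFunctor]
def toStar (P : C.HComod) : Star k H C.Comod where
  toLaxModuleFunctor := P.copowerLax
  additive := inferInstanceAs (RComod.copowerFunctor P.toRComod).Additive
  linear := inferInstanceAs ((RComod.copowerFunctor P.toRComod).Linear k)
  leftExact := inferInstanceAs (PreservesFiniteLimits (RComod.copowerFunctor P.toRComod))
  coproducts J :=
    inferInstanceAs (PreservesColimitsOfShape (Discrete J) (RComod.copowerFunctor P.toRComod))

/-- The morphism `W ⊗ f : W ⊗ P ⟶ W ⊗ Q`. -/
def toStarMapApp {P Q : C.HComod} (f : P ⟶ Q) (W : ModuleCat.{u} k) :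
    RComod.copower W P.toRComod ⟶ RComod.copower W Q.toRComod :=
  ⟨W ◁ f.hom, copowerCoact_map LinearMap.id f.comm⟩

variable (C) in
/-- The functor `_H𝔐^C ⥤ ℒ^lax(Vec, 𝔐^C)` that sends `P` to `W ↦ W ⊗ P`. -/
def toStarFunctor : C.HComod ⥤ Star k H C.Comod where
  obj P := P.toStar
  map f :=
    { nat :=
        { app := fun W => toStarMapApp f W
          naturality := fun _ _ g => RComod.hom_ext
            (MonoidalCategory.whisker_exchange g f.hom).symm }
      comm := fun X W => RComod.hom_ext ((HMod.tensorRightMap (homToHMod f)).comm X W) }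
  map_id P := LFunctor.hom_ext fun W => RComod.hom_ext (MonoidalCategory.whiskerLeft_id W P.obj)
  map_comp f g := LFunctor.hom_ext fun W =>
    RComod.hom_ext (MonoidalCategory.whiskerLeft_comp W f.hom g.hom)

/-- The isomorphism `(W ⊗ V) ⊗ P ≅ W ⊗ (V ⊗ P)`. -/
def copowerAssoc (V : HMod k H) (P : C.HComod) (W : ModuleCat.{u} k) :
    RComod.copower (W ⊗ V.obj) P.toRComod ≅ RComod.copower W (tensor V P).toRComod :=
  RComod.isoMk (α_ W V.obj P.obj) (copowerCoact_assoc W V.obj P.coact)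

/-- The isomorphism `(W ⊗ V) ⊗ P ≅ W ⊗ (V ⊗ P)` of objects of `ℒ^lax(Vec, 𝔐^C)`. -/
def toStarStr (V : HMod k H) (P : C.HComod) : V ⊙ₗ P.toStar ≅ (tensor V P).toStar :=
  LFunctor.isoMk <| LaxModuleFunctor.isoMk
    (NatIso.ofComponents (fun W => copowerAssoc V P W)
      fun f => RComod.hom_ext
        (MonoidalCategory.associator_naturality_left f V.obj P.obj))
    fun X W => RComod.hom_ext (by
      -- After forgetting coactions this is the associativity isomorphism between the functors `- ⊗
      -- V ⊗ P` on `Vec`, already known to respect the twists.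
      have h := (HMod.tensorRightTensor V P.toHMod).inv.comm X W
      exact h)

variable (C) in
/-- `P ↦ (W ↦ W ⊗ P)` as a module functor. -/
@[simps functor]
def toStarLax : LaxModuleFunctor (HMod k H) C.HComod (Star k H C.Comod) where
  functor := toStarFunctor C
  lax :=
    { μₗ := fun V P => (toStarStr V P).hom
      μₗ_naturality_left := fun f P => LFunctor.hom_ext fun W => RComod.hom_ext
        (MonoidalCategory.associator_naturality_middle W f.hom P.obj)
      μₗ_naturality_right := fun V _ _ g => LFunctor.hom_ext fun W => RComod.hom_ext
        (MonoidalCategory.associator_naturality_right W V.obj g.hom)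
      μₗ_associativity := fun V V' P => LFunctor.hom_ext fun W => RComod.hom_ext (by
        change (α_ W (V.obj ⊗ V'.obj) P.obj).hom ≫ W ◁ (α_ V.obj V'.obj P.obj).hom =
          ((α_ W V.obj V'.obj).inv ▷ P.obj ≫ 𝟙 _) ≫ (α_ (W ⊗ V.obj) V'.obj P.obj).hom ≫
            (α_ W V.obj (V'.obj ⊗ P.obj)).hom
        simp)
      μₗ_unitality := fun P => LFunctor.hom_ext fun W => RComod.hom_ext (by
        change (ρ_ W).hom ▷ P.obj ≫ 𝟙 _ = (α_ W (𝟙_ (ModuleCat k)) P.obj).hom ≫ W ◁ (λ_ P.obj).hom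
        simp) }

theorem toStarLax_isStrong : (toStarLax C).IsStrong :=
  fun V P => inferInstanceAs (IsIso (toStarStr V P).hom)

end HComod
end ModuleCoalgebra
end Copower

/-! ### Actions from natural transformations -/

section ActionOfNatural

open scoped TensorProduct

variable {k : Type u} [Field k]

namespace RComod

section

variable {C : Type u} [AddCommGroup C] [Module k C] [Coalgebra k C]

variable (k C) in
/-- The coalgebra `C` as a right comodule over itself. -/
@[simps]
def regular : RComod k C where
  obj := ModuleCat.of k C
  coact := Coalgebra.comul (R := k) (A := C)
  coassoc := Coalgebra.coassoc
  counit := Coalgebra.lTensor_counit_comp_comul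

/-- The coaction as a colinear map. -/
@[simps]
def coactHom (X : RComod k C) : X ⟶ copower X.obj (regular k C) where
  hom := ModuleCat.ofHom X.coact
  comm := by
    ext x
    have h : TensorProduct.assoc k X.obj C C (X.coact.rTensor C (X.coact x)) =
        (Coalgebra.comul (R := k) (A := C)).lTensor X.obj (X.coact x) :=
      LinearMap.congr_fun X.coassoc x
    exact (LinearEquiv.symm_apply_eq _).2 h.symm

/-- The colinear map `c ↦ x ⊗ c`. -/
@[simps]
def tmulHom {W : ModuleCat.{u} k} (x : W) (P : RComod k C) : P ⟶ copower W P where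
  hom := ModuleCat.ofHom (TensorProduct.mk k W P.obj x)
  comm := by
    ext p
    have h : ∀ t : P.obj ⊗[k] C, (TensorProduct.assoc k W P.obj C).symm (x ⊗ₜ t) =
        (TensorProduct.mk k W P.obj x).rTensor C t := by
      intro t
      induction t with
      | zero => simp
      | add s s' hs hs' => simp only [TensorProduct.tmul_add, map_add, hs, hs']
      | tmul c d => rfl
    exact h (P.coact p)

/-- The counit axiom tensored with `V`. It provides a linear retraction of the coaction, by which a
map on `X ⊗ V` is recovered from one on `(X ⊗ C) ⊗ V`. -/
theorem rTensor_counit_coact (X : RComod k C) {V : Type u} [AddCommGroup V] [Module k V]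
    (t : X.obj ⊗[k] V) :
    ((TensorProduct.rid k X.obj).toLinearMap ∘ₗ
        (Coalgebra.counit (R := k) (A := C)).lTensor X.obj).rTensor V
          (X.coact.rTensor V t) = t := by
  rw [← LinearMap.comp_apply, ← LinearMap.rTensor_comp, LinearMap.comp_assoc, X.counit]
  have h : (TensorProduct.rid k X.obj).toLinearMap ∘ₗ (TensorProduct.mk k X.obj k).flip 1 =
      LinearMap.id := by
    ext x
    simp
  rw [h]
  simp

end

variable {H : Type u} [Ring H] [Bialgebra k H]

/-- The unit of `H` as a colinear map. -/
def unitHom : unit k H ⟶ regular k H where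
  hom := ModuleCat.ofHom (Algebra.linearMap k H)
  comm := by
    ext
    change Coalgebra.comul (R := k) (algebraMap k H 1) = algebraMap k H 1 ⊗ₜ 1
    simp [Algebra.TensorProduct.one_def]

/-- The multiplication of `H` as a colinear map. -/
def mulHom : tensor isModuleCoalgebra_lmul (regular k H) (regular k H) ⟶ regular k H where
  hom := ModuleCat.ofHom (LinearMap.mul' k H)
  comm := by
    refine TensorProduct.ext' fun (h : H) (h' : H) => ?_
    change Coalgebra.comul (R := k) (h * h') = (LinearMap.mul' k H).rTensor H
      (mix (Algebra.lmul k H) H H (Coalgebra.comul (R := k) h ⊗ₜ Coalgebra.comul (R := k) h'))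
    have key : ∀ s t : H ⊗[k] H, s * t = (LinearMap.mul' k H).rTensor H
        (mix (Algebra.lmul k H) H H (s ⊗ₜ t)) := by
      intro s t
      induction s with
      | zero => simp
      | add s s' hs hs' => simp only [add_mul, TensorProduct.add_tmul, map_add, hs, hs']
      | tmul a b =>
        induction t with
        | zero => simp
        | add s s' hs hs' => simp only [mul_add, TensorProduct.tmul_add, map_add, hs, hs']
        | tmul c d => simp
    rw [Bialgebra.comul_mul]
    exact key _ _

end RComod

variable {H : Type u} [Ring H] [Bialgebra k H] {C : Type u} [AddCommGroup C] [Module k C]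
  {P : Type u} [AddCommGroup P] [Module k P]

/-- A natural family of endomorphisms of `X ⊗ P`, for comodules `X`, that is compatible with the
unit and the tensor product of comodules. -/
structure NaturalTwist (H : Type u) [Ring H] [Bialgebra k H] (P : Type u) [AddCommGroup P]
    [Module k P] where
  app : ∀ X : RComod k H, X.obj ⊗[k] P →ₗ[k] X.obj ⊗[k] P
  naturality : ∀ {X Y : RComod k H} (f : X ⟶ Y), app Y ∘ₗ f.hom.hom.rTensor P =
    f.hom.hom.rTensor P ∘ₗ app X
  unit : ∀ p : P, app (RComod.unit k H) ((1 : k) ⊗ₜ p) = (1 : k) ⊗ₜ p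
  tensor : ∀ X Y : RComod k H, (TensorProduct.assoc k X.obj Y.obj P).toLinearMap ∘ₗ
    app (RComod.tensor isModuleCoalgebra_lmul X Y) =
      (TensorProduct.leftComm k Y.obj X.obj P).toLinearMap ∘ₗ (app X).lTensor Y.obj ∘ₗ
        (TensorProduct.leftComm k X.obj Y.obj P).toLinearMap ∘ₗ (app Y).lTensor X.obj ∘ₗ
          (TensorProduct.assoc k X.obj Y.obj P).toLinearMap

/-! ### Natural twists are the same as twists by an action. -/

namespace NaturalTwist

variable (t : NaturalTwist (k := k) H P)

/-- The component at `H`. -/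
def appRegular : H ⊗[k] P →ₗ[k] H ⊗[k] P := t.app (RComod.regular k H)

variable (k H P) in
/-- The linear map `h ⊗ p ↦ ε(h) p`. -/
def counitMap : H ⊗[k] P →ₗ[k] P :=
  (TensorProduct.lid k P).toLinearMap ∘ₗ (Coalgebra.counit (R := k) (A := H)).rTensor P

@[simp]
theorem counitMap_tmul (h : H) (p : P) :
    counitMap k H P (h ⊗ₜ p) = Coalgebra.counit (R := k) h • p := by
  simp [counitMap]

/-- The action `h · p = (ε ⊗ P) t(h ⊗ p)` as a linear map. -/
def actMap : H ⊗[k] P →ₗ[k] P := counitMap k H P ∘ₗ t.appRegular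

/-- The maps `h ↦ w ⊗ h` are colinear and their images span `W ⊗ H`, so naturality along them
determines the component at a cofree comodule from the one at `H`. -/
theorem app_copower (W : ModuleCat.{u} k) (s : (W ⊗[k] H) ⊗[k] P) :
    t.app (RComod.copower W (RComod.regular k H)) s =
      (TensorProduct.assoc k W H P).symm (t.appRegular.lTensor W
        (TensorProduct.assoc k W H P s)) := by
  suffices h : t.app (RComod.copower W (RComod.regular k H)) =
      (TensorProduct.assoc k W H P).symm.toLinearMap ∘ₗ t.appRegular.lTensor W ∘ₗ
        (TensorProduct.assoc k W H P).toLinearMap from LinearMap.congr_fun h s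
  refine TensorProduct.ext_threefold fun w h p => ?_
  have h1 := LinearMap.congr_fun (t.naturality (RComod.tmulHom w (RComod.regular k H))) (h ⊗ₜ p)
  have h2 : ∀ s : H ⊗[k] P, (TensorProduct.mk k W H w).rTensor P s =
      (TensorProduct.assoc k W H P).symm (w ⊗ₜ s) := by
    intro s
    induction s with
    | zero => simp
    | add s s' hs hs' => simp only [TensorProduct.tmul_add, map_add, hs, hs']
    | tmul c d => rfl
  exact h1.trans (h2 _)

/-- Naturality along the coaction `X ⟶ X ⊗ H` reduces to a cofree comodule, where `app_copower`
applies; the counit then undoes the coaction. A natural twist is thus determined by the single map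
`H ⊗ P ⟶ P`. -/
theorem app_eq (X : RComod k H) (s : X.obj ⊗[k] P) : t.app X s =
    t.actMap.lTensor X.obj (TensorProduct.assoc k X.obj H P (X.coact.rTensor P s)) := by
  have h1 : t.app (RComod.copower X.obj (RComod.regular k H)) (X.coact.rTensor P s) =
      X.coact.rTensor P (t.app X s) := LinearMap.congr_fun (t.naturality X.coactHom) s
  rw [app_copower] at h1
  have h2 : ∀ r : X.obj ⊗[k] (H ⊗[k] P), ((TensorProduct.rid k X.obj).toLinearMap ∘ₗ
        (Coalgebra.counit (R := k) (A := H)).lTensor X.obj).rTensor P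
        ((TensorProduct.assoc k X.obj H P).symm r) = (counitMap k H P).lTensor X.obj r := by
    intro r
    induction r with
    | zero => simp
    | add s s' hs hs' => simp only [map_add, hs, hs']
    | tmul x r =>
      induction r with
      | zero => simp
      | add s s' hs hs' => simp only [TensorProduct.tmul_add, map_add, hs, hs']
      | tmul h p => simp [TensorProduct.smul_tmul]
  rw [← X.rTensor_counit_coact (t.app X s), ← h1, h2, actMap, LinearMap.lTensor_comp]
  rfl

theorem app_tmul (X : RComod k H) (x : X.obj) (p : P) : t.app X (x ⊗ₜ p) =
    t.actMap.lTensor X.obj (TensorProduct.assoc k X.obj H P (X.coact x ⊗ₜ p)) := by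
  rw [app_eq, LinearMap.rTensor_tmul]

/-- Naturality along the colinear unit `k ⟶ H`, combined with the unit axiom of the twist. -/
theorem actMap_one (p : P) : t.actMap (1 ⊗ₜ p) = p := by
  have h1 := LinearMap.congr_fun (t.naturality (RComod.unitHom (k := k) (H := H))) ((1 : k) ⊗ₜ p)
  have h2 : t.app (RComod.regular k H) ((1 : H) ⊗ₜ p) = (1 : H) ⊗ₜ p := by
    have h3 : (RComod.unitHom (k := k) (H := H)).hom.hom.rTensor P ((1 : k) ⊗ₜ p) =
        (1 : H) ⊗ₜ p := by
      change algebraMap k H 1 ⊗ₜ p = _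
      rw [map_one]
    rw [LinearMap.comp_apply, LinearMap.comp_apply, t.unit] at h1
    exact (congrArg _ h3).symm.trans (h1.trans h3)
  have h4 : t.appRegular (1 ⊗ₜ p) = 1 ⊗ₜ p := h2
  rw [actMap, LinearMap.comp_apply, h4]
  simp

/-- Naturality along the colinear multiplication `H ⊗ H ⟶ H` moves the question to `H ⊗ H`, where
the tensor axiom applies the twist once for each factor. -/
theorem actMap_mul (h h' : H) (p : P) :
    t.actMap ((h * h') ⊗ₜ p) = t.actMap (h ⊗ₜ t.actMap (h' ⊗ₜ p)) := by
  let app₂ : (H ⊗[k] H) ⊗[k] P →ₗ[k] (H ⊗[k] H) ⊗[k] P :=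
    t.app (RComod.tensor isModuleCoalgebra_lmul (RComod.regular k H) (RComod.regular k H))
  have h1 : t.appRegular ((h * h') ⊗ₜ p) =
      (LinearMap.mul' k H).rTensor P (app₂ ((h ⊗ₜ[k] h') ⊗ₜ p)) :=
    LinearMap.congr_fun (t.naturality (RComod.mulHom (k := k) (H := H))) ((h ⊗ₜ[k] h') ⊗ₜ p)
  have h2 : TensorProduct.assoc k H H P (app₂ ((h ⊗ₜ[k] h') ⊗ₜ p)) =
      TensorProduct.leftComm k H H P (t.appRegular.lTensor H
        (TensorProduct.leftComm k H H P (h ⊗ₜ t.appRegular (h' ⊗ₜ p)))) :=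
    LinearMap.congr_fun (t.tensor (RComod.regular k H) (RComod.regular k H))
      ((h ⊗ₜ[k] h') ⊗ₜ p)
  -- Since `ε` is multiplicative, it can be applied to the two tensor factors separately instead of
  -- to their product.
  have h3 : ∀ s : (H ⊗[k] H) ⊗[k] P, counitMap k H P ((LinearMap.mul' k H).rTensor P s) =
      counitMap k H P (counitMap k H (H ⊗[k] P) (TensorProduct.assoc k H H P s)) := by
    intro s
    suffices h : counitMap k H P ∘ₗ (LinearMap.mul' k H).rTensor P =
        counitMap k H P ∘ₗ counitMap k H (H ⊗[k] P) ∘ₗ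
          (TensorProduct.assoc k H H P).toLinearMap from LinearMap.congr_fun h s
    ext
    simp [mul_smul]
  -- The outer twist acts only on the factor `h` and on `P`, so the counit on the other factor can
  -- be taken before it.
  have h4 : ∀ q : H ⊗[k] P, counitMap k H P (counitMap k H (H ⊗[k] P)
      (TensorProduct.leftComm k H H P (t.appRegular.lTensor H
        (TensorProduct.leftComm k H H P (h ⊗ₜ q))))) = t.actMap (h ⊗ₜ counitMap k H P q) := by
    intro q
    induction q with
    | zero => simp
    | add s s' hs hs' => simp only [TensorProduct.tmul_add, map_add, hs, hs']
    | tmul g p =>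
      have h5 : ∀ r : H ⊗[k] P, counitMap k H P (counitMap k H (H ⊗[k] P)
          (TensorProduct.leftComm k H H P (g ⊗ₜ r))) =
          Coalgebra.counit (R := k) g • counitMap k H P r := by
        intro r
        induction r with
        | zero => simp
        | add s s' hs hs' => simp only [TensorProduct.tmul_add, map_add, hs, hs', smul_add]
        | tmul g p => simpa using smul_comm _ _ _
      simp [h5, actMap]
  rw [actMap, LinearMap.comp_apply, h1, h3, h2, h4]
  rfl

/-- The action of `H` given by a natural twist. -/
def act : H →ₐ[k] Module.End k P :=
  AlgHom.ofLinearMap (TensorProduct.curry t.actMap) (LinearMap.ext fun p => t.actMap_one p)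
    fun h h' => LinearMap.ext fun p => t.actMap_mul h h' p

@[simp]
theorem act_apply (h : H) (p : P) : t.act h p = t.actMap (h ⊗ₜ p) := rfl

/-- The vector `w` is carried along passively. This is the form in which the structure morphisms of
`T` are compared with those of `- ⊗ T(k)`. -/
theorem map_mk_app (X : RComod k H) (W : ModuleCat.{u} k) (x : X.obj) (w : W) (p : P) :
    ((TensorProduct.mk k X.obj W).flip w).rTensor P (t.app X (x ⊗ₜ p)) =
      twist t.act X.coact W (x ⊗ₜ (w ⊗ₜ p)) := by
  rw [app_tmul, twist_tmul]
  generalize X.coact x = s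
  induction s with
  | zero => simp
  | add s s' hs hs' => simp only [TensorProduct.add_tmul, map_add, hs, hs']
  | tmul x h => simp

/-- The hypothesis is colinearity of the twist at `H`, from the diagonal coaction on `H ⊗ P` to the
coaction of `P` alone. Applying `ε` to the factor `H` on both sides turns it into the compatibility
required in `_H𝔐^C`. -/
theorem coact_act [Coalgebra k C] {a : H →ₐ[k] Module.End k C} {σ : P →ₗ[k] P ⊗[k] C}
    (h : copowerCoact H σ ∘ₗ t.appRegular = t.appRegular.rTensor C ∘ₗ
      tensorCoact a (Coalgebra.comul (R := k) (A := H)) σ) (x : H) (p : P) :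
    σ (t.act x p) = diagAct t.act a x (σ p) := by
  have h1 := LinearMap.congr_fun h (x ⊗ₜ p)
  have h2 : ∀ s : H ⊗[k] P, (counitMap k H P).rTensor C (copowerCoact H σ s) =
      σ (counitMap k H P s) := by
    intro s
    induction s with
    | zero => simp
    | add s s' hs hs' => simp only [map_add, hs, hs']
    | tmul g p =>
      have h3 : ∀ r : P ⊗[k] C, (counitMap k H P).rTensor C
          ((TensorProduct.assoc k H P C).symm (g ⊗ₜ r)) =
          Coalgebra.counit (R := k) g • r := by
        intro r
        induction r with
        | zero => simp
        | add s s' hs hs' => simp only [TensorProduct.tmul_add, map_add, hs, hs', smul_add]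
        | tmul g p => simp [TensorProduct.smul_tmul']
      simp [copowerCoact, h3]
  have h4 := congrArg ((counitMap k H P).rTensor C) h1
  rw [LinearMap.comp_apply, h2] at h4
  refine h4.trans ?_
  rw [LinearMap.comp_apply, ← LinearMap.comp_apply (LinearMap.rTensor _ _),
    ← LinearMap.rTensor_comp]
  change t.actMap.rTensor C (mix a H P (Coalgebra.comul (R := k) x ⊗ₜ σ p)) =
    (Module.endTensorEndAlgHom (R := k) (S := k) (A := k))
      (Algebra.TensorProduct.map t.act a (Coalgebra.comul (R := k) x)) (σ p)
  generalize Coalgebra.comul (R := k) x = s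
  generalize σ p = r
  induction s with
  | zero => simp
  | add s s' hs hs' => simp only [TensorProduct.add_tmul, map_add, hs, hs', LinearMap.add_apply]
  | tmul x h =>
    induction r with
    | zero => simp
    | add s s' hs hs' => simp only [TensorProduct.tmul_add, map_add, hs, hs']
    | tmul g p => simp [Module.endTensorEndAlgHom_apply]

end NaturalTwist

end ActionOfNatural

/-! ### Coproduct-preserving functors on vector spaces -/

section Coproducts

open scoped TensorProduct

variable {k : Type u} [Field k]

/-- The linear map `k ⟶ W` that sends `1` to `w`. -/
def spanHom {W : ModuleCat.{u} k} (w : W) : 𝟙_ (ModuleCat.{u} k) ⟶ W :=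
  ModuleCat.ofHom (LinearMap.toSpanSingleton k W w)

theorem spanHom_comp {W W' : ModuleCat.{u} k} (w : W) (f : W ⟶ W') :
    spanHom w ≫ f = spanHom (f.hom w) := by
  ext
  change f.hom ((1 : k) • w) = (1 : k) • f.hom w
  simp

theorem spanHom_one : spanHom (1 : k) = 𝟙 (𝟙_ (ModuleCat.{u} k)) := by
  ext
  change (1 : k) • (1 : k) = 1
  simp

theorem spanHom_add {W : ModuleCat.{u} k} (w w' : W) :
    spanHom (w + w') = spanHom w + spanHom w' := by
  ext
  change (1 : k) • (w + w') = (1 : k) • w + (1 : k) • w'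
  simp

theorem spanHom_smul {W : ModuleCat.{u} k} (c : k) (w : W) :
    spanHom (c • w) = c • spanHom w := by
  ext
  change (1 : k) • c • w = c • (1 : k) • w
  simp

/-- A vector space as a coproduct of copies of `k`. -/
def basisCofan (W : ModuleCat.{u} k) :
    Cofan fun _ : Module.Basis.ofVectorSpaceIndex k W => 𝟙_ (ModuleCat.{u} k) :=
  Cofan.mk W fun i => spanHom (Module.Basis.ofVectorSpace k W i)

/-- A vector space is a coproduct of copies of `k`. -/
def isColimitBasisCofan (W : ModuleCat.{u} k) : IsColimit (basisCofan W) :=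
  Cofan.IsColimit.mk _
    (fun s => ModuleCat.ofHom ((Module.Basis.ofVectorSpace k W).constr k fun i =>
      (s.inj i).hom (1 : k)))
    (fun s i => by
      ext
      change (Module.Basis.ofVectorSpace k W).constr k (fun i => (s.inj i).hom (1 : k))
        ((1 : k) • Module.Basis.ofVectorSpace k W i) = (s.inj i).hom (1 : k)
      rw [one_smul, Module.Basis.constr_basis])
    (fun s m h => by
      ext : 1
      refine (Module.Basis.ofVectorSpace k W).ext fun i => ?_
      refine Eq.trans ?_ (Module.Basis.constr_basis _ _ _ _).symm
      have h1 := LinearMap.congr_fun (congrArg ModuleCat.Hom.hom (h i)) (1 : k)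
      refine Eq.trans ?_ h1
      exact congrArg m.hom (one_smul k (Module.Basis.ofVectorSpace k W i)).symm)

variable {D : Type*} [Category* D]

/-- A basis presents `W` as a coproduct of copies of `k`, and both functors preserve it; so the
component at `W` is a coproduct of copies of the component at `k`. -/
theorem vec_isIso {F G : ModuleCat.{u} k ⥤ D}
    [∀ J : Type u, PreservesColimitsOfShape (Discrete J) F]
    [∀ J : Type u, PreservesColimitsOfShape (Discrete J) G] (η : F ⟶ G)
    [IsIso (η.app (𝟙_ (ModuleCat.{u} k)))] : IsIso η := by
  have h : ∀ W, IsIso (η.app W) := fun W => by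
    let α : (Discrete.functor fun _ : Module.Basis.ofVectorSpaceIndex k W =>
        𝟙_ (ModuleCat.{u} k)) ⋙ F ≅ (Discrete.functor fun _ => 𝟙_ (ModuleCat.{u} k)) ⋙ G :=
      Discrete.natIso fun ⟨i⟩ => asIso (η.app (𝟙_ (ModuleCat.{u} k)))
    let e : F.obj W ≅ G.obj W := IsColimit.coconePointsIsoOfNatIso
      (isColimitOfPreserves F (isColimitBasisCofan W))
      (isColimitOfPreserves G (isColimitBasisCofan W)) α
    have h1 : η.app W = e.hom :=
      (isColimitOfPreserves F (isColimitBasisCofan W)).hom_ext fun ⟨i⟩ =>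
        (η.naturality (spanHom (Module.Basis.ofVectorSpace k W i))).trans
          (IsColimit.comp_coconePointsIsoOfNatIso_hom
            (isColimitOfPreserves F (isColimitBasisCofan W))
            (isColimitOfPreserves G (isColimitBasisCofan W)) α ⟨i⟩).symm
    rw [h1]
    infer_instance
  exact NatIso.isIso_of_isIso_app η

/-! ### Coproduct-preserving linear functors from vector spaces to comodules. -/

namespace RComod

variable {C : Type u} [AddCommGroup C] [Module k C] [Coalgebra k C]

theorem hom_apply_congr {M N : RComod k C} {f g : M ⟶ N} (h : f = g) (m : M.obj) :
    f.hom.hom m = g.hom.hom m := by rw [h]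

/-- The isomorphism `k ⊗ P ≅ P` of comodules. -/
def copowerUnit (P : RComod k C) : copower (𝟙_ (ModuleCat.{u} k)) P ≅ P :=
  isoMk (λ_ P.obj) (copowerCoact_unit P.coact)

variable (T : ModuleCat.{u} k ⥤ RComod k C) [T.Additive] [T.Linear k]

/-- The linear map `w ⊗ p ↦ T(w) p`. -/
def coproductMap (W : ModuleCat.{u} k) :
    W ⊗[k] (T.obj (𝟙_ (ModuleCat.{u} k))).obj →ₗ[k] (T.obj W).obj :=
  TensorProduct.lift
    { toFun := fun w => (T.map (spanHom w)).hom.hom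
      map_add' := fun w w' => by
        rw [spanHom_add, T.map_add]
        rfl
      map_smul' := fun c w => by
        rw [spanHom_smul, T.map_smul]
        rfl }

/-- The colinear map `w ⊗ p ↦ T(w) p`. -/
@[simps]
def coproductHom (W : ModuleCat.{u} k) : copower W (T.obj (𝟙_ (ModuleCat.{u} k))) ⟶ T.obj W where
  hom := ModuleCat.ofHom (coproductMap T W)
  comm := TensorProduct.ext' fun w p => by
    have h1 := LinearMap.congr_fun (T.map (spanHom w)).comm p
    have h2 := LinearMap.congr_fun (tmulHom w (T.obj (𝟙_ (ModuleCat.{u} k)))).comm p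
    have h3 : coproductMap T W ∘ₗ TensorProduct.mk k W _ w = (T.map (spanHom w)).hom.hom := rfl
    refine h1.trans (Eq.trans ?_ (congrArg ((coproductMap T W).rTensor C) h2.symm))
    rw [← h3, LinearMap.rTensor_comp]
    rfl

/-- The natural transformation `W ⊗ T(k) ⟶ T(W)`. -/
def coproductNat : copowerFunctor (T.obj (𝟙_ (ModuleCat.{u} k))) ⟶ T where
  app W := coproductHom T W
  naturality W W' f := hom_ext <| ModuleCat.hom_ext <| TensorProduct.ext' fun w p => by
    refine Eq.trans ?_ (hom_apply_congr ((T.congr_map (spanHom_comp w f)).symm.trans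
      (T.map_comp _ _)) p)
    rfl

/-- Linearity of `T` sends multiplication by `c` on `k` to multiplication by `c`. This is the
invertible component at `k` that `vec_isIso` needs. -/
theorem coproductHom_unit (T : ModuleCat.{u} k ⥤ RComod k C) [T.Additive] [T.Linear k] :
    coproductHom T (𝟙_ (ModuleCat.{u} k)) = (copowerUnit _).hom :=
  hom_ext <| ModuleCat.hom_ext <| TensorProduct.ext' fun (c : k) p => by
    have h1 : spanHom (W := 𝟙_ (ModuleCat.{u} k)) c = c • 𝟙 _ := by
      rw [← spanHom_one, ← spanHom_smul]
      congr 1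
      exact (mul_one c).symm
    change (T.map (spanHom (W := 𝟙_ (ModuleCat.{u} k)) c)).hom.hom p = c • p
    rw [h1, T.map_smul, T.map_id]
    rfl

instance [∀ J : Type u, PreservesColimitsOfShape (Discrete J) T] : IsIso (coproductNat T) := by
  have : IsIso ((coproductNat T).app (𝟙_ (ModuleCat.{u} k))) := by
    change IsIso (coproductHom T (𝟙_ (ModuleCat.{u} k)))
    rw [coproductHom_unit]
    infer_instance
  exact vec_isIso _

end RComod

end Coproducts

/-! ### Objects of `ℒ^lax(Vec, 𝔐^C)` are of the form `W ↦ W ⊗ P` -/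

section Fiber

open scoped TensorProduct

variable {k : Type u} [Field k] {H : Type u} [Ring H] [Bialgebra k H]

namespace ModuleCoalgebra

variable {C : ModuleCoalgebra k H} (T : Star k H C.Comod)

/-- The underlying functor to comodules. -/
def comodFunctor : ModuleCat.{u} k ⥤ RComod k C.carrier := T.functor

instance : (comodFunctor T).Additive := T.additive

instance : (comodFunctor T).Linear k := T.linear

instance (J : Type u) : PreservesColimitsOfShape (Discrete J) (comodFunctor T) := T.coproducts J

/-- The value at the ground field. -/
abbrev fiber : RComod k C.carrier := (comodFunctor T).obj (𝟙_ (ModuleCat.{u} k))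

/-- The structure morphism `X ⊗ T(W) ⟶ T(X ⊗ W)`. -/
def strHom (X : RComod k H) (W : ModuleCat.{u} k) :
    RComod.tensor C.isModuleCoalgebra X ((comodFunctor T).obj W) ⟶
      (comodFunctor T).obj (X.obj ⊗ W) :=
  T.str X W

theorem strHom_naturality_left {X Y : RComod k H} (f : X ⟶ Y) (W : ModuleCat.{u} k) :
    RComod.tensorWhiskerRight C.isModuleCoalgebra f ((comodFunctor T).obj W) ≫ strHom T Y W =
      strHom T X W ≫ (comodFunctor T).map (f.hom ▷ W) :=
  T.lax.μₗ_naturality_left f W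

theorem strHom_naturality_right (X : RComod k H) {W W' : ModuleCat.{u} k} (g : W ⟶ W') :
    RComod.tensorWhiskerLeft C.isModuleCoalgebra X ((comodFunctor T).map g) ≫ strHom T X W' =
      strHom T X W ≫ (comodFunctor T).map (X.obj ◁ g) :=
  T.lax.μₗ_naturality_right X g

theorem strHom_assoc (X Y : RComod k H) (W : ModuleCat.{u} k) :
    strHom T (RComod.tensor isModuleCoalgebra_lmul X Y) W ≫
        (comodFunctor T).map (α_ X.obj Y.obj W).hom =
      (RComod.tensorAssoc C.isModuleCoalgebra X Y _).hom ≫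
        RComod.tensorWhiskerLeft C.isModuleCoalgebra X (strHom T Y W) ≫
          strHom T X (Y.obj ⊗ W) :=
  T.lax.μₗ_associativity X Y W

theorem strHom_unit (W : ModuleCat.{u} k) :
    (RComod.tensorUnit C.isModuleCoalgebra ((comodFunctor T).obj W)).hom =
      strHom T (RComod.unit k H) W ≫ (comodFunctor T).map (λ_ W).hom :=
  T.lax.μₗ_unitality W

/-- The isomorphism `W ⊗ T(k) ≅ T(W)`. -/
def fiberNatIso : RComod.copowerFunctor (fiber T) ≅ comodFunctor T :=
  asIso (RComod.coproductNat (comodFunctor T))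

/-- The isomorphism `W ⊗ T(k) ≅ T(W)`. -/
def fiberIso (W : ModuleCat.{u} k) : RComod.copower W (fiber T) ≅ (comodFunctor T).obj W :=
  (fiberNatIso T).app W

theorem fiberIso_naturality {W W' : ModuleCat.{u} k} (g : W ⟶ W') :
    RComod.copowerMap g (fiber T) ≫ (fiberIso T W').hom =
      (fiberIso T W).hom ≫ (comodFunctor T).map g :=
  (fiberNatIso T).hom.naturality g

theorem fiberIso_inv_naturality {W W' : ModuleCat.{u} k} (g : W ⟶ W') :
    (comodFunctor T).map g ≫ (fiberIso T W').inv =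
      (fiberIso T W).inv ≫ RComod.copowerMap g (fiber T) :=
  (fiberNatIso T).inv.naturality g

theorem fiberIso_tmul {W : ModuleCat.{u} k} (w : W) (p : (fiber T).obj) :
    (fiberIso T W).hom.hom.hom (w ⊗ₜ[k] p) =
      ((comodFunctor T).map (spanHom w)).hom.hom p := rfl

/-- The isomorphism `W ⊗ T(k) ≅ T(W)` as a linear map. -/
def fiberMap (W : ModuleCat.{u} k) :
    W ⊗[k] (fiber T).obj →ₗ[k] ((comodFunctor T).obj W).obj := (fiberIso T W).hom.hom.hom

/-- The structure morphism `X ⊗ T(k) ⟶ T(X)`. -/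
def fiberStr (X : RComod k H) :
    RComod.tensor C.isModuleCoalgebra X (fiber T) ⟶ (comodFunctor T).obj X.obj :=
  strHom T X (𝟙_ (ModuleCat.{u} k)) ≫ (comodFunctor T).map (ρ_ X.obj).hom

/-- The structure morphism `X ⊗ T(k) ⟶ X ⊗ T(k)`. -/
def fiberTwist (X : RComod k H) :
    RComod.tensor C.isModuleCoalgebra X (fiber T) ⟶ RComod.copower X.obj (fiber T) :=
  fiberStr T X ≫ (fiberIso T X.obj).inv

theorem fiberTwist_comp (X : RComod k H) :
    fiberTwist T X ≫ (fiberIso T X.obj).hom = fiberStr T X :=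
  (Category.assoc _ _ _).trans
    ((congrArg (fiberStr T X ≫ ·) (fiberIso T X.obj).inv_hom_id).trans (Category.comp_id _))

/-- The linear map `x ↦ x ⊗ w`. -/
def flipMk (X : ModuleCat.{u} k) {W : ModuleCat.{u} k} (w : W) : X ⟶ X ⊗ W :=
  ModuleCat.ofHom ((TensorProduct.mk k X W).flip w)

theorem spanHom_whiskerLeft (X : RComod k H) {W : ModuleCat.{u} k} (w : W) :
    X.obj ◁ spanHom w =
      (ρ_ X.obj).hom ≫ flipMk X.obj w :=
  ModuleCat.hom_ext <| TensorProduct.ext' fun x (c : k) => by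
    change x ⊗ₜ[k] (c • w) = (c • x) ⊗ₜ[k] w
    rw [TensorProduct.tmul_smul, TensorProduct.smul_tmul']

/-- Naturality of the structure morphism along `k ⟶ W`, `1 ↦ w`. The component at `W` is thereby
expressed through the component at `k`. -/
theorem strHom_spanHom (X : RComod k H) {W : ModuleCat.{u} k} (w : W) :
    RComod.tensorWhiskerLeft C.isModuleCoalgebra X ((comodFunctor T).map (spanHom w)) ≫
      strHom T X W = fiberTwist T X ≫
        RComod.copowerMap (flipMk X.obj w)
          (fiber T) ≫
            (fiberIso T (X.obj ⊗ W)).hom := by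
  rw [fiberIso_naturality, ← Category.assoc, fiberTwist_comp, strHom_naturality_right,
    spanHom_whiskerLeft, Functor.map_comp, fiberStr, Category.assoc]

theorem strHom_tmul (X : RComod k H) (W : ModuleCat.{u} k) (x : X.obj) (w : W)
    (p : (fiber T).obj) :
    (strHom T X W).hom.hom (x ⊗ₜ[k] ((fiberIso T W).hom).hom.hom (w ⊗ₜ[k] p)) =
      ((fiberIso T (X.obj ⊗ W)).hom).hom.hom
        (((TensorProduct.mk k X.obj W).flip w).rTensor (fiber T).obj
          ((fiberTwist T X).hom.hom (x ⊗ₜ[k] p))) :=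
  RComod.hom_apply_congr (strHom_spanHom T X w) (x ⊗ₜ[k] p)

theorem fiberStr_naturality {X Y : RComod k H} (f : X ⟶ Y) :
    RComod.tensorWhiskerRight C.isModuleCoalgebra f (fiber T) ≫ fiberStr T Y =
      fiberStr T X ≫ (comodFunctor T).map f.hom := by
  have h := strHom_naturality_left T f (𝟙_ (ModuleCat.{u} k))
  refine (Category.assoc _ _ _).symm.trans ?_
  refine (congrArg (· ≫ (comodFunctor T).map (ρ_ Y.obj).hom) h).trans ?_
  rw [fiberStr, Category.assoc, Category.assoc, ← Functor.map_comp, ← Functor.map_comp,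
    MonoidalCategory.rightUnitor_naturality]

theorem fiberTwist_naturality {X Y : RComod k H} (f : X ⟶ Y) :
    RComod.tensorWhiskerRight C.isModuleCoalgebra f (fiber T) ≫ fiberTwist T Y =
      fiberTwist T X ≫ RComod.copowerMap f.hom (fiber T) := by
  rw [fiberTwist, fiberTwist, ← Category.assoc, fiberStr_naturality, Category.assoc,
    Category.assoc, fiberIso_inv_naturality]

theorem fiberStr_unit : fiberStr T (RComod.unit k H) =
    (RComod.tensorUnit C.isModuleCoalgebra (fiber T)).hom := by
  refine Eq.trans ?_ (strHom_unit T _).symm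
  have h : (ρ_ (𝟙_ (ModuleCat.{u} k))).hom = (λ_ (𝟙_ (ModuleCat.{u} k))).hom := by
    rw [MonoidalCategory.unitors_equal]
  exact congrArg (fun g => strHom T (RComod.unit k H) _ ≫ (comodFunctor T).map g) h

/-- The associativity axiom at `W = k`; naturality in `W` along `Y ⊗ k ≅ Y` absorbs the superfluous
factor `k`. -/
theorem fiberStr_tensor (X Y : RComod k H) :
    fiberStr T (RComod.tensor isModuleCoalgebra_lmul X Y) =
      (RComod.tensorAssoc C.isModuleCoalgebra X Y _).hom ≫
        RComod.tensorWhiskerLeft C.isModuleCoalgebra X (fiberStr T Y) ≫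
          strHom T X Y.obj := by
  have h1 : (ρ_ (X.obj ⊗ Y.obj)).hom = (α_ X.obj Y.obj (𝟙_ _)).hom ≫ X.obj ◁ (ρ_ Y.obj).hom := by
    simp
  have h2 : RComod.tensorWhiskerLeft C.isModuleCoalgebra X (fiberStr T Y) =
      RComod.tensorWhiskerLeft C.isModuleCoalgebra X (strHom T Y (𝟙_ _)) ≫
        RComod.tensorWhiskerLeft C.isModuleCoalgebra X ((comodFunctor T).map (ρ_ Y.obj).hom) :=
    RComod.hom_ext (MonoidalCategory.whiskerLeft_comp _ _ _)
  rw [h2, Category.assoc, strHom_naturality_right]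
  refine (congrArg (fun g => strHom T (RComod.tensor isModuleCoalgebra_lmul X Y) _ ≫
    (comodFunctor T).map g) h1).trans ?_
  refine (congrArg (strHom T (RComod.tensor isModuleCoalgebra_lmul X Y) _ ≫ ·)
    ((comodFunctor T).map_comp _ _)).trans ?_
  refine (Category.assoc _ _ _).symm.trans ?_
  refine (congrArg (· ≫ (comodFunctor T).map (X.obj ◁ (ρ_ Y.obj).hom))
    (strHom_assoc T X Y (𝟙_ _))).trans ?_
  simp only [Category.assoc]

theorem fiberIso_injective (W : ModuleCat.{u} k) :
    Function.Injective ((fiberIso T W).hom).hom.hom := fun a b h => by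
  have h1 := RComod.hom_apply_congr ((fiberIso T W).hom_inv_id)
  exact (h1 a).symm.trans ((congrArg ((fiberIso T W).inv).hom.hom h).trans (h1 b))

/-- The tensor axiom of the natural twist. Compared inside `T(X ⊗ Y)`, the twist at `X ⊗ Y` is the
twist at `Y` followed by the structure morphism `X ⊗ T(Y) ⟶ T(X ⊗ Y)`, which `strHom_tmul` rewrites
as the twist at `X` past the factor `Y`. -/
theorem fiberTwist_tmul_tmul (X Y : RComod k H) (x : X.obj) (y : Y.obj) (p : (fiber T).obj) :
    TensorProduct.assoc k X.obj Y.obj (fiber T).obj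
      ((fiberTwist T (RComod.tensor isModuleCoalgebra_lmul X Y)).hom.hom ((x ⊗ₜ[k] y) ⊗ₜ[k] p)) =
      TensorProduct.leftComm k Y.obj X.obj (fiber T).obj
        ((fiberTwist T X).hom.hom.lTensor Y.obj
          (TensorProduct.leftComm k X.obj Y.obj (fiber T).obj
            (x ⊗ₜ[k] (fiberTwist T Y).hom.hom (y ⊗ₜ[k] p)))) := by
  refine (LinearEquiv.eq_symm_apply _).1 ?_
  apply fiberIso_injective T (X.obj ⊗ Y.obj)
  refine (RComod.hom_apply_congr (fiberTwist_comp T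
    (RComod.tensor isModuleCoalgebra_lmul X Y)) ((x ⊗ₜ[k] y) ⊗ₜ[k] p)).trans ?_
  refine (RComod.hom_apply_congr (fiberStr_tensor T X Y) ((x ⊗ₜ[k] y) ⊗ₜ[k] p)).trans ?_
  refine (congrArg (fun q => (strHom T X Y.obj).hom.hom (x ⊗ₜ[k] q))
    (RComod.hom_apply_congr (fiberTwist_comp T Y) (y ⊗ₜ[k] p)).symm).trans ?_
  let φ : X.obj ⊗[k] (fiber T).obj →ₗ[k] X.obj ⊗[k] (fiber T).obj := (fiberTwist T X).hom.hom
  let σ : X.obj ⊗[k] ((comodFunctor T).obj Y.obj).obj →ₗ[k]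
    ((comodFunctor T).obj (X.obj ⊗ Y.obj)).obj := (strHom T X Y.obj).hom.hom
  -- The twist of `y ⊗ p` need not be a pure tensor, so the formula for pure tensors is extended to
  -- an identity of linear maps.
  have key : σ ∘ₗ TensorProduct.mk k _ _ x ∘ₗ fiberMap T Y.obj =
      fiberMap T (X.obj ⊗ Y.obj) ∘ₗ
        (TensorProduct.assoc k X.obj Y.obj (fiber T).obj).symm.toLinearMap ∘ₗ
          (TensorProduct.leftComm k Y.obj X.obj (fiber T).obj).toLinearMap ∘ₗ
            φ.lTensor Y.obj ∘ₗ (TensorProduct.leftComm k X.obj Y.obj (fiber T).obj).toLinearMap ∘ₗ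
              TensorProduct.mk k _ _ x := TensorProduct.ext' fun y p => by
    refine (strHom_tmul T X Y.obj x y p).trans ?_
    have h : ∀ r : X.obj ⊗[k] (fiber T).obj,
        ((TensorProduct.mk k X.obj Y.obj).flip y).rTensor (fiber T).obj r =
        (TensorProduct.assoc k X.obj Y.obj (fiber T).obj).symm
          (TensorProduct.leftComm k Y.obj X.obj (fiber T).obj (y ⊗ₜ[k] r)) := by
      intro r
      induction r with
      | zero => simp
      | add s s' hs hs' => simp only [TensorProduct.tmul_add, map_add, hs, hs']
      | tmul x p => simp
    exact congrArg (fiberMap T (X.obj ⊗ Y.obj)) (h _)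
  exact LinearMap.congr_fun key ((fiberTwist T Y).hom.hom (y ⊗ₜ[k] p))

/-- The natural twist of `T(k)` given by the structure morphisms of `T`. -/
def naturalTwist : NaturalTwist (k := k) H (fiber T).obj where
  app X := (fiberTwist T X).hom.hom
  naturality f := congrArg (fun g => g.hom.hom) (fiberTwist_naturality T f)
  unit p := by
    apply fiberIso_injective T (𝟙_ (ModuleCat.{u} k))
    refine (RComod.hom_apply_congr ((fiberTwist_comp T (RComod.unit k H)).trans
      (fiberStr_unit T)) ((1 : k) ⊗ₜ[k] p)).trans ?_
    refine Eq.trans ?_ (fiberIso_tmul T (W := 𝟙_ (ModuleCat.{u} k)) (1 : k) p).symm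
    refine Eq.trans ?_ (RComod.hom_apply_congr (((comodFunctor T).congr_map spanHom_one).trans
      ((comodFunctor T).map_id _)) p).symm
    exact one_smul k p
  tensor X Y := TensorProduct.ext_threefold fun x y p => fiberTwist_tmul_tmul T X Y x y p

/-- The value of `T` at the ground field, as an object of `_H𝔐^C`. -/
@[simps toRComod act]
def fiberHComod : C.HComod where
  toRComod := fiber T
  act := (naturalTwist T).act
  -- The structure morphisms of `T` are morphisms in `𝔐^C`; colinearity at `X = H` is all that is
  -- needed.
  coact_act h p := (naturalTwist T).coact_act
    (fiberTwist T (RComod.regular k H)).comm h p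

/-- Every object of `ℒ^lax(Vec, 𝔐^C)` is of the form `W ↦ W ⊗ P`. -/
def toStarFiberIso : (fiberHComod T).toStar ≅ T :=
  LFunctor.isoMk <| LaxModuleFunctor.isoMk (fiberNatIso T) fun X W => RComod.hom_ext <|
    ModuleCat.hom_ext <| by
      refine TensorProduct.ext <| LinearMap.ext fun x => TensorProduct.ext' fun w p => ?_
      refine Eq.trans ?_ (strHom_tmul T X W x w p).symm
      exact congrArg ((fiberIso T (X.obj ⊗ W)).hom).hom.hom
        ((naturalTwist T).map_mk_app X W x w p).symm

end ModuleCoalgebra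

end Fiber

/-! ### The equivalence of `_H𝔐^C` with `ℒ^lax(Vec, 𝔐^C)` -/

section ToStarEquivalence

open scoped TensorProduct

variable {k : Type u} [Field k] {H : Type u} [Ring H] [Bialgebra k H]

/-- By `ε(h₍₁₎) h₍₂₎ = h`, the action can be read off from the structure morphism of `- ⊗ M` at `X =
H` and `W = k`. The map `f` is included so that the two sides of a compatibility can both be
treated. -/
theorem counit_mix {M N : Type u} [AddCommGroup M] [Module k M] [AddCommGroup N] [Module k N]
    (a : H →ₐ[k] Module.End k M) (f : M →ₗ[k] N) (h : H) (m : M) :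
    TensorProduct.lid k N (((TensorProduct.rid k k).toLinearMap ∘ₗ
      (Coalgebra.counit (R := k) (A := H)).rTensor k).rTensor N
        (f.lTensor (H ⊗[k] k) (mix a H k (Coalgebra.comul (R := k) h ⊗ₜ (1 ⊗ₜ m))))) =
      f (a h m) := by
  have h1 : ∀ s : H ⊗[k] H, TensorProduct.lid k N (((TensorProduct.rid k k).toLinearMap ∘ₗ
      (Coalgebra.counit (R := k) (A := H)).rTensor k).rTensor N
        (f.lTensor (H ⊗[k] k) (mix a H k (s ⊗ₜ (1 ⊗ₜ m))))) =
      f (a (TensorProduct.lid k H ((Coalgebra.counit (R := k) (A := H)).rTensor H s)) m) := by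
    intro s
    induction s with
    | zero => simp
    | add s s' hs hs' => simp only [TensorProduct.add_tmul, map_add, hs, hs', LinearMap.add_apply]
    | tmul x y => simp
  rw [h1]
  simp

namespace ModuleCoalgebra

variable {C : ModuleCoalgebra k H}

namespace HComod

section

variable {P Q : C.HComod} (α : P.toStar ⟶ Q.toStar)

/-- The component `W ⊗ P ⟶ W ⊗ Q`. -/
def starApp (W : ModuleCat.{u} k) :
    RComod.copower W P.toRComod ⟶ RComod.copower W Q.toRComod :=
  (LaxModuleFunctor.Hom.nat α).app W

theorem starApp_naturality {W W' : ModuleCat.{u} k} (g : W ⟶ W') :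
    RComod.copowerMap g P.toRComod ≫ starApp α W' =
      starApp α W ≫ RComod.copowerMap g Q.toRComod :=
  (LaxModuleFunctor.Hom.nat α).naturality g

theorem starApp_comm (X : RComod k H) (W : ModuleCat.{u} k) :
    P.copowerStr X W ≫ starApp α (X.obj ⊗ W) =
      RComod.tensorWhiskerLeft C.isModuleCoalgebra X (starApp α W) ≫ Q.copowerStr X W :=
  LaxModuleFunctor.Hom.comm α X W

/-- The colinear map `P ⟶ Q` that corresponds to a morphism of module functors. -/
def fiberHom : P.toRComod ⟶ Q.toRComod :=
  (RComod.copowerUnit P.toRComod).inv ≫ starApp α (𝟙_ (ModuleCat.{u} k)) ≫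
    (RComod.copowerUnit Q.toRComod).hom

theorem starApp_unit (p : P.obj) :
    (starApp α (𝟙_ (ModuleCat.{u} k))).hom.hom ((1 : k) ⊗ₜ[k] p) =
      (1 : k) ⊗ₜ[k] (fiberHom α).hom.hom p :=
  ((LinearEquiv.eq_symm_apply (TensorProduct.lid k Q.obj)).2 rfl)

/-- Naturality along `k ⟶ W`, `1 ↦ w`, so a morphism out of `- ⊗ P` is determined by its component
at `k`. -/
theorem starApp_tmul (W : ModuleCat.{u} k) (w : W) (p : P.obj) :
    (starApp α W).hom.hom (w ⊗ₜ[k] p) = w ⊗ₜ[k] (fiberHom α).hom.hom p := by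
  have h1 := RComod.hom_apply_congr (starApp_naturality α (spanHom w)) ((1 : k) ⊗ₜ[k] p)
  have h2 : (RComod.copowerMap (spanHom w) P.toRComod).hom.hom ((1 : k) ⊗ₜ[k] p) =
      w ⊗ₜ[k] p := congrArg (· ⊗ₜ[k] p) (one_smul k w)
  refine (congrArg (starApp α W).hom.hom h2).symm.trans (h1.trans ?_)
  refine (congrArg (RComod.copowerMap (spanHom w) Q.toRComod).hom.hom (starApp_unit α p)).trans ?_
  exact congrArg (· ⊗ₜ[k] (fiberHom α).hom.hom p) (one_smul k w)

theorem starApp_hom (W : ModuleCat.{u} k) :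
    (starApp α W).hom.hom = (fiberHom α).hom.hom.lTensor W :=
  TensorProduct.ext' fun w p => starApp_tmul α W w p

/-- Compatibility with the structure morphisms at `X = H`, `W = k`, followed by the counit of `H`.
This is where morphisms of lax functors, rather than mere natural transformations, are used for
fullness. -/
theorem fiberHom_act (h : H) (p : P.obj) :
    (fiberHom α).hom.hom (P.act h p) = Q.act h ((fiberHom α).hom.hom p) := by
  have h1 := RComod.hom_apply_congr (starApp_comm α (RComod.regular k H) (𝟙_ (ModuleCat.{u} k)))
    (h ⊗ₜ[k] ((1 : k) ⊗ₜ[k] p))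
  have h2 : (starApp α ((RComod.regular k H).obj ⊗ 𝟙_ (ModuleCat.{u} k))).hom.hom
      (twist P.act (Coalgebra.comul (R := k) (A := H)) k (h ⊗ₜ[k] ((1 : k) ⊗ₜ[k] p))) =
      twist Q.act (Coalgebra.comul (R := k) (A := H)) k
        (h ⊗ₜ[k] (starApp α (𝟙_ (ModuleCat.{u} k))).hom.hom ((1 : k) ⊗ₜ[k] p)) := h1
  have h3 : (fiberHom α).hom.hom.lTensor (H ⊗[k] k)
      (mix P.act H k (Coalgebra.comul (R := k) h ⊗ₜ[k] ((1 : k) ⊗ₜ[k] p))) =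
      mix Q.act H k (Coalgebra.comul (R := k) h ⊗ₜ[k] ((1 : k) ⊗ₜ[k] (fiberHom α).hom.hom p)) := by
    rw [twist_tmul, starApp_unit, twist_tmul] at h2
    exact (LinearMap.congr_fun (starApp_hom α _) _).symm.trans h2
  refine (counit_mix P.act (fiberHom α).hom.hom h p).symm.trans (Eq.trans ?_
    (counit_mix Q.act LinearMap.id h ((fiberHom α).hom.hom p)))
  rw [h3, LinearMap.lTensor_id]
  rfl

end

instance : (toStarFunctor C).Faithful where
  map_injective {P Q f g} h := hom_ext <| ModuleCat.hom_ext <| LinearMap.ext fun p => by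
    have h1 := RComod.hom_apply_congr (congrArg (fun α => starApp α (𝟙_ (ModuleCat.{u} k))) h)
      ((1 : k) ⊗ₜ[k] p)
    have h2 : (1 : k) ⊗ₜ[k] f.hom.hom p = (1 : k) ⊗ₜ[k] g.hom.hom p := h1
    have h3 := congrArg (TensorProduct.lid k Q.obj) h2
    simpa using h3

instance : (toStarFunctor C).Full where
  map_surjective α := ⟨{ toHom := fiberHom α, act_comm := fiberHom_act α },
    LFunctor.hom_ext fun W => RComod.hom_ext <| ModuleCat.hom_ext (starApp_hom α W).symm⟩

instance : (toStarFunctor C).EssSurj where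
  mem_essImage T := ⟨fiberHComod T, ⟨toStarFiberIso T⟩⟩

instance : (toStarFunctor C).IsEquivalence where

end HComod

end ModuleCoalgebra

end ToStarEquivalence

/-! ### Equivalences of module categories -/

section ModuleEquivalences

open Functor.LaxLeftLinear

variable {C : Type*} [Category* C] [MonoidalCategory C]
variable {M N K L : Type*} [Category* M] [Category* N] [Category* K] [Category* L]
  [MonoidalLeftAction C M] [MonoidalLeftAction C N] [MonoidalLeftAction C K]
  [MonoidalLeftAction C L]

namespace LaxModuleFunctor

/-! ### Doctrinal adjunction: a right adjoint of a strong module functor is lax. -/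

section RightAdjoint

/-- The counit `F(G(n)) ⟶ n`. -/
def adjCounit {F : M ⥤ N} {G : N ⥤ M} (adj : F ⊣ G) (n : N) : F.obj (G.obj n) ⟶ n :=
  adj.counit.app n

/-- The unit `m ⟶ G(F(m))`. -/
def adjUnit {F : M ⥤ N} {G : N ⥤ M} (adj : F ⊣ G) (m : M) : m ⟶ G.obj (F.obj m) :=
  adj.unit.app m

theorem adjCounit_naturality {F : M ⥤ N} {G : N ⥤ M} (adj : F ⊣ G) {n n' : N} (g : n ⟶ n') :
    F.map (G.map g) ≫ adjCounit adj n' = adjCounit adj n ≫ g :=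
  adj.counit_naturality g

theorem map_adjUnit_adjCounit {F : M ⥤ N} {G : N ⥤ M} (adj : F ⊣ G) (m : M) :
    F.map (adjUnit adj m) ≫ adjCounit adj (F.obj m) = 𝟙 _ :=
  adj.left_triangle_components m

theorem homEquiv_adjCounit {F : M ⥤ N} {G : N ⥤ M} (adj : F ⊣ G) {m : M} {n : N}
    (f : m ⟶ G.obj n) : (adj.homEquiv m n).symm f = F.map f ≫ adjCounit adj n :=
  adj.homEquiv_counit _ _ _

variable (F : LaxModuleFunctor C M N) (hF : F.IsStrong) {G : N ⥤ M} (adj : F.functor ⊣ G)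

/-- The structure morphism `c ⊗ G(n) ⟶ G(c ⊗ n)` of a right adjoint of a strong module functor. -/
def rightAdjointStr (c : C) (n : N) : c ⊙ₗ G.obj n ⟶ G.obj (c ⊙ₗ n) :=
  haveI := hF c (G.obj n)
  adj.homEquiv _ _ (inv (F.str c (G.obj n)) ≫ c ⊴ₗ adjCounit adj n)

/-- The characterization of the mate. With `rightAdjoint_hom_ext` it reduces every axiom for `G` to
an axiom for `F`, and the inverse of the structure morphism of `F` does not appear again. -/
theorem str_map_rightAdjointStr (c : C) (n : N) :
    F.str c (G.obj n) ≫ F.functor.map (F.rightAdjointStr hF adj c n) ≫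
      adjCounit adj (c ⊙ₗ n) = c ⊴ₗ adjCounit adj n := by
  have := hF c (G.obj n)
  rw [← homEquiv_adjCounit, rightAdjointStr, Equiv.symm_apply_apply,
    IsIso.hom_inv_id_assoc]

theorem str_map_rightAdjointStr_assoc (c : C) (n : N) {Z : N} (f : c ⊙ₗ n ⟶ Z) :
    F.str c (G.obj n) ≫ F.functor.map (F.rightAdjointStr hF adj c n) ≫
      adjCounit adj (c ⊙ₗ n) ≫ f = c ⊴ₗ adjCounit adj n ≫ f := by
  rw [← str_map_rightAdjointStr F hF adj, Category.assoc, Category.assoc]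

-- Transposition is injective and the structure morphism of `F` is invertible, so morphisms into
-- `G(n)` may be compared after both operations.
include hF in
theorem rightAdjoint_hom_ext {c : C} {m : M} {n : N} {f g : c ⊙ₗ m ⟶ G.obj n}
    (h : F.str c m ≫ F.functor.map f ≫ adjCounit adj n =
      F.str c m ≫ F.functor.map g ≫ adjCounit adj n) : f = g := by
  have := hF c m
  rw [cancel_epi, ← homEquiv_adjCounit, ← homEquiv_adjCounit] at h
  exact (adj.homEquiv _ _).symm.injective h

/-- A right adjoint of a strong module functor is a lax module functor. -/
def rightAdjoint : LaxModuleFunctor C N M where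
  functor := G
  lax :=
    { μₗ := fun c n => F.rightAdjointStr hF adj c n
      μₗ_naturality_left := fun {c c'} f n => F.rightAdjoint_hom_ext hF adj (by
        have h := μₗ_naturality_left_assoc F.functor f (G.obj n)
          (F.functor.map (F.rightAdjointStr hF adj c' n) ≫ adjCounit adj (c' ⊙ₗ n))
        rw [Functor.map_comp, Functor.map_comp, Category.assoc, Category.assoc,
          adjCounit_naturality, str_map_rightAdjointStr_assoc, ← h,
          str_map_rightAdjointStr, action_exchange])
      μₗ_naturality_right := fun c {n n'} g => F.rightAdjoint_hom_ext hF adj (by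
        have h := μₗ_naturality_right_assoc F.functor c (G.map g)
          (F.functor.map (F.rightAdjointStr hF adj c n') ≫ adjCounit adj (c ⊙ₗ n'))
        rw [Functor.map_comp, Functor.map_comp, Category.assoc, Category.assoc,
          adjCounit_naturality, str_map_rightAdjointStr_assoc, ← h,
          str_map_rightAdjointStr, ← actionHomRight_comp, adjCounit_naturality,
          actionHomRight_comp])
      μₗ_associativity := fun c c' n => F.rightAdjoint_hom_ext hF adj (by
        have h := μₗ_associativity_assoc F.functor c c' (G.obj n)
          (F.functor.map (c ⊴ₗ F.rightAdjointStr hF adj c' n) ≫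
            F.functor.map (F.rightAdjointStr hF adj c (c' ⊙ₗ n)) ≫
              adjCounit adj (c ⊙ₗ c' ⊙ₗ n))
        simp only [Functor.map_comp, Category.assoc]
        rw [adjCounit_naturality, str_map_rightAdjointStr_assoc, h,
          ← μₗ_naturality_right_assoc, str_map_rightAdjointStr, ← actionHomRight_comp,
          ← actionHomRight_comp, str_map_rightAdjointStr]
        simp)
      μₗ_unitality := fun n => F.rightAdjoint_hom_ext hF adj (by
        have h := μₗ_unitality F.functor (C := C) (G.obj n)
        rw [Functor.map_comp, Category.assoc, adjCounit_naturality,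
          str_map_rightAdjointStr_assoc]
        refine (Category.assoc _ _ _).symm.trans ((congrArg (· ≫ adjCounit adj n) h.symm).trans ?_)
        simp) }

/-- The unit of the adjunction, as a morphism of module functors. -/
def rightAdjointUnit : id M ⟶ comp F (F.rightAdjoint hF adj) where
  nat := adj.unit
  comm c m := F.rightAdjoint_hom_ext hF adj (by
    change F.str c m ≫ F.functor.map (𝟙 _ ≫ adjUnit adj (c ⊙ₗ m)) ≫
        adjCounit adj (F.functor.obj (c ⊙ₗ m)) =
      F.str c m ≫ F.functor.map (c ⊴ₗ adjUnit adj m ≫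
        F.rightAdjointStr hF adj c (F.functor.obj m) ≫ G.map (F.str c m)) ≫
          adjCounit adj (F.functor.obj (c ⊙ₗ m))
    rw [Category.id_comp, map_adjUnit_adjCounit, Category.comp_id,
      Functor.map_comp, Functor.map_comp, Category.assoc, Category.assoc,
      adjCounit_naturality, ← μₗ_naturality_right_assoc, str_map_rightAdjointStr_assoc,
      ← actionHomRight_comp_assoc, map_adjUnit_adjCounit]
    simp)

/-- The counit of the adjunction, as a morphism of module functors. -/
def rightAdjointCounit : comp (F.rightAdjoint hF adj) F ⟶ id N where
  nat := adj.counit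
  comm c n := by
    refine (Category.assoc _ _ _).trans ((F.str_map_rightAdjointStr hF adj c n).trans ?_)
    exact (Category.comp_id _).symm

end RightAdjoint

/-- A morphism of module functors with invertible components, as an isomorphism. -/
def isoOfNatIsIso {F G : LaxModuleFunctor C M N} (η : F ⟶ G) [IsIso η.nat] : F ≅ G :=
  isoMk (asIso η.nat) η.comm

/-- The right adjoint is a module functor by doctrinal adjunction. The unit and counit are morphisms
of module functors and, for an equivalence, invertible. -/
theorem moduleEquivalent_of_isStrong (F : LaxModuleFunctor C M N) (hF : F.IsStrong)
    [F.functor.IsEquivalence] : ModuleEquivalent C M N := by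
  let adj := F.functor.asEquivalence.toAdjunction
  have h1 : IsIso (F.rightAdjointUnit hF adj).nat := inferInstanceAs (IsIso adj.unit)
  have h2 : IsIso (F.rightAdjointCounit hF adj).nat := inferInstanceAs (IsIso adj.counit)
  exact ⟨F, F.rightAdjoint hF adj, ⟨(isoOfNatIsIso (F.rightAdjointUnit hF adj)).symm⟩,
    ⟨isoOfNatIsIso (F.rightAdjointCounit hF adj)⟩⟩

/-- The natural isomorphism underlying an isomorphism of module functors. -/
def natIso {F G : LaxModuleFunctor C M N} (e : F ≅ G) : F.functor ≅ G.functor where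
  hom := e.hom.nat
  inv := e.inv.nat
  hom_inv_id := by rw [← comp_nat, e.hom_inv_id, id_nat]
  inv_hom_id := by rw [← comp_nat, e.inv_hom_id, id_nat]

theorem IsStrong.of_iso {F G : LaxModuleFunctor C M N} (hG : G.IsStrong) (e : F ≅ G) :
    F.IsStrong := fun c m => by
  have := hG c m
  have h := e.hom.comm c m
  have h1 : F.str c m = (c ⊴ₗ ((natIso e).app m).hom ≫ G.str c m) ≫
      ((natIso e).app (c ⊙ₗ m)).inv := by
    rw [Iso.eq_comp_inv]
    exact h
  rw [h1]
  infer_instance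

theorem isStrong_id : (id M).IsStrong (C := C) := fun c m => inferInstanceAs (IsIso (𝟙 (c ⊙ₗ m)))

/-! ### Lax module equivalences are strong. -/

section Inverse

variable {F : LaxModuleFunctor C M N} {G : LaxModuleFunctor C N M} (e : comp F G ≅ id M)
  (e' : comp G F ≅ id N)

/-- The equivalence of categories underlying an equivalence of module categories. -/
def equivalenceOfInverse : M ≌ N :=
  CategoryTheory.Equivalence.mk F.functor G.functor (natIso e).symm (natIso e')

include e e' in
theorem isEquivalence_of_inverse : F.functor.IsEquivalence :=
  (equivalenceOfInverse e e').isEquivalence_functor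

-- The structure morphisms of the two composites are isomorphisms, being conjugate to identities.
-- From `comp F G` the image under `G` of a structure morphism of `F` is epi, hence so is the
-- morphism itself; from `comp G F` the structure morphisms of `F` at objects in the image of `G`
-- are split mono, and every `m` is isomorphic to `G(F(m))`.
include e e' in
theorem isStrong_of_inverse : F.IsStrong := fun c m => by
  have := isEquivalence_of_inverse e e'
  have := isEquivalence_of_inverse e' e
  have h1 : IsIso (G.str c (F.functor.obj m) ≫ G.functor.map (F.str c m)) :=
    isStrong_id.of_iso e c m
  have h2 : IsIso (F.str c (G.functor.obj (F.functor.obj m)) ≫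
      F.functor.map (G.str c (F.functor.obj m))) := isStrong_id.of_iso e' c (F.functor.obj m)
  have h3 : Epi (F.str c m) := by
    have := epi_of_epi (G.str c (F.functor.obj m)) (G.functor.map (F.str c m))
    exact G.functor.epi_of_epi_map this
  have h4 : IsSplitMono (F.str c (G.functor.obj (F.functor.obj m))) :=
    IsSplitMono.mk' ⟨F.functor.map (G.str c (F.functor.obj m)) ≫ inv (F.str c _ ≫ _), by
      rw [← Category.assoc, IsIso.hom_inv_id]⟩
  let a : m ≅ G.functor.obj (F.functor.obj m) := ((natIso e).app m).symm
  -- Naturality along `m ≅ G(F(m))` moves the split monomorphism from `G(F(m))` to `m`.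
  have h5 : F.str c m = c ⊴ₗ F.functor.map a.hom ≫ F.str c _ ≫ F.functor.map (c ⊴ₗ a.inv) := by
    rw [← μₗ_naturality_right, ← actionHomRight_comp_assoc, ← Functor.map_comp, a.hom_inv_id]
    simp
  have h6 : IsSplitMono (F.str c m) := by
    rw [h5]
    infer_instance
  exact isIso_of_epi_of_isSplitMono _

end Inverse

end LaxModuleFunctor

open LaxModuleFunctor in
theorem ModuleEquivalent.symm (h : ModuleEquivalent C M N) : ModuleEquivalent C N M := by
  obtain ⟨F, G, e, e'⟩ := h
  exact ⟨G, F, e', e⟩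

-- Only the forward functors need to be composed: they are automatically strong, and a strong
-- equivalence has a lax quasi-inverse.
open LaxModuleFunctor in
theorem ModuleEquivalent.trans (h : ModuleEquivalent C M N) (h' : ModuleEquivalent C N K) :
    ModuleEquivalent C M K := by
  obtain ⟨F, G, ⟨e⟩, ⟨e'⟩⟩ := h
  obtain ⟨F', G', ⟨i⟩, ⟨i'⟩⟩ := h'
  have := isEquivalence_of_inverse e e'
  have := isEquivalence_of_inverse i i'
  have h1 := isStrong_of_inverse e e'
  have h2 := isStrong_of_inverse i i'
  have : (comp F F').functor.IsEquivalence :=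
    inferInstanceAs (F.functor ⋙ F'.functor).IsEquivalence
  refine (comp F F').moduleEquivalent_of_isStrong fun c m => ?_
  have := h1 c m
  have := h2 c (F.functor.obj m)
  exact inferInstanceAs (IsIso (F'.str c (F.functor.obj m) ≫ F'.functor.map (F.str c m)))

end ModuleEquivalences

/-! ### Transport along equivalences of linear module categories -/

section Transport

namespace LaxModuleFunctor

variable {C : Type*} [Category* C] [MonoidalCategory C]
variable {M N K : Type*} [Category* M] [Category* N] [Category* K]
  [MonoidalLeftAction C M] [MonoidalLeftAction C N] [MonoidalLeftAction C K]

/-- Whiskering of an isomorphism of module functors with `F` on the source side. -/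
def whiskerLeftIso (F : LaxModuleFunctor C M N) {G G' : LaxModuleFunctor C N K} (e : G ≅ G') :
    comp F G ≅ comp F G' where
  hom := whiskerLeft F e.hom
  inv := whiskerLeft F e.inv
  hom_inv_id := hom_ext fun m => by
    change e.hom.nat.app (F.functor.obj m) ≫ e.inv.nat.app (F.functor.obj m) = 𝟙 _
    rw [← NatTrans.comp_app, ← comp_nat, e.hom_inv_id]
    rfl
  inv_hom_id := hom_ext fun m => by
    change e.inv.nat.app (F.functor.obj m) ≫ e.hom.nat.app (F.functor.obj m) = 𝟙 _
    rw [← NatTrans.comp_app, ← comp_nat, e.inv_hom_id]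
    rfl

end LaxModuleFunctor

/-- Equivalences of `k`-linear module categories by functors of type `ℒ`. -/
structure LEquivalence (k : Type u) [Field k] (C : Type*) [Category* C] [MonoidalCategory C]
    (M N : Type*) [Category* M] [Category* N] [Preadditive M] [Preadditive N] [Linear k M]
    [Linear k N] [MonoidalLeftAction C M] [MonoidalLeftAction C N] where
  functor : LFunctor k C M N
  inverse : LFunctor k C N M
  unitIso : LFunctor.id k C M ≅ functor.comp inverse
  counitIso : inverse.comp functor ≅ LFunctor.id k C N

section

variable {k : Type u} [Field k] {C : Type*} [Category* C] [MonoidalCategory C]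
  {M N : Type*} [Category* M] [Category* N] [Preadditive M] [Preadditive N] [Linear k M]
  [Linear k N] [MonoidalLeftAction C M] [MonoidalLeftAction C N]

/-- An additive linear equivalence is a functor of type `ℒ`. -/
def LFunctor.ofIsEquivalence (F : LaxModuleFunctor C M N) (h : F.functor.Additive)
    (h' : F.functor.Linear k) [F.functor.IsEquivalence] : LFunctor k C M N where
  toLaxModuleFunctor := F
  additive := h
  linear := h'
  leftExact := inferInstance
  coproducts _ := inferInstance

/-- Equivalences preserve all limits and colimits, so the two linear module functors are of type
`ℒ`. A linear module equivalence is therefore an equivalence inside `𝔐^H-Mod`. -/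
theorem LinearModuleEquivalent.nonempty_lEquivalence (h : LinearModuleEquivalent C k M N) :
    Nonempty (LEquivalence k C M N) := by
  obtain ⟨F, G, hF, hF', hG, hG', ⟨e⟩, ⟨e'⟩⟩ := h
  have := LaxModuleFunctor.isEquivalence_of_inverse e e'
  have := LaxModuleFunctor.isEquivalence_of_inverse e' e
  exact ⟨⟨LFunctor.ofIsEquivalence F hF hF', LFunctor.ofIsEquivalence G hG hG',
    LFunctor.isoMk e.symm, LFunctor.isoMk e'⟩⟩

namespace LFunctor

/-- The isomorphism of module functors underlying an isomorphism of functors of type `ℒ`. -/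
def laxIso {F G : LFunctor k C M N} (e : F ≅ G) :
    F.toLaxModuleFunctor ≅ G.toLaxModuleFunctor where
  hom := e.hom
  inv := e.inv
  hom_inv_id := e.hom_inv_id
  inv_hom_id := e.inv_hom_id

end LFunctor

namespace LEquivalence

variable (e : LEquivalence k C M N)

/-- The underlying equivalence of categories. -/
def equivalence : M ≌ N :=
  LaxModuleFunctor.equivalenceOfInverse (LFunctor.laxIso e.unitIso).symm
    (LFunctor.laxIso e.counitIso)

end LEquivalence

end

/-! ### Invariance of `M_*` under equivalence, and left exactness of `F_*`. -/

variable {k : Type u} [Field k] {H : Type u} [Ring H] [Bialgebra k H]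
variable {M N : Type*} [Category* M] [Category* N] [Preadditive M] [Preadditive N]
  [Linear k M] [Linear k N] [MonoidalLeftAction (RComod k H) M] [MonoidalLeftAction (RComod k H) N]

/-- The isomorphism `G_* F_* ≅ 1` given by an isomorphism `G F ≅ 1`. -/
def starCompIso {F : LFunctor k (RComod k H) M N} {G : LFunctor k (RComod k H) N M}
    (e : F.comp G ≅ LFunctor.id k (RComod k H) M) :
    (starLax F).functor ⋙ (starLax G).functor ≅ 𝟭 (Star k H M) :=
  NatIso.ofComponents
    (fun T => (LFunctor.isoMk (LaxModuleFunctor.assoc T.toLaxModuleFunctor F.toLaxModuleFunctor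
      G.toLaxModuleFunctor ≪≫ LaxModuleFunctor.whiskerLeftIso T.toLaxModuleFunctor
        (LFunctor.laxIso e) ≪≫ LaxModuleFunctor.compId T.toLaxModuleFunctor) :
          (T.comp F).comp G ≅ T))
    fun {T T'} η => LaxModuleFunctor.hom_ext fun W => by
      have h : G.functor.map (F.functor.map ((LaxModuleFunctor.Hom.nat η).app W)) ≫
          (LaxModuleFunctor.Hom.nat e.hom).app (T'.functor.obj W) =
          (LaxModuleFunctor.Hom.nat e.hom).app (T.functor.obj W) ≫
            (LaxModuleFunctor.Hom.nat η).app W :=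
        (LaxModuleFunctor.Hom.nat e.hom).naturality ((LaxModuleFunctor.Hom.nat η).app W)
      change G.functor.map (F.functor.map ((LaxModuleFunctor.Hom.nat η).app W)) ≫
          𝟙 (G.functor.obj (F.functor.obj (T'.functor.obj W))) ≫
            (LaxModuleFunctor.Hom.nat e.hom).app (T'.functor.obj W) ≫ 𝟙 (T'.functor.obj W) =
        (𝟙 (G.functor.obj (F.functor.obj (T.functor.obj W))) ≫
            (LaxModuleFunctor.Hom.nat e.hom).app (T.functor.obj W) ≫ 𝟙 (T.functor.obj W)) ≫
          (LaxModuleFunctor.Hom.nat η).app W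
      rw [Category.id_comp, Category.id_comp]
      refine (Category.assoc _ _ _).symm.trans ?_
      refine (congrArg (· ≫ 𝟙 (T'.functor.obj W)) h).trans ?_
      refine (Category.comp_id _).trans ?_
      exact congrArg (· ≫ (LaxModuleFunctor.Hom.nat η).app W) (Category.comp_id _).symm

theorem LEquivalence.starLax_isEquivalence (e : LEquivalence k (RComod k H) M N) :
    (starLax e.functor).functor.IsEquivalence :=
  (CategoryTheory.Equivalence.mk (starLax e.functor).functor (starLax e.inverse).functor
    (starCompIso e.unitIso.symm).symm (starCompIso e.counitIso)).isEquivalence_functor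

theorem LEquivalence.star_moduleEquivalent (e : LEquivalence k (RComod k H) M N) :
    ModuleEquivalent (HMod k H) (Star k H M) (Star k H N) :=
  have := e.starLax_isEquivalence
  (starLax e.functor).moduleEquivalent_of_isStrong (starLax_isStrong e.functor)

theorem ModuleCoalgebra.star_moduleEquivalent (C : ModuleCoalgebra k H) :
    ModuleEquivalent (HMod k H) (Star k H C.Comod) C.HComod :=
  have : (HComod.toStarLax C).functor.IsEquivalence :=
    inferInstanceAs (HComod.toStarFunctor C).IsEquivalence
  ((HComod.toStarLax C).moduleEquivalent_of_isStrong HComod.toStarLax_isStrong).symm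

/-- An equivalence of `M` with `𝔐^C` induces one of `M_*` with `(𝔐^C)_*`, which is `_H𝔐^C`. -/
theorem starIsModModCat (k : Type u) [Field k] (H : Type u) [Ring H] [Bialgebra k H] :
    StarIsModModCat.{v, w} k H := fun M => by
  obtain ⟨C, hC⟩ := M.exists_equiv
  obtain ⟨e⟩ := hC.nonempty_lEquivalence
  exact ⟨C, e.star_moduleEquivalent.trans C.star_moduleEquivalent⟩

namespace ModuleCoalgebra

variable {C : ModuleCoalgebra k H}

theorem hasFiniteLimits_of_equivalence {M : Type*} [Category* M] (e : M ≌ C.Comod) :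
    HasFiniteLimits M := ⟨fun J _ _ =>
  have : HasLimitsOfShape J C.Comod := inferInstanceAs (HasLimitsOfShape J (RComod k C.carrier))
  Adjunction.hasLimitsOfShape_of_equivalence e.functor⟩

theorem hasCoproducts_of_equivalence {M : Type*} [Category* M] (e : M ≌ C.Comod) :
    HasCoproducts.{u} M := fun J =>
  have : HasColimitsOfShape (Discrete J) C.Comod :=
    inferInstanceAs (HasColimitsOfShape (Discrete J) (RComod k C.carrier))
  Adjunction.hasColimitsOfShape_of_equivalence e.functor

/-- Exactness of coproducts passes from vector spaces to comodules, and from comodules along the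
equivalence. -/
theorem preservesFiniteLimits_colim {M : Type*} [Category* M] (e : M ≌ C.Comod) (S : Type u)
    [HasCoproducts.{u} M] :
    PreservesFiniteLimits (colim : (Discrete S ⥤ M) ⥤ M) := by
  have : HasFiniteLimits M := hasFiniteLimits_of_equivalence e
  have : HasColimitsOfShape (Discrete S) C.Comod :=
    inferInstanceAs (HasColimitsOfShape (Discrete S) (RComod k C.carrier))
  have : HasExactColimitsOfShape (Discrete S) C.Comod :=
    inferInstanceAs (HasExactColimitsOfShape (Discrete S) (RComod k C.carrier))
  have := HasExactColimitsOfShape.domain_of_functor (Discrete S) e.functor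
  infer_instance

end ModuleCoalgebra

/-- Limit cones in `M_*` are pointwise limit cones, `F` preserves each of their evaluations, and a
pointwise limit cone in `N_*` is a limit cone. Exactness of coproducts is needed in the source `M`
only. -/
theorem starLax_preservesFiniteLimits [HasFiniteLimits M] [HasCoproducts.{u} M]
    [∀ S : Type u, PreservesFiniteLimits (colim : (Discrete S ⥤ M) ⥤ M)]
    (F : LFunctor k (RComod k H) M N) : PreservesFiniteLimits (starLax F).functor :=
  ⟨fun J _ _ => ⟨fun {D} => ⟨fun {c} hc => ⟨LFunctor.isLimitOfEv fun W => by
    have := LFunctor.preservesLimitsOfShape_ev (k := k) (C := RComod k H)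
      (M := ModuleCat.{u} k) (N := M) (J := J) W
    have := F.leftExact
    exact isLimitOfPreserves F.functor
      (isLimitOfPreserves (LFunctor.ev k (RComod k H) M W) hc)⟩⟩⟩⟩

theorem starIsLeftExact (k : Type u) [Field k] (H : Type u) [Ring H] [Bialgebra k H] :
    StarIsLeftExact.{v, w} k H := fun M N F => by
  obtain ⟨C, hC⟩ := M.exists_equiv
  obtain ⟨e⟩ := hC.nonempty_lEquivalence
  have := ModuleCoalgebra.hasFiniteLimits_of_equivalence e.equivalence
  have := ModuleCoalgebra.hasCoproducts_of_equivalence e.equivalence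
  have := ModuleCoalgebra.preservesFiniteLimits_colim e.equivalence
  exact starLax_preservesFiniteLimits F

end Transport

/-! ### Cofree comodules -/

section Cofree

open scoped TensorProduct

/-! ### Equalizers as a property of three morphisms. -/

section Equalizers

variable {A B : Type*} [Category* A] [Category* B]

/-- The condition that `h` is an equalizer of `a` and `b`. -/
structure IsEqualizer {X Y Z : A} (h : X ⟶ Y) (a b : Y ⟶ Z) : Prop where
  w : h ≫ a = h ≫ b
  exists_lift : ∀ {T : A} (g : T ⟶ Y), g ≫ a = g ≫ b → ∃ l : T ⟶ X, l ≫ h = g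
  hom_ext : ∀ {T : A} {l l' : T ⟶ X}, l ≫ h = l' ≫ h → l = l'

namespace IsEqualizer

variable {X Y Z : A} {h : X ⟶ Y} {a b : Y ⟶ Z}

/-- The limit fork of an equalizer. -/
def isLimit (H : IsEqualizer h a b) : IsLimit (Fork.ofι h H.w) :=
  Fork.IsLimit.mk' _ fun s => ⟨(H.exists_lift s.ι s.condition).choose,
    (H.exists_lift s.ι s.condition).choose_spec,
    fun hm => H.hom_ext (hm.trans (H.exists_lift s.ι s.condition).choose_spec.symm)⟩

theorem of_isLimit {w : h ≫ a = h ≫ b} (H : IsLimit (Fork.ofι h w)) : IsEqualizer h a b where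
  w := w
  exists_lift g hg := ⟨Fork.IsLimit.lift H g hg, Fork.IsLimit.lift_ι' H g hg⟩
  hom_ext hl := Fork.IsLimit.hom_ext H hl

theorem map (H : IsEqualizer h a b) (F : A ⥤ B) [PreservesLimit (parallelPair a b) F] :
    IsEqualizer (F.map h) (F.map a) (F.map b) :=
  of_isLimit (isLimitForkMapOfIsLimit F H.w H.isLimit)

theorem mono (H : IsEqualizer h a b) : Mono h := ⟨fun _ _ => H.hom_ext⟩

theorem of_iso (H : IsEqualizer h a b) {X' Y' Z' : A} (i : X ≅ X') (j : Y ≅ Y') (l : Z ≅ Z')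
    {h' : X' ⟶ Y'} {a' b' : Y' ⟶ Z'} (hh : h ≫ j.hom = i.hom ≫ h') (ha : a ≫ l.hom = j.hom ≫ a')
    (hb : b ≫ l.hom = j.hom ≫ b') : IsEqualizer h' a' b' where
  w := by
    rw [← cancel_epi i.hom, ← Category.assoc, ← Category.assoc, ← hh, Category.assoc,
      Category.assoc, ← ha, ← hb, ← Category.assoc, ← Category.assoc, H.w]
  exists_lift g hg := by
    obtain ⟨t, ht⟩ := H.exists_lift (g ≫ j.inv) (by
      rw [← cancel_mono l.hom]
      simpa [ha, hb] using hg)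
    exact ⟨t ≫ i.hom, by rw [Category.assoc, ← hh, reassoc_of% ht]; simp⟩
  hom_ext {T t t'} ht := by
    have h1 : h' = i.inv ≫ h ≫ j.hom := by rw [hh, i.inv_hom_id_assoc]
    rw [h1, ← Category.assoc, ← Category.assoc, ← Category.assoc, ← Category.assoc,
      cancel_mono] at ht
    exact (cancel_mono i.inv).1 (H.hom_ext ht)

theorem exists_iso (H : IsEqualizer h a b) {X' : A} {h' : X' ⟶ Y} (H' : IsEqualizer h' a b) :
    ∃ e : X ≅ X', e.hom ≫ h' = h := by
  obtain ⟨f, hf⟩ := H'.exists_lift h H.w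
  obtain ⟨g, hg⟩ := H.exists_lift h' H'.w
  exact ⟨⟨f, g, H.hom_ext (by rw [Category.assoc, hg, hf, Category.id_comp]),
    H'.hom_ext (by rw [Category.assoc, hf, hg, Category.id_comp])⟩, hf⟩

end IsEqualizer

variable {k : Type u} [Field k] {C : Type*} [Category* C] [MonoidalCategory C]
  {M N : Type*} [Category* M] [Category* N] [Preadditive M] [Preadditive N] [Linear k M]
  [Linear k N] [MonoidalLeftAction C M] [MonoidalLeftAction C N]

/-- Equalizers of functors of type `ℒ` can be recognized pointwise, with no assumption on limits in
`N`. -/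
theorem LFunctor.isEqualizer_of_ev {X Y Z : LFunctor k C M N} {h : X ⟶ Y} {a b : Y ⟶ Z}
    (H : ∀ m, IsEqualizer ((LFunctor.ev k C N m).map h) ((LFunctor.ev k C N m).map a)
      ((LFunctor.ev k C N m).map b)) : IsEqualizer h a b := by
  have w : h ≫ a = h ≫ b := LFunctor.hom_ext fun m => (H m).w
  exact IsEqualizer.of_isLimit (w := w) <| LFunctor.isLimitOfEv fun m =>
    (isLimitMapConeForkEquiv (LFunctor.ev k C N m) w).symm (H m).isLimit

end Equalizers

variable {k : Type u} [Field k]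

/-! ### The cofree resolution of a comodule. -/

namespace RComod

section

variable {C : Type u} [AddCommGroup C] [Module k C] [Coalgebra k C]

variable (k C) in
/-- The linear map `v ⊗ c ↦ ε(c) v`. -/
def counitRight (V : Type u) [AddCommGroup V] [Module k V] : V ⊗[k] C →ₗ[k] V :=
  (TensorProduct.rid k V).toLinearMap ∘ₗ (Coalgebra.counit (R := k) (A := C)).lTensor V

theorem counitRight_coact (X : RComod k C) : counitRight k C X.obj ∘ₗ X.coact = LinearMap.id := by
  rw [counitRight, LinearMap.comp_assoc, X.counit]
  ext x
  simp

theorem counitRight_naturality {V W : Type u} [AddCommGroup V] [Module k V] [AddCommGroup W]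
    [Module k W] (f : V →ₗ[k] W) :
    f ∘ₗ counitRight k C V = counitRight k C W ∘ₗ f.rTensor C := by
  ext v c
  simp [counitRight]

theorem rTensor_counitRight (V : Type u) [AddCommGroup V] [Module k V] :
    (counitRight k C V).rTensor C ∘ₗ copowerCoact V (Coalgebra.comul (R := k) (A := C)) =
      LinearMap.id := by
  have h : ∀ (v : V) (s : C ⊗[k] C), (counitRight k C V).rTensor C
      ((TensorProduct.assoc k V C C).symm (v ⊗ₜ s)) =
      v ⊗ₜ TensorProduct.lid k C ((Coalgebra.counit (R := k) (A := C)).rTensor C s) := by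
    intro v s
    induction s with
    | zero => simp
    | add s s' hs hs' => simp only [TensorProduct.tmul_add, map_add, hs, hs']
    | tmul c d => simp [counitRight, TensorProduct.smul_tmul]
  ext v c
  simp [copowerCoact, h]

theorem coactHom_naturality {X Y : RComod k C} (f : X ⟶ Y) :
    coactHom X ≫ copowerMap f.hom (regular k C) = f ≫ coactHom Y :=
  hom_ext <| ModuleCat.hom_ext f.comm.symm

/-- The coaction as a linear map. -/
abbrev coactMap (X : RComod k C) : X.obj ⟶ X.obj ⊗ (regular k C).obj := ModuleCat.ofHom X.coact

/-- The pair is `ρ ⊗ C` and `X ⊗ Δ`. The counit splits this fork on vector spaces, so a lift of `g`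
can only be `(X ⊗ ε) ∘ g`; that this linear map is colinear has to be checked. -/
theorem isEqualizer_coactHom (X : RComod k C) : IsEqualizer (coactHom X)
    (copowerMap X.coactMap (regular k C)) (coactHom (copower X.obj (regular k C))) where
  w := coactHom_naturality (coactHom X)
  exists_lift {Y} g hg := by
    let γ : Y.obj →ₗ[k] X.obj ⊗[k] C := g.hom.hom
    have h1 : X.coact.rTensor C ∘ₗ γ =
        copowerCoact X.obj (Coalgebra.comul (R := k) (A := C)) ∘ₗ γ :=
      congrArg (fun f => f.hom.hom) hg
    have h2 : copowerCoact X.obj (Coalgebra.comul (R := k) (A := C)) ∘ₗ γ =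
      γ.rTensor C ∘ₗ Y.coact := g.comm
    -- Apply `ε` to the last factor of the equation `(ρ ⊗ C) g = (X ⊗ Δ) g`.
    have h3 : X.coact ∘ₗ counitRight k C X.obj ∘ₗ γ = γ := by
      rw [← LinearMap.comp_assoc, counitRight_naturality, LinearMap.comp_assoc, h1,
        ← LinearMap.comp_assoc]
      exact congrArg (· ∘ₗ γ) (counitRight_coact (copower X.obj (regular k C)))
    -- Apply `ε` to the middle factor, using colinearity of `g`. Together with `h3`, this makes the
    -- lift colinear.
    have h4 : (counitRight k C X.obj ∘ₗ γ).rTensor C ∘ₗ Y.coact = γ := by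
      rw [LinearMap.rTensor_comp, LinearMap.comp_assoc, ← h2, ← LinearMap.comp_assoc,
        rTensor_counitRight, LinearMap.id_comp]
    exact ⟨⟨ModuleCat.ofHom (counitRight k C X.obj ∘ₗ γ), h3.trans h4.symm⟩,
      hom_ext <| ModuleCat.hom_ext h3⟩
  hom_ext {Y l l'} h := hom_ext <| ModuleCat.hom_ext <| LinearMap.ext fun y => by
    have h1 : X.coact (l.hom.hom y) = X.coact (l'.hom.hom y) := hom_apply_congr h y
    have h2 := LinearMap.congr_fun X.counitRight_coact
    exact (h2 _).symm.trans ((congrArg (counitRight k C X.obj) h1).trans (h2 _))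

end

end RComod

/-! ### The module functor `- ⊗ C`, and coactions as morphisms of module functors. -/

namespace ModuleCoalgebra

variable {H : Type u} [Ring H] [Bialgebra k H] (C : ModuleCoalgebra k H)

/-- The forgetful functor `𝔐^C ⥤ Vec` as a lax module functor. -/
@[simps functor]
def forgetLax : LaxModuleFunctor (RComod k H) C.Comod (ModuleCat.{u} k) where
  functor := RComod.forget k C.carrier
  lax :=
    { μₗ := fun X M => 𝟙 (X.obj ⊗ M.obj)
      μₗ_naturality_left := fun f M => (Category.comp_id _).trans (Category.id_comp _).symm
      μₗ_naturality_right := fun X _ _ g => (Category.comp_id _).trans (Category.id_comp _).symm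
      μₗ_associativity := fun X Y M => by
        change 𝟙 ((X.obj ⊗ Y.obj) ⊗ M.obj) ≫ (α_ X.obj Y.obj M.obj).hom =
          (α_ X.obj Y.obj M.obj).hom ≫ X.obj ◁ 𝟙 (Y.obj ⊗ M.obj) ≫ 𝟙 (X.obj ⊗ Y.obj ⊗ M.obj)
        simp
      μₗ_unitality := fun M => (Category.id_comp (λ_ M.obj).hom).symm }

/-- The forgetful functor `𝔐^C ⥤ Vec` as a functor of type `ℒ`. -/
@[simps toLaxModuleFunctor]
def forgetL : LFunctor k (RComod k H) C.Comod (ModuleCat.{u} k) where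
  toLaxModuleFunctor := C.forgetLax
  additive := ⟨fun {_ _} _ _ => rfl⟩
  linear := ⟨fun {_ _} _ _ => rfl⟩
  leftExact := inferInstanceAs (PreservesFiniteLimits (RComod.forget k C.carrier))
  coproducts J :=
    inferInstanceAs (PreservesColimitsOfShape (Discrete J) (RComod.forget k C.carrier))

/-- The coalgebra `C` as an object of `_H𝔐^C`. -/
@[simps toRComod act]
def regular : C.HComod where
  toRComod := RComod.regular k C.carrier
  act := C.act
  coact_act := C.isModuleCoalgebra.comul_act

/-- The functor `W ↦ W ⊗ C`. -/
abbrev cofree : Star k H C.Comod := C.regular.toStar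

variable {C}

/-- This factorization is why the coaction is compatible with the action of `𝔐^H`: it says that `M ⟶
M ⊗ C` respects the structure morphisms of the forgetful functor followed by `- ⊗ C`. -/
theorem coactHom_tensor (X : RComod k H) (M : RComod k C.carrier) :
    RComod.coactHom (RComod.tensor C.isModuleCoalgebra X M) =
      RComod.tensorWhiskerLeft C.isModuleCoalgebra X (RComod.coactHom M) ≫
        C.regular.copowerStr X M.obj :=
  RComod.hom_ext <| ModuleCat.hom_ext (tensorCoact_eq_twist C.act X.coact M.coact)

namespace HComod

/-- The coaction as an `H`-linear map. -/
@[simps]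
def coactHMod (P : C.HComod) : P.toHMod ⟶ P.toHMod ⊗ C.regular.toHMod :=
  ⟨ModuleCat.ofHom P.coact, P.coact_act⟩

/-- The coaction of `W ⊗ P`, as a morphism of module functors. -/
def coactStar (P : C.HComod) : P.toStar ⟶ P.toHMod ⊙ₗ C.cofree :=
  LaxModuleFunctor.Hom.mk (F := P.copowerLax)
    (G := P.toHMod.tensorRightLax.comp C.regular.copowerLax)
    { app := fun W => RComod.coactHom (RComod.copower W P.toRComod)
      naturality := fun _ _ f =>
        (RComod.coactHom_naturality (RComod.copowerMap f P.toRComod)).symm }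
    fun X W => by
      have h1 := RComod.coactHom_naturality (P.copowerStr X W)
      have h2 := coactHom_tensor X (RComod.copower W P.toRComod)
      refine h1.symm.trans ?_
      refine (congrArg (· ≫ RComod.copowerMap (P.copowerStr X W).hom (RComod.regular k C.carrier))
        h2).trans ?_
      exact Category.assoc _ _ _

/-- The morphism `W ⊗ P ⊗ C ⟶ W ⊗ P ⊗ C ⊗ C` given by the coaction of `P`. -/
def coactLeft {S : Type*} [Category* S] [MonoidalLeftAction (HMod k H) S] (P : C.HComod) (L : S) :
    P.toHMod ⊙ₗ L ⟶ P.toHMod ⊙ₗ C.regular.toHMod ⊙ₗ L :=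
  P.coactHMod ⊵ₗ L ≫ (αₗ P.toHMod C.regular.toHMod L).hom

/-- The coaction of `W ⊗ P` is `W` tensored with that of `P`, up to reassociation. Equalizer
conditions on `M_*` can thus be evaluated as conditions on the comodules `W ⊗ P`. -/
theorem ev_coactLeft {N : Type*} [Category* N] [Preadditive N]
    [Linear k N] [MonoidalLeftAction (RComod k H) N] (P : C.HComod) (L : Star k H N)
    (W : ModuleCat.{u} k) :
    (LFunctor.ev k (RComod k H) N W).map (P.coactLeft L) =
      L.functor.map (RComod.copower W P.toRComod).coactMap := by
  refine Eq.trans ?_ (L.functor.map_comp (W ◁ P.toRComod.coactMap)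
    (α_ W P.obj (RComod.regular k C.carrier).obj).inv).symm
  exact congrArg (L.functor.map (W ◁ P.toRComod.coactMap) ≫ ·) (Category.comp_id _)

/-- At each `W` this is the cofree resolution of the comodule `W ⊗ P`. Its last two terms are
obtained from `- ⊗ C` by the action of `_H𝔐`, so a strong module functor can be applied to it. -/
theorem isEqualizer_coactStar (P : C.HComod) :
    IsEqualizer P.coactStar (P.coactLeft C.cofree) (P.toHMod ⊴ₗ C.regular.coactStar) :=
  LFunctor.isEqualizer_of_ev fun W => by
    rw [ev_coactLeft]
    exact RComod.isEqualizer_coactHom (RComod.copower W P.toRComod)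

end HComod

end ModuleCoalgebra

end Cofree

/-! ### The functor `F ↦ F_*` is fully faithful -/

section FullyFaithful

variable {k : Type u} [Field k] {H : Type u} [Ring H] [Bialgebra k H]
  {N : Type*} [Category* N] [Preadditive N] [Linear k N] [MonoidalLeftAction (RComod k H) N]

namespace ModuleCoalgebra

variable {C : ModuleCoalgebra k H}

section

variable (F : LFunctor k (RComod k H) C.Comod N)

/-- The underlying functor on comodules. -/
def onComod : RComod k C.carrier ⥤ N := F.functor

instance : PreservesFiniteLimits (onComod F) := F.leftExact

/-- The structure morphism `X ⊗ F(M) ⟶ F(X ⊗ M)`. -/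
def strOn (X : RComod k H) (M : RComod k C.carrier) :
    X ⊙ₗ (onComod F).obj M ⟶ (onComod F).obj (RComod.tensor C.isModuleCoalgebra X M) :=
  F.str X M

theorem strOn_naturality_right (X : RComod k H) {M M' : RComod k C.carrier} (g : M ⟶ M') :
    X ⊴ₗ (onComod F).map g ≫ strOn F X M' =
      strOn F X M ≫ (onComod F).map (RComod.tensorWhiskerLeft C.isModuleCoalgebra X g) :=
  F.lax.μₗ_naturality_right X g

theorem isEqualizer_map_coactHom (M : RComod k C.carrier) :
    IsEqualizer ((onComod F).map (RComod.coactHom M))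
      ((onComod F).map (RComod.copowerMap M.coactMap (RComod.regular k C.carrier)))
      ((onComod F).map (RComod.coactHom (RComod.copower M.obj (RComod.regular k C.carrier)))) :=
  (RComod.isEqualizer_coactHom M).map (onComod F)

end

section

variable {F G : LFunctor k (RComod k H) C.Comod N}

/-- The components of a morphism between functors of type `ℒ` on comodules. -/
def homApp (θ : F ⟶ G) (M : RComod k C.carrier) : (onComod F).obj M ⟶ (onComod G).obj M :=
  (LaxModuleFunctor.Hom.nat θ).app M

theorem homApp_naturality (θ : F ⟶ G) {M M' : RComod k C.carrier} (f : M ⟶ M') :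
    (onComod F).map f ≫ homApp θ M' = homApp θ M ≫ (onComod G).map f :=
  (LaxModuleFunctor.Hom.nat θ).naturality f

theorem homApp_ext {θ θ' : F ⟶ G} (h : ∀ M, homApp θ M = homApp θ' M) : θ = θ' :=
  LFunctor.hom_ext h

/-- Left exactness makes `G(M) ⟶ G(M ⊗ C)` a monomorphism, so `θ` at `M` is determined by `θ` at `M
⊗ C`, which is a component of `θ_*` at the object `- ⊗ C`. -/
theorem starMap₂_injective : Function.Injective (starMap₂ (F := F) (G := G)) := by
  intro θ θ' h
  refine homApp_ext fun M => (isEqualizer_map_coactHom G M).hom_ext ?_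
  have h1 : homApp θ (RComod.copower M.obj (RComod.regular k C.carrier)) =
      homApp θ' (RComod.copower M.obj (RComod.regular k C.carrier)) :=
    congrArg (fun φ => (LaxModuleFunctor.Hom.nat
      ((LaxModuleFunctor.Hom.nat φ).app C.cofree)).app M.obj) h
  rw [← homApp_naturality, ← homApp_naturality, h1]

variable (φ : starLax F ⟶ starLax G)

/-- The structure morphism of the module functor `W ↦ W ⊗ C`. -/
def cofreeStr (X : RComod k H) (M : RComod k C.carrier) :
    RComod.tensor C.isModuleCoalgebra X (RComod.copower M.obj (RComod.regular k C.carrier)) ⟶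
      RComod.copower (RComod.tensor C.isModuleCoalgebra X M).obj (RComod.regular k C.carrier) :=
  C.regular.copowerStr X M.obj

theorem coactHom_tensor_eq (X : RComod k H) (M : RComod k C.carrier) :
    RComod.coactHom (RComod.tensor C.isModuleCoalgebra X M) =
      RComod.tensorWhiskerLeft C.isModuleCoalgebra X (RComod.coactHom M) ≫ cofreeStr X M :=
  coactHom_tensor X M

/-- The component of a morphism `F_* ⟶ G_*` at the module functor `W ↦ W ⊗ P`. -/
def starComp (P : C.HComod) (W : ModuleCat.{u} k) :
    (onComod F).obj (RComod.copower W P.toRComod) ⟶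
      (onComod G).obj (RComod.copower W P.toRComod) :=
  (LaxModuleFunctor.Hom.nat ((LaxModuleFunctor.Hom.nat φ).app P.toStar)).app W

theorem starComp_naturality (P : C.HComod) {W W' : ModuleCat.{u} k} (g : W ⟶ W') :
    (onComod F).map (RComod.copowerMap g P.toRComod) ≫ starComp φ P W' =
      starComp φ P W ≫ (onComod G).map (RComod.copowerMap g P.toRComod) :=
  (LaxModuleFunctor.Hom.nat ((LaxModuleFunctor.Hom.nat φ).app P.toStar)).naturality g

theorem starComp_comm (P : C.HComod) (X : RComod k H) (W : ModuleCat.{u} k) :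
    strOn F X (RComod.copower W P.toRComod) ≫ (onComod F).map (P.copowerStr X W) ≫
        starComp φ P (X.obj ⊗ W) =
      X ⊴ₗ starComp φ P W ≫ strOn G X (RComod.copower W P.toRComod) ≫
        (onComod G).map (P.copowerStr X W) := by
  have h := LaxModuleFunctor.Hom.comm ((LaxModuleFunctor.Hom.nat φ).app P.toStar) X W
  exact (Category.assoc _ _ _).symm.trans h

/-- Naturality of `φ` along `- ⊗ P ⟶ P ⊗ (- ⊗ C)`. Since `φ` is a morphism of module functors and
the structure morphisms of `F_*` and `G_*` have identity components, `φ` at `P ⊗ (- ⊗ C)`, evaluated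
at `W`, is `φ` at `- ⊗ C`, evaluated at `W ⊗ P`. -/
theorem starComp_coactHom (P : C.HComod) (W : ModuleCat.{u} k) :
    (onComod F).map (RComod.coactHom (RComod.copower W P.toRComod)) ≫
        starComp φ C.regular (W ⊗ P.obj) =
      starComp φ P W ≫ (onComod G).map (RComod.coactHom (RComod.copower W P.toRComod)) := by
  have h1 : (onComod F).map (RComod.coactHom (RComod.copower W P.toRComod)) ≫
      (LaxModuleFunctor.Hom.nat ((LaxModuleFunctor.Hom.nat φ).app
        (P.toHMod ⊙ₗ C.cofree))).app W =
      starComp φ P W ≫ (onComod G).map (RComod.coactHom (RComod.copower W P.toRComod)) :=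
    congrArg (fun α => (LaxModuleFunctor.Hom.nat α).app W)
      ((LaxModuleFunctor.Hom.nat φ).naturality P.coactStar)
  have h2 := congrArg (fun α => (LaxModuleFunctor.Hom.nat α).app W)
    (LaxModuleFunctor.Hom.comm φ P.toHMod C.cofree)
  have h3 : (LaxModuleFunctor.Hom.nat ((LaxModuleFunctor.Hom.nat φ).app
      (P.toHMod ⊙ₗ C.cofree))).app W = starComp φ C.regular (W ⊗ P.obj) :=
    (Category.id_comp _).symm.trans (h2.trans (Category.comp_id _))
  exact (congrArg ((onComod F).map (RComod.coactHom (RComod.copower W P.toRComod)) ≫ ·)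
    h3).symm.trans h1

/-- The component of a morphism `F_* ⟶ G_*` at the module functor `W ↦ W ⊗ C`. -/
def cofreeComp (W : ModuleCat.{u} k) :
    (onComod F).obj (RComod.copower W (RComod.regular k C.carrier)) ⟶
      (onComod G).obj (RComod.copower W (RComod.regular k C.carrier)) :=
  starComp φ C.regular W

theorem cofreeComp_naturality {W W' : ModuleCat.{u} k} (g : W ⟶ W') :
    (onComod F).map (RComod.copowerMap g (RComod.regular k C.carrier)) ≫ cofreeComp φ W' =
      cofreeComp φ W ≫ (onComod G).map (RComod.copowerMap g (RComod.regular k C.carrier)) :=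
  starComp_naturality φ C.regular g

theorem cofreeComp_comm (X : RComod k H) (M : RComod k C.carrier) :
    strOn F X (RComod.copower M.obj (RComod.regular k C.carrier)) ≫
        (onComod F).map (cofreeStr X M) ≫
          cofreeComp φ (RComod.tensor C.isModuleCoalgebra X M).obj =
      X ⊴ₗ cofreeComp φ M.obj ≫ strOn G X (RComod.copower M.obj (RComod.regular k C.carrier)) ≫
        (onComod G).map (cofreeStr X M) :=
  starComp_comm φ C.regular X M.obj

/-- The component of `φ` at `- ⊗ C` respects both arrows of the cofree resolution: `ρ ⊗ C` by
naturality in the vector space, and `M ⊗ Δ` by `starComp_coactHom` for `P = C`. It therefore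
restricts to the equalizers `F(M)` and `G(M)`. -/
theorem exists_unstarApp (M : RComod k C.carrier) :
    ∃ θ : (onComod F).obj M ⟶ (onComod G).obj M, θ ≫ (onComod G).map (RComod.coactHom M) =
      (onComod F).map (RComod.coactHom M) ≫ cofreeComp φ M.obj := by
  refine (isEqualizer_map_coactHom G M).exists_lift _ ?_
  have h1 := cofreeComp_naturality φ M.coactMap
  have h2 := starComp_coactHom φ C.regular M.obj
  have h3 := (isEqualizer_map_coactHom F M).w
  refine (Category.assoc _ _ _).trans (Eq.trans ?_ (Category.assoc _ _ _).symm)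
  refine (congrArg ((onComod F).map (RComod.coactHom M) ≫ ·) h1).symm.trans
    (Eq.trans ?_ (congrArg ((onComod F).map (RComod.coactHom M) ≫ ·) h2))
  refine (Category.assoc _ _ _).symm.trans (Eq.trans ?_ (Category.assoc _ _ _))
  exact congrArg (· ≫ cofreeComp φ _) h3

/-- The component at `M` of the morphism `F ⟶ G` given by a morphism `F_* ⟶ G_*`. -/
def unstarApp (M : RComod k C.carrier) : (onComod F).obj M ⟶ (onComod G).obj M :=
  (exists_unstarApp φ M).choose

theorem unstarApp_coactHom (M : RComod k C.carrier) :
    unstarApp φ M ≫ (onComod G).map (RComod.coactHom M) =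
      (onComod F).map (RComod.coactHom M) ≫ cofreeComp φ M.obj :=
  (exists_unstarApp φ M).choose_spec

theorem unstarApp_coactHom_assoc (M : RComod k C.carrier) {Z : N}
    (f : (onComod G).obj (RComod.copower M.obj (RComod.regular k C.carrier)) ⟶ Z) :
    unstarApp φ M ≫ (onComod G).map (RComod.coactHom M) ≫ f =
      (onComod F).map (RComod.coactHom M) ≫ cofreeComp φ M.obj ≫ f :=
  (Category.assoc _ _ _).symm.trans
    ((congrArg (· ≫ f) (unstarApp_coactHom φ M)).trans (Category.assoc _ _ _))

theorem unstarApp_naturality {M M' : RComod k C.carrier} (f : M ⟶ M') :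
    (onComod F).map f ≫ unstarApp φ M' = unstarApp φ M ≫ (onComod G).map f := by
  refine (isEqualizer_map_coactHom G M').hom_ext ?_
  rw [Category.assoc, Category.assoc, unstarApp_coactHom, ← Functor.map_comp,
    ← RComod.coactHom_naturality, Functor.map_comp, unstarApp_coactHom_assoc, ← Category.assoc,
    ← Functor.map_comp, ← RComod.coactHom_naturality, Functor.map_comp, Category.assoc,
    cofreeComp_naturality]


/-- Tested after the monomorphism `G(X ⊗ M) ⟶ G(X ⊗ M ⊗ C)`. The coaction of `X ⊗ M` factors through
the structure morphism of `- ⊗ C`, which the component of `φ` respects as a morphism of lax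
functors. -/
theorem unstarApp_comm (X : RComod k H) (M : RComod k C.carrier) :
    strOn F X M ≫ unstarApp φ (RComod.tensor C.isModuleCoalgebra X M) =
      X ⊴ₗ unstarApp φ M ≫ strOn G X M := by
  refine (isEqualizer_map_coactHom G _).hom_ext ?_
  have h1 := cofreeComp_comm φ X M
  have h2 : ∀ F : LFunctor k (RComod k H) C.Comod N,
      strOn F X M ≫ (onComod F).map (RComod.coactHom (RComod.tensor C.isModuleCoalgebra X M)) =
      X ⊴ₗ (onComod F).map (RComod.coactHom M) ≫
        strOn F X (RComod.copower M.obj (RComod.regular k C.carrier)) ≫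
          (onComod F).map (cofreeStr X M) := fun F => by
    rw [coactHom_tensor_eq, Functor.map_comp, ← Category.assoc, ← strOn_naturality_right,
      Category.assoc]
  rw [Category.assoc, Category.assoc, unstarApp_coactHom, h2, ← Category.assoc, h2,
    Category.assoc, Category.assoc, ← actionHomRight_comp_assoc, unstarApp_coactHom,
    actionHomRight_comp_assoc, h1]

/-- The morphism `F ⟶ G` given by a morphism `F_* ⟶ G_*`. -/
def unstar : F ⟶ G :=
  LaxModuleFunctor.Hom.mk (F := F.toLaxModuleFunctor) (G := G.toLaxModuleFunctor)
    { app := unstarApp φ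
      naturality := fun _ _ f => unstarApp_naturality φ f }
    (unstarApp_comm φ)

/-- Both sides solve the same lifting problem for the equalizer at `W ⊗ P`, by `starComp_coactHom`.
-/
theorem unstarApp_copower (P : C.HComod) (W : ModuleCat.{u} k) :
    unstarApp φ (RComod.copower W P.toRComod) = starComp φ P W := by
  refine (isEqualizer_map_coactHom G _).hom_ext ?_
  rw [unstarApp_coactHom]
  exact starComp_coactHom φ P W

/-- The two agree at the objects `- ⊗ P`, and every object of `(𝔐^C)_*` is isomorphic to one of
these. -/
theorem starMap₂_unstar : starMap₂ (unstar φ) = φ := by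
  have h : ∀ P : C.HComod, (LaxModuleFunctor.Hom.nat (starMap₂ (unstar φ))).app P.toStar =
      (LaxModuleFunctor.Hom.nat φ).app P.toStar := fun P =>
    LFunctor.hom_ext fun W => unstarApp_copower φ P W
  refine LaxModuleFunctor.hom_ext fun T => ?_
  have h1 := (LaxModuleFunctor.Hom.nat (starMap₂ (unstar φ))).naturality (toStarFiberIso T).hom
  have h2 := (LaxModuleFunctor.Hom.nat φ).naturality (toStarFiberIso T).hom
  rw [← cancel_epi ((starLax F).functor.map (toStarFiberIso T).hom)]
  refine h1.trans (Eq.trans ?_ h2.symm)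
  exact congrArg (· ≫ (starLax G).functor.map (toStarFiberIso T).hom) (h (fiberHComod T))

theorem starMap₂_bijective : Function.Bijective (starMap₂ (F := F) (G := G)) :=
  ⟨starMap₂_injective, fun φ => ⟨unstar φ, starMap₂_unstar φ⟩⟩

end

end ModuleCoalgebra

end FullyFaithful

/-! ### The functor `F ↦ F_*` is essentially surjective -/

section EssentiallySurjective

open Functor.LaxLeftLinear

/-! ### Strong module functors applied to morphisms `T₁ ⟶ V ⊗ T₂`. -/

namespace LaxModuleFunctor

variable {A : Type*} [Category* A] [MonoidalCategory A] {S S' : Type*} [Category* S] [Category* S']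
  [MonoidalLeftAction A S] [MonoidalLeftAction A S']

section

variable (Φ : LaxModuleFunctor A S S') (hΦ : Φ.IsStrong)

/-- The structure isomorphism `V ⊗ Φ(T) ≅ Φ(V ⊗ T)` of a strong module functor. -/
@[simps! hom]
def strIso (V : A) (T : S) : V ⊙ₗ Φ.functor.obj T ≅ Φ.functor.obj (V ⊙ₗ T) :=
  haveI := hΦ V T
  asIso (Φ.str V T)

/-- The morphism `Φ(S) ⟶ V ⊗ Φ(T)` given by a morphism `S ⟶ V ⊗ T`. -/
def mapInto {T₁ T₂ : S} {V : A} (d : T₁ ⟶ V ⊙ₗ T₂) :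
    Φ.functor.obj T₁ ⟶ V ⊙ₗ Φ.functor.obj T₂ :=
  Φ.functor.map d ≫ (Φ.strIso hΦ V T₂).inv

theorem mapInto_str {T₁ T₂ : S} {V : A} (d : T₁ ⟶ V ⊙ₗ T₂) :
    Φ.mapInto hΦ d ≫ Φ.str V T₂ = Φ.functor.map d := by
  rw [mapInto, Category.assoc, ← strIso_hom _ hΦ, Iso.inv_hom_id, Category.comp_id]

theorem map_mapInto {T₀ T₁ T₂ : S} {V : A} (f : T₀ ⟶ T₁) (d : T₁ ⟶ V ⊙ₗ T₂) :
    Φ.functor.map f ≫ Φ.mapInto hΦ d = Φ.mapInto hΦ (f ≫ d) := by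
  rw [mapInto, mapInto, Functor.map_comp, Category.assoc]

theorem mapInto_actionHomLeft {T₁ T₂ : S} {V V' : A} (d : T₁ ⟶ V ⊙ₗ T₂) (f : V ⟶ V') :
    Φ.mapInto hΦ d ≫ f ⊵ₗ Φ.functor.obj T₂ = Φ.mapInto hΦ (d ≫ f ⊵ₗ T₂) := by
  have := hΦ V' T₂
  rw [← cancel_mono (Φ.str V' T₂), Category.assoc, mapInto_str, μₗ_naturality_left,
    ← Category.assoc, mapInto_str, Functor.map_comp]

theorem str_mapInto {T₁ T₂ : S} {V V' : A} (d : T₁ ⟶ V ⊙ₗ T₂) :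
    Φ.str V' T₁ ≫ Φ.mapInto hΦ (V' ⊴ₗ d ≫ (αₗ V' V T₂).inv) =
      V' ⊴ₗ Φ.mapInto hΦ d ≫ (αₗ V' V (Φ.functor.obj T₂)).inv := by
  have := hΦ (V' ⊗ V) T₂
  rw [← cancel_mono (Φ.str (V' ⊗ V) T₂), Category.assoc, mapInto_str, Functor.map_comp,
    ← μₗ_naturality_right_assoc, Category.assoc, ← μₗ_associativity_inv,
    ← actionHomRight_comp_assoc, mapInto_str]

/-- `Φ` preserves the equalizer, and its structure isomorphisms rewrite the image as an equalizer of
a pair formed from the action on `Φ(T₂)`. That pair depends on `Φ` only through `Φ(T₂)` and the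
image of `d`. -/
theorem isEqualizer_mapInto [PreservesFiniteLimits Φ.functor] {T₁ T₂ : S} {V R : A}
    {h : T₁ ⟶ V ⊙ₗ T₂} {σ : V ⟶ V ⊗ R} {d : T₂ ⟶ R ⊙ₗ T₂}
    (H : IsEqualizer h (σ ⊵ₗ T₂ ≫ (αₗ V R T₂).hom) (V ⊴ₗ d)) :
    IsEqualizer (Φ.mapInto hΦ h)
      (σ ⊵ₗ Φ.functor.obj T₂ ≫ (αₗ V R (Φ.functor.obj T₂)).hom) (V ⊴ₗ Φ.mapInto hΦ d) := by
  have h1 : Φ.str V T₂ ≫ Φ.functor.map (σ ⊵ₗ T₂ ≫ (αₗ V R T₂).hom) =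
      (σ ⊵ₗ Φ.functor.obj T₂ ≫ (αₗ V R (Φ.functor.obj T₂)).hom) ≫
        V ⊴ₗ Φ.str R T₂ ≫ Φ.str V (R ⊙ₗ T₂) := by
    rw [Functor.map_comp, ← μₗ_naturality_left_assoc, μₗ_associativity, Category.assoc]
  have h2 : Φ.str V T₂ ≫ Φ.functor.map (V ⊴ₗ d) =
      V ⊴ₗ Φ.mapInto hΦ d ≫ V ⊴ₗ Φ.str R T₂ ≫ Φ.str V (R ⊙ₗ T₂) := by
    rw [← μₗ_naturality_right, ← actionHomRight_comp_assoc, mapInto_str]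
  have := hΦ R T₂
  let l : V ⊙ₗ R ⊙ₗ Φ.functor.obj T₂ ≅ Φ.functor.obj (V ⊙ₗ R ⊙ₗ T₂) :=
    asIso (V ⊴ₗ Φ.str R T₂) ≪≫ Φ.strIso hΦ V (R ⊙ₗ T₂)
  have hl : l.hom = V ⊴ₗ Φ.str R T₂ ≫ Φ.str V (R ⊙ₗ T₂) := rfl
  refine (H.map Φ.functor).of_iso (Iso.refl _) (Φ.strIso hΦ V T₂).symm l.symm ?_ ?_ ?_
  · exact (Category.id_comp _).symm
  · rw [Iso.symm_hom, Iso.symm_hom, Iso.comp_inv_eq, Category.assoc, Iso.eq_inv_comp, strIso_hom,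
      h1, hl]
  · rw [Iso.symm_hom, Iso.symm_hom, Iso.comp_inv_eq, Category.assoc, Iso.eq_inv_comp, strIso_hom,
      h2, hl]

end

end LaxModuleFunctor

open scoped TensorProduct

/-- Bookkeeping for `coactFork`: `i` and `j` are images of the identity structure morphisms of the
forgetful functor, and they have to be removed from a composite. -/
theorem comp_id_comp_eq {A : Type*} [Category* A] {X Y Z X' Z' : A} {a : X ⟶ Y} {i : Y ⟶ Y}
    {c : Y ⟶ Z} {c' : Y ⟶ Z'} {c'' : Z' ⟶ Z} {x : X ⟶ X'} {y : X' ⟶ Z'} {j : Z ⟶ Z}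
    (hi : i = 𝟙 Y) (hj : j = 𝟙 Z) (hc : c = c' ≫ c'') (h : a ≫ c' = x ≫ y) :
    (a ≫ i) ≫ c = x ≫ (y ≫ c'') ≫ j := by
  subst hi hj hc
  rw [Category.comp_id, Category.comp_id, ← Category.assoc, h, Category.assoc]

variable {k : Type u} [Field k] {H : Type u} [Ring H] [Bialgebra k H]

namespace ModuleCoalgebra

variable {C : ModuleCoalgebra k H}

namespace HComod

theorem toStarFunctor_map_coactStar {P Q : C.HComod} (f : P ⟶ Q) :
    (toStarFunctor C).map f ≫ Q.coactStar = P.coactStar ≫ homToHMod f ⊵ₗ C.cofree :=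
  LFunctor.hom_ext fun W => (RComod.coactHom_naturality (toStarMapApp f W)).symm

/-- The coaction on `V ⊗ P` involves `P` only. With naturality in `P`, this says that the coactions
assemble into a morphism of `_H𝔐`-module functors. -/
theorem toStarStr_coactStar (V : HMod k H) (P : C.HComod) :
    (toStarStr V P).hom ≫ (tensor V P).coactStar =
      V ⊴ₗ P.coactStar ≫ (αₗ V P.toHMod C.cofree).inv :=
  LFunctor.hom_ext fun W => by
    have h := (RComod.coactHom_naturality (copowerAssoc V P W).hom).symm
    refine h.trans ?_
    exact congrArg (RComod.coactHom (RComod.copower (W ⊗ V.obj) P.toRComod) ≫ ·)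
      (Category.id_comp (RComod.copowerMap (copowerAssoc V P W).hom.hom
        (RComod.regular k C.carrier))).symm

end HComod

variable {N : Type*} [Category* N] [Preadditive N] [Linear k N]
  [MonoidalLeftAction (RComod k H) N] {L : Star k H N}
  (d : L ⟶ C.regular.toHMod ⊙ₗ L)

variable (L) in
/-- The morphism `L(M) ⟶ L(M ⊗ C)` given by the coaction of `M`. -/
def coactFork : C.forgetL.comp L ⟶ C.forgetL.comp (C.regular.toHMod ⊙ₗ L) :=
  LaxModuleFunctor.Hom.mk (F := C.forgetLax.comp L.toLaxModuleFunctor)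
    (G := C.forgetLax.comp (C.regular.toHMod.tensorRightLax.comp L.toLaxModuleFunctor))
    { app := fun (M : RComod k C.carrier) => L.functor.map M.coactMap
      naturality := fun (M M' : RComod k C.carrier) (f : RComod.Hom M M') => by
        have h : f.hom ≫ M'.coactMap = M.coactMap ≫ f.hom ▷ (RComod.regular k C.carrier).obj :=
          ModuleCat.hom_ext f.comm
        exact (L.functor.map_comp _ _).symm.trans
          ((congrArg L.functor.map h).trans (L.functor.map_comp _ _)) }
    fun X (M : RComod k C.carrier) => by
      -- The factorization of the coaction of `X ⊗ M` through the structure morphism of `- ⊗ C`, on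
      -- vector spaces.
      have h : (RComod.tensor C.isModuleCoalgebra X M).coactMap =
          X.obj ◁ M.coactMap ≫ (C.regular.copowerStr X M.obj).hom :=
        ModuleCat.hom_ext (tensorCoact_eq_twist C.act X.coact M.coact)
      have h1 : L.str X M.obj ≫ L.functor.map (X.obj ◁ M.coactMap) =
          X ⊴ₗ L.functor.map M.coactMap ≫ L.str X (M.obj ⊗ (RComod.regular k C.carrier).obj) :=
        (L.lax.μₗ_naturality_right X M.coactMap).symm
      have h2 : L.functor.map (𝟙 (X.obj ⊗ M.obj)) = 𝟙 _ := L.functor.map_id _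
      have h3 : L.functor.map (𝟙 (X.obj ⊗ M.obj) ▷ (RComod.regular k C.carrier).obj) = 𝟙 _ :=
        (L.functor.congr_map (MonoidalCategory.id_whiskerRight _ _)).trans (L.functor.map_id _)
      exact comp_id_comp_eq h2 h3 ((L.functor.congr_map h).trans (L.functor.map_comp _ _)) h1

/-- The morphism `L(M) ⟶ L(M ⊗ C)` given by a morphism `L ⟶ C ⊗ L`. -/
def cofreeFork : C.forgetL.comp L ⟶ C.forgetL.comp (C.regular.toHMod ⊙ₗ L) :=
  LaxModuleFunctor.whiskerLeft C.forgetLax d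

section

variable {F : LFunctor k (RComod k H) C.Comod N} (ι : F ⟶ C.forgetL.comp L)

/-- The components of a morphism to `L ∘ U`, where `U` is the forgetful functor. -/
def forkApp (M : RComod k C.carrier) : (onComod F).obj M ⟶ L.functor.obj M.obj :=
  (LaxModuleFunctor.Hom.nat ι).app M

theorem forkApp_naturality {M M' : RComod k C.carrier} (f : M ⟶ M') :
    (onComod F).map f ≫ forkApp ι M' = forkApp ι M ≫ L.functor.map f.hom :=
  (LaxModuleFunctor.Hom.nat ι).naturality f

theorem forkApp_comm (X : RComod k H) (M : RComod k C.carrier) :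
    strOn F X M ≫ forkApp ι (RComod.tensor C.isModuleCoalgebra X M) =
      X ⊴ₗ forkApp ι M ≫ L.str X M.obj :=
  (LaxModuleFunctor.Hom.comm ι X M).trans (congrArg (X ⊴ₗ forkApp ι M ≫ ·)
    ((congrArg (L.str X M.obj ≫ ·) (L.functor.map_id _)).trans (Category.comp_id _)))

/-- The morphism `F ∘ (- ⊗ P) ⟶ P ⊗ L`. -/
def forkStar (P : C.HComod) : P.toStar.comp F ⟶ P.toHMod ⊙ₗ L :=
  LaxModuleFunctor.Hom.mk (F := P.copowerLax.comp F.toLaxModuleFunctor)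
    (G := P.toHMod.tensorRightLax.comp L.toLaxModuleFunctor)
    { app := fun W => forkApp ι (RComod.copower W P.toRComod)
      naturality := fun _ _ f => forkApp_naturality ι (RComod.copowerMap f P.toRComod) }
    fun X W => by
      have h1 := forkApp_comm ι X (RComod.copower W P.toRComod)
      have h2 := forkApp_naturality ι (P.copowerStr X W)
      refine (Category.assoc _ _ _).trans ?_
      refine (congrArg (strOn F X (RComod.copower W P.toRComod) ≫ ·) h2).trans ?_
      refine (Category.assoc _ _ _).symm.trans ?_
      refine (congrArg (· ≫ L.functor.map (P.copowerStr X W).hom) h1).trans ?_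
      exact Category.assoc _ _ _

/-- At `W` this is the defining equalizer of `F` at the comodule `W ⊗ P`; by `ev_coactLeft` the
coaction there is `coactLeft`. -/
theorem isEqualizer_forkStar {d : L ⟶ C.regular.toHMod ⊙ₗ L}
    (H : ∀ M : C.Comod, IsEqualizer ((LFunctor.ev k (RComod k H) N M).map ι)
      ((LFunctor.ev k (RComod k H) N M).map (coactFork L))
      ((LFunctor.ev k (RComod k H) N M).map (cofreeFork d))) (P : C.HComod) :
    IsEqualizer (forkStar ι P) (P.coactLeft L) (P.toHMod ⊴ₗ d) :=
  LFunctor.isEqualizer_of_ev fun W => by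
    rw [HComod.ev_coactLeft]
    exact H (RComod.copower W P.toRComod)

theorem starLax_map_forkStar {P Q : C.HComod} (f : P ⟶ Q) :
    (starLax F).functor.map ((HComod.toStarFunctor C).map f) ≫ forkStar ι Q =
      forkStar ι P ≫ HComod.homToHMod f ⊵ₗ L :=
  LFunctor.hom_ext fun W => forkApp_naturality ι (HComod.toStarMapApp f W)

/-- The exact counterpart, for `F_*`, of the identity satisfied by `mapCoact` for `Φ`. The matching
right-hand sides make the comparison isomorphism a morphism of module functors. -/
theorem toStarStr_forkStar (V : HMod k H) (P : C.HComod) :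
    (starLax F).str V P.toStar ≫ (starLax F).functor.map (HComod.toStarStr V P).hom ≫
        forkStar ι (HComod.tensor V P) =
      V ⊴ₗ forkStar ι P ≫ (αₗ V P.toHMod L).inv :=
  LFunctor.hom_ext fun W => by
    refine (Category.id_comp _).trans ?_
    refine (forkApp_naturality ι (HComod.copowerAssoc V P W).hom).trans ?_
    exact congrArg (forkApp ι (RComod.copower (W ⊗ V.obj) P.toRComod) ≫ ·)
      (Category.id_comp (L.functor.map (HComod.copowerAssoc V P W).hom.hom)).symm

end

end ModuleCoalgebra

end EssentiallySurjective

/-! ### Every strong left exact functor `(𝔐^C)_* ⟶ N_*` is isomorphic to some `F_*`. -/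

section Realization

namespace LaxModuleFunctor

variable {A : Type*} [Category* A] [MonoidalCategory A] {S S' S'' : Type*} [Category* S]
  [Category* S'] [Category* S''] [MonoidalLeftAction A S] [MonoidalLeftAction A S']
  [MonoidalLeftAction A S'']

/-- A strong equivalence can be cancelled on the source side, by whiskering with its lax right
adjoint. It suffices therefore to compare `F_*` and `Φ` on the objects `- ⊗ P`. -/
theorem nonempty_iso_of_comp {E : LaxModuleFunctor A S S'} (hE : E.IsStrong)
    [E.functor.IsEquivalence] {F G : LaxModuleFunctor A S' S''} (e : comp E F ≅ comp E G) :
    Nonempty (F ≅ G) := by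
  let adj := E.functor.asEquivalence.toAdjunction
  have : IsIso (E.rightAdjointCounit hE adj).nat := inferInstanceAs (IsIso adj.counit)
  let i : comp (E.rightAdjoint hE adj) E ≅ id S' := isoOfNatIsIso (E.rightAdjointCounit hE adj)
  exact ⟨(idComp F).symm ≪≫ whiskerRightIso i.symm F ≪≫ assoc _ _ _ ≪≫
    whiskerLeftIso (E.rightAdjoint hE adj) e ≪≫ (assoc _ _ _).symm ≪≫ whiskerRightIso i G ≪≫
      idComp G⟩

end LaxModuleFunctor

variable {k : Type u} [Field k] {H : Type u} [Ring H] [Bialgebra k H]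
  {N : Type*} [Category* N] [Preadditive N] [Linear k N] [MonoidalLeftAction (RComod k H) N]

namespace ModuleCoalgebra

variable {C : ModuleCoalgebra k H}

section

variable {Φ : LaxModuleFunctor (HMod k H) (Star k H C.Comod) (Star k H N)} (hΦ : Φ.IsStrong)

/-- The morphism `Φ(- ⊗ P) ⟶ P ⊗ Φ(- ⊗ C)` given by the coaction of `P`. -/
def mapCoact (P : C.HComod) :
    Φ.functor.obj P.toStar ⟶ P.toHMod ⊙ₗ Φ.functor.obj C.cofree :=
  Φ.mapInto hΦ P.coactStar

/-- `Φ` applied to the cofree resolution of `- ⊗ P`. The resulting pair is formed from `P`, the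
object `L = Φ(- ⊗ C)` and the image of the comultiplication. -/
theorem isEqualizer_mapCoact [PreservesFiniteLimits Φ.functor] (P : C.HComod) :
    IsEqualizer (mapCoact hΦ P) (P.coactLeft (Φ.functor.obj C.cofree))
      (P.toHMod ⊴ₗ mapCoact hΦ C.regular) :=
  Φ.isEqualizer_mapInto hΦ P.isEqualizer_coactStar

theorem map_mapCoact {P Q : C.HComod} (f : P ⟶ Q) :
    Φ.functor.map ((HComod.toStarFunctor C).map f) ≫ mapCoact hΦ Q =
      mapCoact hΦ P ≫ HComod.homToHMod f ⊵ₗ Φ.functor.obj C.cofree :=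
  (Φ.map_mapInto hΦ ((HComod.toStarFunctor C).map f) Q.coactStar).trans
    ((congrArg (Φ.mapInto hΦ) (HComod.toStarFunctor_map_coactStar f)).trans
      (Φ.mapInto_actionHomLeft hΦ P.coactStar (HComod.homToHMod f)).symm)

theorem str_mapCoact (V : HMod k H) (P : C.HComod) :
    Φ.str V P.toStar ≫ Φ.functor.map (HComod.toStarStr V P).hom ≫
        mapCoact hΦ (HComod.tensor V P) =
      V ⊴ₗ mapCoact hΦ P ≫ (αₗ V P.toHMod (Φ.functor.obj C.cofree)).inv := by
  have h1 : Φ.functor.map (HComod.toStarStr V P).hom ≫ mapCoact hΦ (HComod.tensor V P) =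
      Φ.mapInto hΦ (V ⊴ₗ P.coactStar ≫ (αₗ V P.toHMod C.cofree).inv) :=
    (Φ.map_mapInto hΦ (HComod.toStarStr V P).hom (HComod.tensor V P).coactStar).trans
      (congrArg (Φ.mapInto hΦ) (HComod.toStarStr_coactStar V P))
  exact (congrArg (Φ.str V P.toStar ≫ ·) h1).trans (Φ.str_mapInto hΦ P.coactStar)

end

section

variable {Φ : LaxModuleFunctor (HMod k H) (Star k H C.Comod) (Star k H N)} (hΦ : Φ.IsStrong)
  {F : LFunctor k (RComod k H) C.Comod N} {ι : F ⟶ C.forgetL.comp (Φ.functor.obj C.cofree)}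
  {τ : ∀ P : C.HComod, P.toStar.comp F ≅ Φ.functor.obj P.toStar}
  (hτ : ∀ P, (τ P).hom ≫ mapCoact hΦ P = forkStar ι P)
  (hm : ∀ P, Mono (mapCoact hΦ P))

include hτ hm

/-- Both sides agree after the monomorphism into `Q ⊗ L`, because the equalizer morphisms of `F_*`
and of `Φ` have the same naturality. Compatibility with the action of `V` is proved in the same way
in `star_comm`. -/
theorem star_naturality {P Q : C.HComod} (f : P ⟶ Q) :
    (starLax F).functor.map ((HComod.toStarFunctor C).map f) ≫ (τ Q).hom =
      (τ P).hom ≫ Φ.functor.map ((HComod.toStarFunctor C).map f) := by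
  have := hm Q
  have h1 := starLax_map_forkStar ι f
  have h2 := map_mapCoact hΦ f
  refine (cancel_mono (mapCoact hΦ Q)).1 ?_
  refine (Category.assoc _ _ _).trans ?_
  refine (congrArg ((starLax F).functor.map ((HComod.toStarFunctor C).map f) ≫ ·)
    (hτ Q)).trans (h1.trans ?_)
  refine (congrArg (· ≫ HComod.homToHMod f ⊵ₗ _) (hτ P)).symm.trans ?_
  refine (Category.assoc _ _ _).trans ?_
  exact (congrArg ((τ P).hom ≫ ·) h2).symm.trans (Category.assoc _ _ _).symm

theorem star_comm (V : HMod k H) (P : C.HComod) :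
    ((starLax F).str V P.toStar ≫ (starLax F).functor.map (HComod.toStarStr V P).hom) ≫
        (τ (HComod.tensor V P)).hom =
      V ⊴ₗ (τ P).hom ≫ Φ.str V P.toStar ≫ Φ.functor.map (HComod.toStarStr V P).hom := by
  have := hm (HComod.tensor V P)
  have h1 := toStarStr_forkStar ι V P
  have h2 := str_mapCoact hΦ V P
  refine (cancel_mono (mapCoact hΦ (HComod.tensor V P))).1 ?_
  refine (Category.assoc _ _ _).trans ?_
  refine (congrArg (((starLax F).str V P.toStar ≫
    (starLax F).functor.map (HComod.toStarStr V P).hom) ≫ ·) (hτ _)).trans ?_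
  refine (Category.assoc _ _ _).trans (h1.trans ?_)
  rw [← hτ P, actionHomRight_comp, Category.assoc]
  refine (congrArg (V ⊴ₗ (τ P).hom ≫ ·) h2).symm.trans ?_
  exact (congrArg (V ⊴ₗ (τ P).hom ≫ ·) (Category.assoc _ _ _)).symm.trans
    (Category.assoc _ _ _).symm

/-- The comparison isomorphism `F_* ≅ Φ`, restricted to `_H𝔐^C`. -/
def starCompToStarIso :
    (HComod.toStarLax C).comp (starLax F) ≅ (HComod.toStarLax C).comp Φ :=
  LaxModuleFunctor.isoMk
    (NatIso.ofComponents τ fun f => star_naturality hΦ hτ hm f)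
    fun V P => star_comm hΦ hτ hm V P

end

/-- `F` is the cotensor product of a comodule with `L = Φ(- ⊗ C)`: the equalizer of the two
morphisms `L(M) ⇉ L(M ⊗ C)`. The hypotheses on `N` make this equalizer exist among functors of type
`ℒ` and be computed pointwise. -/
theorem exists_starLax_iso [HasFiniteLimits N] [HasCoproducts.{u} N]
    [∀ S : Type u, PreservesFiniteLimits (colim : (Discrete S ⥤ N) ⥤ N)]
    {Φ : LaxModuleFunctor (HMod k H) (Star k H C.Comod) (Star k H N)} (hΦ : Φ.IsStrong)
    [PreservesFiniteLimits Φ.functor] :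
    ∃ F : LFunctor k (RComod k H) C.Comod N, Nonempty (starLax F ≅ Φ) := by
  have : HasLimitsOfShape WalkingParallelPair (LFunctor k (RComod k H) C.Comod N) :=
    LFunctor.hasLimitsOfShape
  let u := coactFork (C := C) (Φ.functor.obj C.cofree)
  let v := cofreeFork (mapCoact hΦ C.regular)
  have h1 : IsEqualizer (equalizer.ι u v) u v :=
    IsEqualizer.of_isLimit (equalizerIsEqualizer u v)
  have h2 : ∀ M : C.Comod, IsEqualizer
      ((LFunctor.ev k (RComod k H) N M).map (equalizer.ι u v))
      ((LFunctor.ev k (RComod k H) N M).map u) ((LFunctor.ev k (RComod k H) N M).map v) :=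
    fun M =>
      have : PreservesLimitsOfShape WalkingParallelPair (LFunctor.ev k (RComod k H) N M) :=
        LFunctor.preservesLimitsOfShape_ev M
      h1.map _
  have h3 := fun P => isEqualizer_forkStar (equalizer.ι u v) h2 P
  have h4 := fun P => isEqualizer_mapCoact hΦ P
  -- For each `P`, `h3` and `h4` are equalizers of the same pair `P ⊗ L ⇉ P ⊗ C ⊗ L`. The choices
  -- need no coherence, since `hτ` determines `τ`.
  choose τ hτ using fun P => (h3 P).exists_iso (h4 P)
  have : (HComod.toStarLax C).functor.IsEquivalence :=
    inferInstanceAs (HComod.toStarFunctor C).IsEquivalence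
  exact ⟨equalizer u v, LaxModuleFunctor.nonempty_iso_of_comp HComod.toStarLax_isStrong
    (starCompToStarIso hΦ hτ fun P => (h4 P).mono)⟩

end ModuleCoalgebra

end Realization

/-! ### The 2-equivalence -/

section PseudofunctorTransport

open Bicategory

universe w₁ w₂ v₁ v₂ u₁ u₂

variable {B : Type u₁} [Bicategory.{w₁, v₁} B] {B' : Type u₂} [Bicategory.{w₂, v₂} B']

theorem precomp_isEquivalence {a b : B} {f : a ⟶ b} {g : b ⟶ a} (i : 𝟙 a ≅ f ≫ g)
    (j : g ≫ f ≅ 𝟙 b) (c : B) : (precomp c f).IsEquivalence :=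
  (CategoryTheory.Equivalence.mk (precomp c f) (precomp c g)
    ((leftUnitorNatIso b c).symm ≪≫ (precomposing b b c).mapIso j.symm ≪≫
      associatorNatIsoRight g f c)
    ((associatorNatIsoRight f g c).symm ≪≫ (precomposing a a c).mapIso i.symm ≪≫
      leftUnitorNatIso a c)).isEquivalence_functor

/-- The comparison 2-cells `F.mapComp f h` fill a square whose other sides are `F.mapFunctor b c`
and precomposition with `f` and with `F.map f`. These three are equivalences, hence so is the
fourth. -/
theorem mapFunctor_isEquivalence_of_equivalence (F : Pseudofunctor B B') {a b : B} {f : a ⟶ b}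
    {g : b ⟶ a} (i : 𝟙 a ≅ f ≫ g) (j : g ≫ f ≅ 𝟙 b) (c : B)
    [(F.mapFunctor b c).IsEquivalence] : (F.mapFunctor a c).IsEquivalence := by
  have := precomp_isEquivalence i j c
  have := precomp_isEquivalence ((F.mapId a).symm ≪≫ F.map₂Iso i ≪≫ F.mapComp f g)
    ((F.mapComp g f).symm ≪≫ F.map₂Iso j ≪≫ F.mapId b) (F.obj c)
  let e : precomp c f ⋙ F.mapFunctor a c ≅ F.mapFunctor b c ⋙ precomp (F.obj c) (F.map f) :=
    NatIso.ofComponents (fun h => F.mapComp f h) fun θ => by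
      change F.map₂ (f ◁ θ) ≫ _ = _ ≫ F.map f ◁ F.map₂ θ
      simp
  have : (precomp c f ⋙ F.mapFunctor a c).IsEquivalence := Functor.isEquivalence_of_iso e.symm
  exact Functor.isEquivalence_of_comp_left (precomp c f) (F.mapFunctor a c)

end PseudofunctorTransport

/-! ### Assembly of the 2-equivalence. -/

section TwoEquivalence

variable {k : Type u} [Field k] {H : Type u} [Ring H] [Bialgebra k H]

/-- The 0-cell `𝔐^C`. -/
def ModuleCoalgebra.comodModCat (C : ModuleCoalgebra k H) : ComodModCat.{u, u + 1} k H where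
  carrier := C.Comod
  exists_equiv := ⟨C, LaxModuleFunctor.id _, LaxModuleFunctor.id _,
    inferInstanceAs (𝟭 C.Comod).Additive, inferInstanceAs ((𝟭 C.Comod).Linear k),
    inferInstanceAs (𝟭 C.Comod).Additive, inferInstanceAs ((𝟭 C.Comod).Linear k),
    ⟨LaxModuleFunctor.idComp _⟩, ⟨LaxModuleFunctor.idComp _⟩⟩

theorem ComodModCat.exists_iso_comodModCat (M : ComodModCat.{u, u + 1} k H) :
    ∃ (C : ModuleCoalgebra k H) (f : M ⟶ C.comodModCat) (g : C.comodModCat ⟶ M),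
      Nonempty (𝟙 M ≅ f ≫ g) ∧ Nonempty (g ≫ f ≅ 𝟙 C.comodModCat) := by
  obtain ⟨C, hC⟩ := M.exists_equiv
  obtain ⟨e⟩ := hC.nonempty_lEquivalence
  exact ⟨C, e.functor, e.inverse, ⟨e.unitIso⟩, ⟨e.counitIso⟩⟩

variable (h₀ : StarIsModModCat.{u, u + 1} k H) (h₁ : StarIsLeftExact.{u, u + 1} k H)

/-- Only the source has to be of the form `𝔐^C`. From the target one needs finite limits and exact
coproducts, which it has as a category equivalent to some `𝔐^D`. -/
theorem ModuleCoalgebra.starFunctor_mapFunctor_isEquivalence (C : ModuleCoalgebra k H)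
    (N : ComodModCat.{u, u + 1} k H) :
    ((starFunctor h₀ h₁).mapFunctor C.comodModCat N).IsEquivalence where
  faithful := ⟨fun {F G} _ _ h => (starMap₂_bijective (C := C) (F := F) (G := G)).1 h⟩
  full := ⟨fun {F G} => (starMap₂_bijective (C := C) (F := F) (G := G)).2⟩
  essSurj := ⟨fun Φ => by
    obtain ⟨D, hD⟩ := N.exists_equiv
    obtain ⟨e⟩ := hD.nonempty_lEquivalence
    have := hasFiniteLimits_of_equivalence e.equivalence
    have := hasCoproducts_of_equivalence e.equivalence
    have := preservesFiniteLimits_colim e.equivalence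
    let Ψ : LeftExactStrongFunctor (HMod k H) (Star k H C.Comod) (Star k H N.carrier) := Φ
    have := Ψ.leftExact
    obtain ⟨F, ⟨i⟩⟩ := exists_starLax_iso (C := C) (Φ := Ψ.toLaxModuleFunctor) Ψ.strong
    exact ⟨F, ⟨LeftExactStrongFunctor.isoMk (F := ((starFunctor h₀ h₁).mapFunctor
      C.comodModCat N).obj F) (G := Ψ) i⟩⟩⟩

theorem starFunctor_mapFunctor_isEquivalence (M N : ComodModCat.{u, u + 1} k H) :
    ((starFunctor h₀ h₁).mapFunctor M N).IsEquivalence := by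
  obtain ⟨C, f, g, ⟨i⟩, ⟨j⟩⟩ := M.exists_iso_comodModCat
  have := C.starFunctor_mapFunctor_isEquivalence h₀ h₁ N
  exact mapFunctor_isEquivalence_of_equivalence (starFunctor h₀ h₁) i j N

/-- Quasi-inverse lax module functors are automatically strong and left exact, so they are 1-cells.
-/
theorem ModModCat.nonempty_equivalence {M N : ModModCat.{v, w} k H}
    (h : ModuleEquivalent (HMod k H) M.carrier N.carrier) :
    Nonempty (Bicategory.Equivalence M N) := by
  obtain ⟨F, G, ⟨e⟩, ⟨e'⟩⟩ := h
  have := LaxModuleFunctor.isEquivalence_of_inverse e e'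
  have := LaxModuleFunctor.isEquivalence_of_inverse e' e
  let F' : M ⟶ N := LeftExactStrongFunctor.mk F (LaxModuleFunctor.isStrong_of_inverse e e')
    inferInstance
  let G' : N ⟶ M := LeftExactStrongFunctor.mk G (LaxModuleFunctor.isStrong_of_inverse e' e)
    inferInstance
  exact ⟨Bicategory.Equivalence.mkOfAdjointifyCounit (f := F') (g := G')
    (LeftExactStrongFunctor.isoMk e.symm) (LeftExactStrongFunctor.isoMk e')⟩

/-- A 0-cell equivalent to `_H𝔐^C` is hit, up to equivalence, by `𝔐^C`, since `(𝔐^C)_*` is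
equivalent to `_H𝔐^C`. -/
theorem isTwoEquivalence_starFunctor : IsTwoEquivalence (starFunctor h₀ h₁) := by
  refine ⟨fun b => ?_, starFunctor_mapFunctor_isEquivalence h₀ h₁⟩
  obtain ⟨C, hC⟩ := b.exists_equiv
  exact ⟨C.comodModCat, ModModCat.nonempty_equivalence (M := (starFunctor h₀ h₁).obj C.comodModCat)
    (C.star_moduleEquivalent.trans hC.symm)⟩

end TwoEquivalence

end ModuleDuality

end

/-- The universe levels are those of the categories `𝔐^C`, so that these are themselves 0-cells of
the source. -/
theorem mainTheorem5 {k : Type u} [Field k] {H : Type u} [Ring H] [Bialgebra k H] :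
    ∃ (h₀ : ModuleDuality.StarIsModModCat.{u, u + 1} k H)
      (h₁ : ModuleDuality.StarIsLeftExact.{u, u + 1} k H),
      ModuleDuality.IsTwoEquivalence (ModuleDuality.starFunctor h₀ h₁) :=
  ⟨ModuleDuality.starIsModModCat k H, ModuleDuality.starIsLeftExact k H,
    ModuleDuality.isTwoEquivalence_starFunctor _ _⟩
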